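/- Let $Q=(a,b)$, $a<b$, be a bounded interval; $J$ always denotes a nondegenerate open subinterval, $\langle f\rangle_J=\frac1{|J|}\int_J f$. For $p\ge 1$ and $\varphi$ locally integrable on $Q$ put $$\|\varphi\|_{\mathrm{BMO}^p(Q)}=\sup_{J\subseteq Q}\big\langle|\varphi-\langle\varphi\rangle_J|^p\big\rangle_J^{1/p}\in[0,\infty].$$ A weight $w$ (an a.e. positive function on $Q$) belongs to $A_\infty(Q)$ if $w$ and $\log w$ are locally integrable on $Q$ and $$[w]_{A_\infty(Q)}=\sup_{J\subseteq Q}\langle w\rangle_J\,e^{-\langle\log w\rangle_J}<\infty .$$ (In both suprema, a term for an interval $J$ over which $\varphi$, respectively $\log w$, is not integrable counts as $+\infty$.) For $C\ge1$ let $\xi^{\pm}=\xi^\pm(C)$ be the solutions of $e^{-\xi}=C(1-\xi)$ with $-\infty<\xi^-\le0\le\xi^+<1$; let $k(1)=0$ and $$k(C)=2\,\frac{(1-\xi^-)(1-\xi^+)}{\xi^+-\xi^-}\,(C-1)\qquad(C>1).$$ Let $\varepsilon_0(p)$ be the John--Nirenberg constant of $\mathrm{BMO}^p((0,1))$, i.e.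 the supremum of all $\varepsilon\ge0$ for which there is a finite constant $K=K(\varepsilon,p)$ such that $\langle e^{\varphi}\rangle_J\le K e^{\langle\varphi\rangle_J}$ for all $\varphi$ with $\|\varphi\|_{\mathrm{BMO}^p((0,1))}\le\varepsilon$ and all intervals $J\subseteq(0,1)$. **Theorem.** Let $e^\varphi\in A_\infty(Q)$ and $C=[e^\varphi]_{A_\infty(Q)}$ (so $C\ge 1$). Then $$\xi^+\le\|\varphi\|_{\mathrm{BMO}^2(Q)}\le|\xi^-|\qquad\text{and}\qquad\|\varphi\|_{\mathrm{BMO}^1(Q)}\ge k(C).$$ If $1<p<2$ and $C\ge\frac{e^{p-2}}{p-1}$, then $$\|\varphi\|_{\mathrm{BMO}^p(Q)}\ge\varepsilon_0(p)\,\xi^+ .$$ Both $\mathrm{BMO}^2$ bounds and the $\mathrm{BMO}^p$ bound are sharp, in the sense that they are attained: on every $Q$ and for every $C\ge1$ there are functions $\varphi$ with $e^\varphi\in A_\infty(Q)$, $[e^\varphi]_{A_\infty(Q)}=C$ and $\|\varphi\|_{\mathrm{BMO}^2(Q)}=\xi^+$, respectively $\|\varphi\|_{\mathrm{BMO}^2(Q)}=|\xi^-|$;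 and for every $p\in(1,2)$ and every $C\ge\frac{e^{p-2}}{p-1}$ there is $\varphi$ with $e^\varphi\in A_\infty(Q)$, $[e^\varphi]_{A_\infty(Q)}=C$ and $\|\varphi\|_{\mathrm{BMO}^p(Q)}=\varepsilon_0(p)\,\xi^+$. -/

import Mathlib

open MeasureTheory Set
open scoped ENNReal NNReal

/-- The oscillation `⟨|φ - ⟨φ⟩_J|^p⟩_J ^ (1/p)` of `φ` over a set `J`, as an extended nonnegative
real. If `φ` is not integrable over `J`, then it has no average and the oscillation is `∞`. -/
noncomputable def bmoOsc (p : ℝ) (φ : ℝ → ℝ) (J : Set ℝ) : ℝ≥0∞ :=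
  open scoped Classical in
  if IntegrableOn φ J then
    (laverage (volume.restrict J) fun t => ENNReal.ofReal (|φ t - ⨍ s in J, φ s| ^ p)) ^ (1 / p)
  else ⊤

/-- The norm of `φ` in `BMO^p(Q)`: the supremum of the oscillations over all subintervals
of `Q`. -/
noncomputable def bmoNorm (p : ℝ) (φ : ℝ → ℝ) (Q : Set ℝ) : ℝ≥0∞ :=
  ⨆ (c : ℝ) (d : ℝ) (_ : c < d) (_ : Ioo c d ⊆ Q), bmoOsc p φ (Ioo c d)

/-- The quantity `⟨w⟩_J * exp (-⟨log w⟩_J)` for a weight `w` and a set `J`, as an extended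
nonnegative real. It is `∞` if `log w` is not integrable over `J`. -/
noncomputable def aInftyRatio (w : ℝ → ℝ) (J : Set ℝ) : ℝ≥0∞ :=
  open scoped Classical in
  if IntegrableOn (fun t => Real.log (w t)) J then
    (laverage (volume.restrict J) fun t => ENNReal.ofReal (w t)) *
      ENNReal.ofReal (Real.exp (-⨍ t in J, Real.log (w t)))
  else ⊤

/-- The `A_∞(Q)`-characteristic of `w`. -/
noncomputable def aInftyChar (w : ℝ → ℝ) (Q : Set ℝ) : ℝ≥0∞ :=
  ⨆ (c : ℝ) (d : ℝ) (_ : c < d) (_ : Ioo c d ⊆ Q), aInftyRatio w (Ioo c d)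

/-- `w` is a weight of class `A_∞(Q)`. -/
structure MemAInfty (w : ℝ → ℝ) (Q : Set ℝ) : Prop where
  pos : ∀ᵐ t ∂(volume.restrict Q), 0 < w t
  locallyIntegrableOn : LocallyIntegrableOn w Q
  locallyIntegrableOn_log : LocallyIntegrableOn (fun t => Real.log (w t)) Q
  char_lt_top : aInftyChar w Q < ⊤

/-- The integral John--Nirenberg inequality on the interval `(0,1)` holds at level `ε`, i.e.
`⟨e^φ⟩_J ≤ K e^{⟨φ⟩_J}` for all subintervals `J` of `(0,1)` and all `φ` with
`‖φ‖_{BMO^p((0,1))} ≤ ε`, where `K` is finite and depends only on `ε` and `p`. -/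
def JohnNirenbergHolds (p : ℝ) (ε : ℝ≥0) : Prop :=
  ∃ K : ℝ≥0, ∀ φ : ℝ → ℝ, LocallyIntegrableOn φ (Ioo 0 1) → bmoNorm p φ (Ioo 0 1) ≤ ε →
    ∀ c d : ℝ, c < d → Ioo c d ⊆ Ioo 0 1 →
      (laverage (volume.restrict (Ioo c d)) fun t => ENNReal.ofReal (Real.exp (φ t))) ≤
        K * ENNReal.ofReal (Real.exp (⨍ t in Ioo c d, φ t))

/-- The John--Nirenberg constant `ε₀(p)` of `BMO^p((0,1))`. -/
noncomputable def johnNirenbergConst (p : ℝ) : ℝ≥0∞ :=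
  ⨆ (ε : ℝ≥0) (_ : JohnNirenbergHolds p ε), (ε : ℝ≥0∞)

theorem hasDerivAt_one_sub_mul_exp (x : ℝ) :
    HasDerivAt (fun ξ : ℝ => (1 - ξ) * Real.exp ξ) (-x * Real.exp x) x := by
  have h := ((hasDerivAt_id x).const_sub 1).mul (Real.hasDerivAt_exp x)
  refine h.congr_deriv ?_
  simp only [id]
  ring

theorem exp_neg_eq_iff (C ξ : ℝ) :
    Real.exp (-ξ) = C * (1 - ξ) ↔ C * ((1 - ξ) * Real.exp ξ) = 1 := by
  have h : Real.exp (-ξ) * Real.exp ξ = 1 := by rw [← Real.exp_add]; simp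
  have h0 : Real.exp ξ ≠ 0 := (Real.exp_pos ξ).ne'
  constructor
  · intro e
    rw [← mul_assoc, ← e, h]
  · intro e
    apply mul_right_cancel₀ h0
    rw [h, mul_assoc, e]

theorem existsUnique_xiPlus {C : ℝ} (hC : 1 ≤ C) :
    ∃! ξ : ℝ, (0 ≤ ξ ∧ ξ < 1) ∧ Real.exp (-ξ) = C * (1 - ξ) := by
  have hC0 : 0 < C := by linarith
  have hcont : Continuous (fun ξ : ℝ => (1 - ξ) * Real.exp ξ) := by fun_prop
  have hanti : StrictAntiOn (fun ξ : ℝ => (1 - ξ) * Real.exp ξ) (Ici 0) := by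
    apply strictAntiOn_of_deriv_neg (convex_Ici 0) hcont.continuousOn
    intro x hx
    rw [interior_Ici, mem_Ioi] at hx
    rw [(hasDerivAt_one_sub_mul_exp x).deriv]
    have := mul_pos hx (Real.exp_pos x)
    linarith
  simp only [exp_neg_eq_iff]
  apply existsUnique_of_exists_of_unique
  · have hmem : C⁻¹ ∈ Icc ((1 - (1 : ℝ)) * Real.exp 1) ((1 - (0 : ℝ)) * Real.exp 0) := by
      simp only [sub_self, zero_mul, sub_zero, Real.exp_zero, mul_one]
      exact ⟨by positivity, inv_le_one_of_one_le₀ hC⟩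
    obtain ⟨x, hx, hxe⟩ := intermediate_value_Icc' (zero_le_one' ℝ) hcont.continuousOn hmem
    simp only at hxe
    refine ⟨x, ⟨hx.1, lt_of_le_of_ne hx.2 ?_⟩, ?_⟩
    · rintro rfl
      have : 0 < C⁻¹ := by positivity
      rw [← hxe] at this
      simp at this
    · rw [hxe, mul_inv_cancel₀ hC0.ne']
  · rintro x y ⟨hx, hx'⟩ ⟨hy, hy'⟩
    exact hanti.injOn hx.1 hy.1 (mul_left_cancel₀ hC0.ne' (hx'.trans hy'.symm))

theorem existsUnique_xiMinus {C : ℝ} (hC : 1 ≤ C) :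
    ∃! ξ : ℝ, ξ ≤ 0 ∧ Real.exp (-ξ) = C * (1 - ξ) := by
  have hC0 : 0 < C := by linarith
  have hcont : Continuous (fun ξ : ℝ => (1 - ξ) * Real.exp ξ) := by fun_prop
  have hmono : StrictMonoOn (fun ξ : ℝ => (1 - ξ) * Real.exp ξ) (Iic 0) := by
    apply strictMonoOn_of_deriv_pos (convex_Iic 0) hcont.continuousOn
    intro x hx
    rw [interior_Iic, mem_Iio] at hx
    rw [(hasDerivAt_one_sub_mul_exp x).deriv]
    exact mul_pos (by linarith) (Real.exp_pos x)
  simp only [exp_neg_eq_iff]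
  apply existsUnique_of_exists_of_unique
  · have hmem : C⁻¹ ∈ Icc ((1 - (-(2 * C))) * Real.exp (-(2 * C)))
        ((1 - (0 : ℝ)) * Real.exp 0) := by
      refine ⟨?_, ?_⟩
      · have hq := Real.quadratic_le_exp_of_nonneg (x := 2 * C) (by linarith)
        rw [Real.exp_neg, ← div_eq_mul_inv, div_le_iff₀ (Real.exp_pos _), inv_mul_eq_div,
          le_div_iff₀ hC0]
        nlinarith
      · simpa using inv_le_one_of_one_le₀ hC
    obtain ⟨x, hx, hxe⟩ :=
      intermediate_value_Icc (by linarith : -(2 * C) ≤ 0) hcont.continuousOn hmem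
    simp only at hxe
    exact ⟨x, hx.2, by rw [hxe, mul_inv_cancel₀ hC0.ne']⟩
  · rintro x y ⟨hx, hx'⟩ ⟨hy, hy'⟩
    exact hmono.injOn hx hy (mul_left_cancel₀ hC0.ne' (hx'.trans hy'.symm))

/-- For `C ≥ 1`, the solution `ξ⁺(C)` of `e^{-ξ} = C (1 - ξ)` with `0 ≤ ξ < 1`. -/
noncomputable def xiPlus (C : ℝ) : ℝ :=
  open scoped Classical in
  if h : 1 ≤ C then (existsUnique_xiPlus h).exists.choose else 0

/-- For `C ≥ 1`, the solution `ξ⁻(C)` of `e^{-ξ} = C (1 - ξ)` with `ξ ≤ 0`. -/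
noncomputable def xiMinus (C : ℝ) : ℝ :=
  open scoped Classical in
  if h : 1 ≤ C then (existsUnique_xiMinus h).exists.choose else 0

theorem xiPlus_spec {C : ℝ} (hC : 1 ≤ C) :
    (0 ≤ xiPlus C ∧ xiPlus C < 1) ∧ Real.exp (-xiPlus C) = C * (1 - xiPlus C) := by
  rw [xiPlus, dif_pos hC]
  exact (existsUnique_xiPlus hC).exists.choose_spec

theorem xiMinus_spec {C : ℝ} (hC : 1 ≤ C) :
    xiMinus C ≤ 0 ∧ Real.exp (-xiMinus C) = C * (1 - xiMinus C) := by
  rw [xiMinus, dif_pos hC]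
  exact (existsUnique_xiMinus hC).exists.choose_spec

/-- The function `k` on `[1,∞)`. -/
noncomputable def kFun (C : ℝ) : ℝ :=
  open scoped Classical in
  if C = 1 then 0
  else 2 * ((1 - xiMinus C) * (1 - xiPlus C) / (xiPlus C - xiMinus C)) * (C - 1)

/-! The estimates are Bellman function arguments. An interval is recorded by the point `(X₁, X₂)` of
averages of `φ` and `e^φ` over it; the `A_∞` condition keeps all these points in the strip `e^{X₁} ≤
X₂ ≤ C e^{X₁}`. A function on the strip that equals `f` on the lower curve and is locally convex
bounds `⟨f(φ)⟩` from below. After the substitution `ψ = φ/ξ` with `ξ = ξ^±`, the tangent to the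
upper curve that leaves the lower curve at abscissa `a` touches the upper one at `a + 1`. The
Bellman function is ruled by these tangents: along each of them it agrees with a plane tangent to
the graph of `f` over the lower curve, and it is the envelope of these planes.

The envelope property is an ODE for the free coefficient `τ` of the planes, and local convexity is
the sign condition `ξ τ - τ' ≥ 0` (`TangentFamily`). Then the plane with the foot of the tangent
through `(X₁, X₂)` is the largest among the admissible ones. `splitting_induction` exploits this
without treating chords of the strip: the integral of a fixed plane is additive, so an interval is
cut into two pieces for which its optimal plane is still admissible, each piece passes to its own
better plane, and on short intervals the plane is compared with `f` at the mean. The choice `f(v) =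
-v²`, `ξ = ξ⁻` gives the upper `BMO²` bound; `f(v) = |v|^p`, `ξ = ξ⁺` gives the lower bounds for `1
< p ≤ 2`, where `τ` comes from `M(a) = ∫₀^∞ e^{-z} |a + z|^p dz` (`expMoment`) and the sign
condition holds once `ξ⁺ ≥ 2 - p`. That is the threshold on `C`. For `p = 1` the relevant part of
the surface is one plane over the angle between the two tangents from `(0, 1)`, and a similar
splitting works (`integral_abs_ge_of_reverseJensen`).

These arguments need bounded functions. `integral_convex_contraction_le` shows that a monotone
contraction decreases all centered convex moments; hence truncation increases neither the
characteristic nor the oscillations, and limits of truncations give the general case. The same lemma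
shows that the oscillations of `-log t` are largest on intervals ending at the singularity. So
multiples `-α log (t - a)` with `α = ξ^±` have characteristic exactly `C` and `BMO^p` norm
`M(-1)^{1/p} |α|`, which gives sharpness. Finally `ε₀(p) = M(-1)^{1/p}` for `1 < p < 2`: the lower
bound keeps `ξ⁺` away from `1` for small norm, and `-log t` itself shows that the constant cannot be
larger. -/

/-! ### Splitting intervals -/

/-- If `A, Y` are continuous and positive at one end of an interval while `A` is negative at the
other end, then strictly inside both are nonnegative and one of them vanishes at some point. -/
theorem exists_exit_point {A Y : ℝ → ℝ} {m d : ℝ} (hA : ContinuousOn A (uIcc m d))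
    (hY : ContinuousOn Y (uIcc m d)) (hAm : 0 < A m) (hYm : 0 < Y m) (hAd : A d < 0) :
    ∃ t ∈ uIcc m d, t ≠ m ∧ t ≠ d ∧ 0 ≤ A t ∧ 0 ≤ Y t ∧ (A t ≤ 0 ∨ Y t ≤ 0) := by
  have hc : ContinuousOn (fun t => min (A t) (Y t)) (uIcc m d) :=
    continuous_min.comp_continuousOn (hA.prodMk hY)
  have hmem : (0 : ℝ) ∈ uIcc (min (A m) (Y m)) (min (A d) (Y d)) :=
    mem_uIcc.2 (Or.inr ⟨(min_lt_of_left_lt hAd).le, (lt_min hAm hYm).le⟩)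
  obtain ⟨t, ht, h0⟩ := intermediate_value_uIcc hc hmem
  simp only at h0
  refine ⟨t, ht, ?_, ?_, ?_, ?_, ?_⟩
  · rintro rfl
    exact (lt_min hAm hYm).ne' h0
  · rintro rfl
    exact (min_lt_of_left_lt hAd).ne h0
  · exact h0 ▸ min_le_left _ _
  · exact h0 ▸ min_le_right _ _
  · rcases min_choice (A t) (Y t) with h | h
    · exact Or.inl (by rw [← h, h0])
    · exact Or.inr (by rw [← h, h0])

theorem IntervalIntegrable.mono_Icc {g : ℝ → ℝ} {a b s t : ℝ}
    (h : IntervalIntegrable g volume a b) (hs : a ≤ s) (hst : s ≤ t) (ht : t ≤ b) :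
    IntervalIntegrable g volume s t :=
  h.mono_set (by
    rw [uIcc_of_le hst, uIcc_of_le (hs.trans (hst.trans ht))]
    exact Icc_subset_Icc hs ht)

/-- The mean oscillations of an integrable function over short intervals are dominated by an
additive function of the interval with small total mass. -/
theorem exists_oscillation_bound {ψ : ℝ → ℝ} {a b ε : ℝ} (hab : a ≤ b)
    (hψ : IntervalIntegrable ψ volume a b) (hε : 0 < ε) :
    ∃ h > 0, ∃ e : ℝ → ℝ, IntervalIntegrable e volume a b ∧ (∀ x, 0 ≤ e x) ∧
      ∫ x in a..b, e x ≤ ε ∧ ∀ s t, a ≤ s → s < t → t ≤ b → t - s ≤ h →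
        ∫ x in s..t, |ψ x - (∫ y in s..t, ψ y) / (t - s)| ≤ ∫ x in s..t, e x := by
  -- The dominating function is `2 |ψ - g| + 2 η` with `g` continuous and `L¹`-close to `ψ`; its
  -- integral is at most `2 η + 2 η (b - a) = ε`.
  set η := ε / (2 * (1 + (b - a))) with hη
  have hpos : 0 < 2 * (1 + (b - a)) := by linarith
  have hη0 : 0 < η := by positivity
  have hi : Integrable ψ (volume.restrict (Ioc a b)) :=
    (intervalIntegrable_iff_integrableOn_Ioc_of_le hab).1 hψ
  obtain ⟨g, hgs, hg, hgc, hgi⟩ := hi.exists_hasCompactSupport_integral_sub_le hη0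
  have hgi' : IntervalIntegrable g volume a b := hgc.intervalIntegrable _ _
  obtain ⟨h, hh, hu⟩ := Metric.uniformContinuous_iff.1
    (hgs.uniformContinuous_of_continuous hgc) η hη0
  have hdi : IntervalIntegrable (fun x => |ψ x - g x|) volume a b := (hψ.sub hgi').abs
  refine ⟨h / 2, by positivity, fun x => 2 * |ψ x - g x| + 2 * η,
    (hdi.const_mul 2).add intervalIntegrable_const, fun x => by positivity, ?_, ?_⟩
  · rw [intervalIntegral.integral_add (hdi.const_mul 2) intervalIntegrable_const,
      intervalIntegral.integral_const_mul, intervalIntegral.integral_const, smul_eq_mul,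
      intervalIntegral.integral_of_le hab]
    have : ∫ x in Ioc a b, |ψ x - g x| ≤ η := hg
    have h2 : ε = η * (2 * (1 + (b - a))) := by rw [hη, div_mul_cancel₀ _ hpos.ne']
    nlinarith
  · intro s t hs hst ht hlen
    have hψ' := hψ.mono_Icc hs hst.le ht
    have hg' := hgi'.mono_Icc hs hst.le ht
    have hd' := hdi.mono_Icc hs hst.le ht
    set c := g s
    set m := (∫ y in s..t, ψ y) / (t - s) with hm
    have hts : 0 < t - s := sub_pos.2 hst
    have hc1 : ∫ x in s..t, |ψ x - c| ≤ ∫ x in s..t, (|ψ x - g x| + η) := by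
      apply intervalIntegral.integral_mono_on hst.le
        (hψ'.sub intervalIntegrable_const).abs (hd'.add intervalIntegrable_const)
      intro x hx
      have h1 : |g x - c| ≤ η := by
        have := hu (a := x) (b := s) (by
          rw [Real.dist_eq, abs_of_nonneg (by linarith [hx.1])]; linarith [hx.2])
        rw [Real.dist_eq] at this
        exact this.le
      calc |ψ x - c| = |(ψ x - g x) + (g x - c)| := by ring_nf
        _ ≤ |ψ x - g x| + |g x - c| := abs_add_le _ _
        _ ≤ _ := by linarith
    -- Replacing the constant `c` by the mean costs at most a factor `2`.
    have hc2 : |m - c| * (t - s) ≤ ∫ x in s..t, |ψ x - c| := by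
      have h1 := intervalIntegral.abs_integral_le_integral_abs (μ := volume) hst.le
        (f := fun x => ψ x - c)
      rw [intervalIntegral.integral_sub hψ' intervalIntegrable_const,
        intervalIntegral.integral_const, smul_eq_mul] at h1
      have h2 : (∫ x in s..t, ψ x) - (t - s) * c = (m - c) * (t - s) := by
        rw [hm]; field_simp
      rwa [h2, abs_mul, abs_of_pos hts] at h1
    have hc3 : ∫ x in s..t, |ψ x - m| ≤ ∫ x in s..t, (|ψ x - c| + |m - c|) := by
      apply intervalIntegral.integral_mono_on hst.le
        (hψ'.sub intervalIntegrable_const).abs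
        ((hψ'.sub intervalIntegrable_const).abs.add intervalIntegrable_const)
      intro x hx
      rw [abs_sub_comm m c]
      calc |ψ x - m| = |(ψ x - c) + (c - m)| := by ring_nf
        _ ≤ _ := abs_add_le _ _
    rw [intervalIntegral.integral_add (hψ'.sub intervalIntegrable_const).abs
      intervalIntegrable_const, intervalIntegral.integral_const, smul_eq_mul] at hc3
    rw [intervalIntegral.integral_add hd' intervalIntegrable_const,
      intervalIntegral.integral_const, smul_eq_mul] at hc1
    rw [intervalIntegral.integral_add (hd'.const_mul 2) intervalIntegrable_const,
      intervalIntegral.integral_const_mul, intervalIntegral.integral_const, smul_eq_mul]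
    nlinarith

set_option maxHeartbeats 1000000 in
/-- Bellman-type induction: a family `ℓ u` of minorants at the averages is propagated through a
splitting of the intervals which avoids the intervals that are not admissible for `u`. -/
theorem splitting_induction {a b N M r K : ℝ} {ψ : ℝ → ℝ}
    (hint : ∀ g : ℝ → ℝ, Continuous g → IntervalIntegrable (fun x => g (ψ x)) volume a b)
    (hN : ∀ x, |ψ x| ≤ N) (hr : 0 < r) (hK : 0 ≤ K) {U : Set ℝ} (hU : ∀ u ∈ U, |u| ≤ M)
    {ℓ T : ℝ → ℝ → ℝ} {f : ℝ → ℝ} (hℓ : ∀ u, Continuous (ℓ u)) (hT : ∀ u, Continuous (T u))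
    (hf : Continuous f)
    (hLip : ∀ u ∈ U, ∀ v ∈ Icc (-N) N, ∀ w ∈ Icc (-N) N,
      (ℓ u v - f v) - (ℓ u w - f w) ≤ K * |v - w|)
    (hstep : ∀ s t, a ≤ s → s < t → t ≤ b → ∃ u ∈ U,
      (∫ x in s..t, ψ x) + r * (t - s) ≤ u * (t - s) ∧
      (∀ u' ∈ U, ((∫ x in s..t, ψ x) ≤ u' * (t - s) ∨ ∫ x in s..t, T u' (ψ x) ≤ 0) →
        ∫ x in s..t, ℓ u' (ψ x) ≤ ∫ x in s..t, ℓ u (ψ x)) ∧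
      ℓ u ((∫ x in s..t, ψ x) / (t - s)) ≤ f ((∫ x in s..t, ψ x) / (t - s)))
    {s t : ℝ} (hs : a ≤ s) (hst : s < t) (ht : t ≤ b) {u : ℝ} (hu : u ∈ U)
    (hadm : (∫ x in s..t, ψ x) ≤ u * (t - s) ∨ ∫ x in s..t, T u (ψ x) ≤ 0) :
    ∫ x in s..t, ℓ u (ψ x) ≤ ∫ x in s..t, f (ψ x) := by
  have hψ : IntervalIntegrable ψ volume a b := hint id continuous_id
  have hab : a ≤ b := hs.trans (hst.le.trans ht)
  have hN0 : 0 ≤ N := (abs_nonneg _).trans (hN 0)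
  have hM0 : 0 ≤ M := (abs_nonneg _).trans (hU u hu)
  have key : ∀ ε > 0, ∫ x in s..t, ℓ u (ψ x) ≤ (∫ x in s..t, f (ψ x)) + K * ε := by
    intro ε hε
    obtain ⟨h, hh, e, hei, he0, heε, hosc⟩ := exists_oscillation_bound hab hψ hε
    -- A lower bound for the relative length of either piece. The margin `r` forces a deficit `r (t
    -- - s)` of `∫ (u - ψ)`, of which a piece of length `l` carries at most `(N + M) l`; the extra
    -- terms in the denominator keep it positive and `δ ≤ 1/2`.
    set δ := r / (2 * (N + M + r)) with hδ
    have hD : 0 < 2 * (N + M + r) := by linarith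
    have hδ0 : 0 < δ := by positivity
    have hδr : δ * (2 * (N + M + r)) = r := by rw [hδ]; field_simp
    have hδ2 : δ ≤ 1 / 2 := by
      rw [hδ, div_le_iff₀ hD]; linarith
    have claim : ∀ n : ℕ, ∀ s t, a ≤ s → s < t → t ≤ b → (t - s) * (1 - δ) ^ n ≤ h →
        ∀ u ∈ U, ((∫ x in s..t, ψ x) ≤ u * (t - s) ∨ ∫ x in s..t, T u (ψ x) ≤ 0) →
        ∫ x in s..t, ℓ u (ψ x) ≤ (∫ x in s..t, f (ψ x)) + K * ∫ x in s..t, e x := by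
      intro n
      induction n with
      | zero =>
        intro s t hs hst ht hlen u' hu' hadm
        obtain ⟨u, hu, -, hmax, hbase⟩ := hstep s t hs hst ht
        refine (hmax u' hu' hadm).trans ?_
        have hts : 0 < t - s := sub_pos.2 hst
        have hψ' := hψ.mono_Icc hs hst.le ht
        have hℓ' := (hint _ (hℓ u)).mono_Icc hs hst.le ht
        have hf' := (hint _ hf).mono_Icc hs hst.le ht
        set m := (∫ x in s..t, ψ x) / (t - s) with hm
        have hmN : m ∈ Icc (-N) N := by
          rw [mem_Icc, ← abs_le, hm, abs_div, abs_of_pos hts, div_le_iff₀ hts]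
          have := intervalIntegral.norm_integral_le_of_norm_le_const (a := s) (b := t)
            (f := ψ) (C := N) (fun x _ => hN x)
          rwa [abs_of_pos hts] at this
        have h1 : ∫ x in s..t, (ℓ u (ψ x) - f (ψ x)) ≤ ∫ x in s..t, K * |ψ x - m| := by
          apply intervalIntegral.integral_mono_on hst.le (hℓ'.sub hf')
            ((hψ'.sub intervalIntegrable_const).abs.const_mul K)
          intro x _
          have := hLip u hu (ψ x) (abs_le.1 (hN x)) m hmN
          linarith
        rw [intervalIntegral.integral_sub hℓ' hf', intervalIntegral.integral_const_mul] at h1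
        have h2 := hosc s t hs hst ht (by simpa using hlen)
        have h3 := mul_le_mul_of_nonneg_left h2 hK
        linarith
      | succ n ih =>
        intro s t hs hst ht hlen u' hu' hadm
        obtain ⟨u, hu, hru, hmax, -⟩ := hstep s t hs hst ht
        refine (hmax u' hu' hadm).trans ?_
        have hts : 0 < t - s := sub_pos.2 hst
        have hsplit : ∀ g : ℝ → ℝ, IntervalIntegrable g volume a b → ∀ m, s < m → m < t →
            ∫ x in s..t, g x = (∫ x in s..m, g x) + ∫ x in m..t, g x := by
          intro g hg m h1 h2
          exact (intervalIntegral.integral_add_adjacent_intervals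
            (hg.mono_Icc hs h1.le (h2.le.trans ht))
            (hg.mono_Icc (hs.trans h1.le) h2.le ht)).symm
        have hδ1 : 0 < 1 - δ := by linarith
        -- Additivity of the integral of `ℓ u`: any cut that leaves `u` admissible for both pieces
        -- and shortens both by the factor `1 - δ` closes the induction step.
        have hchild : ∀ m, s < m → m < t → m - s ≤ (1 - δ) * (t - s) →
            t - m ≤ (1 - δ) * (t - s) →
            ((∫ x in s..m, ψ x) ≤ u * (m - s) ∨ ∫ x in s..m, T u (ψ x) ≤ 0) →
            ((∫ x in m..t, ψ x) ≤ u * (t - m) ∨ ∫ x in m..t, T u (ψ x) ≤ 0) →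
            ∫ x in s..t, ℓ u (ψ x) ≤ (∫ x in s..t, f (ψ x)) + K * ∫ x in s..t, e x := by
          intro m h1 h2 hl1 hl2 ha1 ha2
          have hl : ∀ y, y ≤ (1 - δ) * (t - s) → y * (1 - δ) ^ n ≤ h := by
            intro y hy
            refine le_trans ?_ hlen
            rw [pow_succ']
            calc y * (1 - δ) ^ n ≤ (1 - δ) * (t - s) * (1 - δ) ^ n :=
                  mul_le_mul_of_nonneg_right hy (by positivity)
              _ = _ := by ring
          have i1 := ih s m hs h1 (h2.le.trans ht) (hl _ hl1) u hu ha1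
          have i2 := ih m t (hs.trans h1.le) h2 ht (hl _ hl2) u hu ha2
          rw [hsplit _ (hint _ (hℓ u)) m h1 h2, hsplit _ (hint _ hf) m h1 h2,
            hsplit _ hei m h1 h2]
          linarith
        -- Extension by zero makes the primitives continuous on the whole line.
        have hcont : ∀ g : ℝ → ℝ, IntervalIntegrable g volume a b →
            Continuous (fun y => ∫ x in s..y, (indicator (Ioc a b) g) x) ∧ ∀ y₁ y₂, a ≤ y₁ →
              y₁ ≤ y₂ → y₂ ≤ b → ∫ x in y₁..y₂, (indicator (Ioc a b) g) x =
                ∫ x in y₁..y₂, g x := by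
          intro g hg
          have hgi : Integrable (indicator (Ioc a b) g) volume :=
            ((intervalIntegrable_iff_integrableOn_Ioc_of_le hab).1 hg).integrable_indicator
              measurableSet_Ioc
          refine ⟨intervalIntegral.continuous_primitive
            (fun _ _ => hgi.intervalIntegrable) s, ?_⟩
          intro y₁ y₂ h1 h2 h3
          apply intervalIntegral.integral_congr_ae
          refine Filter.Eventually.of_forall fun x hx => ?_
          rw [uIoc_of_le h2] at hx
          rw [indicator_of_mem]
          exact ⟨h1.trans_lt hx.1, hx.2.trans h3⟩
        obtain ⟨c1, e1⟩ := hcont ψ hψ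
        obtain ⟨c2, e2⟩ := hcont _ (hint _ (hT u))
        have hlow : ∀ y₁ y₂, a ≤ y₁ → y₁ ≤ y₂ → y₂ ≤ b →
            -((N + M) * (y₂ - y₁)) ≤ (∫ x in y₁..y₂, ψ x) - u * (y₂ - y₁) := by
          intro y₁ y₂ _ h12 _
          have := intervalIntegral.norm_integral_le_of_norm_le_const (a := y₁) (b := y₂)
            (f := ψ) (C := N) (fun x _ => hN x)
          rw [abs_of_nonneg (sub_nonneg.2 h12), Real.norm_eq_abs] at this
          have h3 := (abs_le.1 this).1
          have h4 := mul_le_mul_of_nonneg_right (abs_le.1 (hU u hu)).2 (sub_nonneg.2 h12)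
          linarith
        set m := (s + t) / 2 with hm
        have hsm : s < m := by rw [hm]; linarith
        have hmt : m < t := by rw [hm]; linarith
        have hms : m - s = (t - s) / 2 := by rw [hm]; ring
        have htm : t - m = (t - s) / 2 := by rw [hm]; ring
        have hψt := hsplit ψ hψ
        by_cases ha1 : (∫ x in s..m, ψ x) ≤ u * (m - s) ∨ ∫ x in s..m, T u (ψ x) ≤ 0
        · by_cases ha2 : (∫ x in m..t, ψ x) ≤ u * (t - m) ∨ ∫ x in m..t, T u (ψ x) ≤ 0
          · exact hchild m hsm hmt (by rw [hms]; nlinarith) (by rw [htm]; nlinarith) ha1 ha2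
          · push Not at ha2
            -- The right half is inadmissible, so it is enlarged to the left until it just becomes
            -- admissible; this happens before `s` because the whole interval satisfies the
            -- condition with margin. At the exit point its mean is still at least `u`, hence the
            -- mean of the rest is at most `u`, and the rest is admissible too.
            obtain ⟨y, hy, hym, hys, hA0, -, hAY⟩ := exists_exit_point
              (A := fun y => (∫ x in s..t, indicator (Ioc a b) ψ x) -
                (∫ x in s..y, indicator (Ioc a b) ψ x) - u * (t - y))
              (Y := fun y => (∫ x in s..t, indicator (Ioc a b) (fun x => T u (ψ x)) x) -
                (∫ x in s..y, indicator (Ioc a b) (fun x => T u (ψ x)) x)) (m := m) (d := s)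
              (by fun_prop) (by fun_prop)
              (by
                rw [e1 s t hs hst.le ht, e1 s m hs hsm.le (hmt.le.trans ht), hψt m hsm hmt]
                linarith [ha2.1])
              (by
                rw [e2 s t hs hst.le ht, e2 s m hs hsm.le (hmt.le.trans ht),
                  hsplit _ (hint _ (hT u)) m hsm hmt]
                linarith [ha2.2])
              (by
                rw [e1 s t hs hst.le ht, e1 s s hs le_rfl (hst.le.trans ht),
                  intervalIntegral.integral_same]
                nlinarith)
            rw [uIcc_of_ge hsm.le] at hy
            have hsy : s < y := lt_of_le_of_ne hy.1 (Ne.symm hys)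
            have hyt : y < t := hy.2.trans_lt hmt
            rw [e1 s t hs hst.le ht, e1 s y hs hsy.le (hyt.le.trans ht), hψt y hsy hyt,
              e2 s t hs hst.le ht, e2 s y hs hsy.le (hyt.le.trans ht),
              hsplit _ (hint _ (hT u)) y hsy hyt] at hAY
            rw [e1 s t hs hst.le ht, e1 s y hs hsy.le (hyt.le.trans ht), hψt y hsy hyt] at hA0
            have hl := hlow s y hs hsy.le (hyt.le.trans ht)
            rw [hψt y hsy hyt] at hru
            have hys' : δ * (t - s) ≤ y - s := by
              have h1 : r * (t - s) ≤ (N + M) * (y - s) := by linarith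
              have h2 : (N + M) * (y - s) ≤ (2 * (N + M + r)) * (y - s) :=
                mul_le_mul_of_nonneg_right (by linarith) (by linarith)
              rw [← hδr] at h1
              have h3 : (2 * (N + M + r)) * (δ * (t - s)) ≤ (2 * (N + M + r)) * (y - s) := by
                linarith
              exact le_of_mul_le_mul_left h3 hD
            refine hchild y hsy hyt ?_ ?_ (Or.inl ?_) ?_
            · have : y - s ≤ m - s := by linarith [hy.2]
              rw [hms] at this
              nlinarith
            · linarith
            · nlinarith
            · rcases hAY with h | h
              · left; linarith
              · right; linarith
        · push Not at ha1
          -- The mirror image: the left half is enlarged to the right.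
          obtain ⟨y, hy, hym, hys, hA0, -, hAY⟩ := exists_exit_point
            (A := fun y => (∫ x in s..y, indicator (Ioc a b) ψ x) - u * (y - s))
            (Y := fun y => ∫ x in s..y, indicator (Ioc a b) (fun x => T u (ψ x)) x)
            (m := m) (d := t) (by fun_prop) (by fun_prop)
            (by
              rw [e1 s m hs hsm.le (hmt.le.trans ht)]
              linarith [ha1.1])
            (by
              rw [e2 s m hs hsm.le (hmt.le.trans ht)]
              exact ha1.2)
            (by
              rw [e1 s t hs hst.le ht]
              nlinarith)
          rw [uIcc_of_le hmt.le] at hy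
          have hyt : y < t := lt_of_le_of_ne hy.2 hys
          have hsy : s < y := hsm.trans_le hy.1
          rw [e1 s y hs hsy.le (hyt.le.trans ht), e2 s y hs hsy.le (hyt.le.trans ht)] at hAY
          rw [e1 s y hs hsy.le (hyt.le.trans ht)] at hA0
          have hl := hlow y t (hs.trans hsy.le) hyt.le ht
          rw [hψt y hsy hyt] at hru
          have hys' : δ * (t - s) ≤ t - y := by
            have h1 : r * (t - s) ≤ (N + M) * (t - y) := by linarith
            have h2 : (N + M) * (t - y) ≤ (2 * (N + M + r)) * (t - y) :=
              mul_le_mul_of_nonneg_right (by linarith) (by linarith)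
            rw [← hδr] at h1
            have h3 : (2 * (N + M + r)) * (δ * (t - s)) ≤ (2 * (N + M + r)) * (t - y) := by
              linarith
            exact le_of_mul_le_mul_left h3 hD
          refine hchild y hsy hyt ?_ ?_ ?_ (Or.inl ?_)
          · linarith
          · have : t - y ≤ t - m := by linarith [hy.1]
            rw [htm] at this
            nlinarith
          · rcases hAY with h | h
            · left; linarith
            · right; linarith
          · nlinarith
    have hδ1 : 1 - δ < 1 := by linarith
    obtain ⟨n, hn⟩ := exists_pow_lt_of_lt_one (x := h / (t - s))
      (div_pos hh (sub_pos.2 hst)) hδ1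
    have hc := claim n s t hs hst ht (by
      rw [lt_div_iff₀ (sub_pos.2 hst)] at hn
      linarith) u hu hadm
    have h1 : ∫ x in s..t, e x ≤ ∫ x in a..b, e x :=
      intervalIntegral.integral_mono_interval hs hst.le ht
        (Filter.Eventually.of_forall he0) hei
    have h2 := mul_le_mul_of_nonneg_left (h1.trans heε) hK
    linarith
  refine le_of_forall_pos_le_add fun ε hε => ?_
  have h1 := key (ε / (K + 1)) (by positivity)
  have h2 : K * (ε / (K + 1)) ≤ ε := by
    rw [mul_div_assoc', div_le_iff₀ (by linarith)]
    nlinarith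
  linarith

/-! ### Tangent lines, tangent planes and the Bellman estimate -/

/-- The exceptional point is needed because `|v|^p` with `p < 2` has no second derivative at `0`, so
the planes need not depend differentiably on their foot there. -/
theorem le_of_hasDerivAt_nonneg_off_point {g g' : ℝ → ℝ} {x₁ x₂ c : ℝ} (h : x₁ ≤ x₂)
    (hc : ContinuousOn g (Icc x₁ x₂))
    (hd : ∀ x ∈ Ioo x₁ x₂, x ≠ c → HasDerivAt g (g' x) x)
    (hn : ∀ x ∈ Ioo x₁ x₂, x ≠ c → 0 ≤ g' x) : g x₁ ≤ g x₂ := by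
  have aux : ∀ y₁ y₂, x₁ ≤ y₁ → y₁ ≤ y₂ → y₂ ≤ x₂ → c ∉ Ioo y₁ y₂ → g y₁ ≤ g y₂ := by
    intro y₁ y₂ h1 h12 h2 hcm
    have hsub : ∀ x ∈ Ioo y₁ y₂, x ∈ Ioo x₁ x₂ ∧ x ≠ c := fun x hx =>
      ⟨⟨h1.trans_lt hx.1, hx.2.trans_le h2⟩, fun e => hcm (e ▸ hx)⟩
    refine monotoneOn_of_deriv_nonneg (convex_Icc y₁ y₂) (hc.mono (Icc_subset_Icc h1 h2)) ?_ ?_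
      (left_mem_Icc.2 h12) (right_mem_Icc.2 h12) h12
    · rw [interior_Icc]
      intro x hx
      exact (hd x (hsub x hx).1 (hsub x hx).2).differentiableAt.differentiableWithinAt
    · rw [interior_Icc]
      intro x hx
      rw [(hd x (hsub x hx).1 (hsub x hx).2).deriv]
      exact hn x (hsub x hx).1 (hsub x hx).2
  by_cases hcm : c ∈ Ioo x₁ x₂
  · exact (aux x₁ c le_rfl hcm.1.le hcm.2.le (by simp)).trans
      (aux c x₂ hcm.1.le hcm.2.le le_rfl (by simp))
  · exact aux x₁ x₂ le_rfl h le_rfl hcm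

/-- Vertical distance from the point `(X₁, X₂)` to the tangent of the upper boundary curve that
meets the lower boundary `x₂ = e^{ξ x₁}` at `x₁ = a`, in normalized coordinates. -/
noncomputable def tangentGap (ξ X₁ X₂ a : ℝ) : ℝ :=
  Real.exp (-(ξ * a)) * X₂ - 1 - ξ * (X₁ - a) / (1 - ξ)

theorem hasDerivAt_tangentGap (ξ X₁ X₂ a : ℝ) :
    HasDerivAt (tangentGap ξ X₁ X₂) (-(ξ * Real.exp (-(ξ * a)) * X₂) + ξ / (1 - ξ)) a := by
  have h1 : HasDerivAt (fun a => Real.exp (-(ξ * a))) (Real.exp (-(ξ * a)) * -(ξ * 1)) a :=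
    (((hasDerivAt_id a).const_mul ξ).neg).exp
  have h2 : HasDerivAt (fun a => ξ * (X₁ - a) / (1 - ξ)) (ξ * -1 / (1 - ξ)) a :=
    ((((hasDerivAt_id a).const_sub X₁).const_mul ξ).div_const _)
  refine (((h1.mul_const X₂).sub_const 1).sub h2).congr_deriv ?_
  ring

/-- The derivative in the foot contains `-ξ e^{-ξ a} X₂`, which is nondecreasing for either sign of
`ξ`. All later sign information on the gap comes from this convexity and a few values. -/
theorem convexOn_tangentGap {ξ X₁ X₂ : ℝ} (hX : 0 ≤ X₂) :
    ConvexOn ℝ univ (tangentGap ξ X₁ X₂) := by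
  have hd : deriv (tangentGap ξ X₁ X₂) =
      fun a => -(ξ * Real.exp (-(ξ * a)) * X₂) + ξ / (1 - ξ) :=
    funext fun a => (hasDerivAt_tangentGap ξ X₁ X₂ a).deriv
  apply Monotone.convexOn_univ_of_deriv
    (fun a => (hasDerivAt_tangentGap ξ X₁ X₂ a).differentiableAt)
  rw [hd]
  intro x y hxy
  have : ξ * Real.exp (-(ξ * y)) ≤ ξ * Real.exp (-(ξ * x)) := by
    rcases le_total 0 ξ with h | h
    · exact mul_le_mul_of_nonneg_left (Real.exp_le_exp.2 (by nlinarith)) h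
    · exact mul_le_mul_of_nonpos_left (Real.exp_le_exp.2 (by nlinarith)) h
  have := mul_le_mul_of_nonneg_right this hX
  simp only
  linarith

theorem ConvexOn.nonpos_of_mem_Icc {g : ℝ → ℝ} (hg : ConvexOn ℝ univ g) {x y z : ℝ}
    (hx : g x ≤ 0) (hy : g y ≤ 0) (hz : z ∈ Icc x y) : g z ≤ 0 :=
  (hg.le_max_of_mem_Icc (mem_univ _) (mem_univ _) hz).trans (max_le hx hy)

/-- The foot of the tangent through a given point of the domain, with the sign pattern of the
gap as a function of the foot. -/
theorem exists_tangent_foot {ξ C₀ s₀ X₁ X₂ : ℝ} (hξ1 : ξ < 1) (hs0 : 0 ≤ s₀)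
    (hs1 : s₀ ≤ 1) (hC₀ : C₀ * Real.exp (ξ * s₀) ≤ 1 + ξ * s₀ / (1 - ξ))
    (hC : C₀ * Real.exp ξ < 1 / (1 - ξ)) (hlow : Real.exp (ξ * X₁) ≤ X₂)
    (hup : X₂ ≤ C₀ * Real.exp (ξ * X₁)) :
    ∃ α ∈ Icc (X₁ - s₀) X₁, (∀ a, α ≤ a → 0 ≤ tangentGap ξ X₁ X₂ a) ∧
      ∀ a', a' ≤ α → (X₁ - 1 ≤ a' ∨ tangentGap ξ X₁ X₂ a' ≤ 0) →
        ∀ a ∈ Icc a' α, tangentGap ξ X₁ X₂ a ≤ 0 := by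
  have h1ξ : 0 < 1 - ξ := by linarith
  have hX2 : 0 ≤ X₂ := (Real.exp_pos _).le.trans hlow
  have hconv := convexOn_tangentGap (ξ := ξ) (X₁ := X₁) hX2
  have hval : ∀ s, tangentGap ξ X₁ X₂ (X₁ - s) ≤
      C₀ * Real.exp (ξ * s) - 1 - ξ * s / (1 - ξ) := by
    intro s
    have h1 : Real.exp (-(ξ * (X₁ - s))) * X₂ ≤
        Real.exp (-(ξ * (X₁ - s))) * (C₀ * Real.exp (ξ * X₁)) :=
      mul_le_mul_of_nonneg_left hup (Real.exp_pos _).le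
    have h2 : Real.exp (-(ξ * (X₁ - s))) * (C₀ * Real.exp (ξ * X₁)) =
        C₀ * Real.exp (ξ * s) := by
      rw [mul_left_comm, ← Real.exp_add]
      congr 2
      ring
    rw [tangentGap, sub_sub_cancel]
    linarith
  have hX1 : 0 ≤ tangentGap ξ X₁ X₂ X₁ := by
    have h1 : Real.exp (-(ξ * X₁)) * Real.exp (ξ * X₁) ≤ Real.exp (-(ξ * X₁)) * X₂ :=
      mul_le_mul_of_nonneg_left hlow (Real.exp_pos _).le
    rw [← Real.exp_add] at h1
    simp only [tangentGap, sub_self, mul_zero, zero_div, sub_zero]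
    simp only [neg_add_cancel, Real.exp_zero] at h1
    linarith
  have hcont : ContinuousOn (tangentGap ξ X₁ X₂) (Icc (X₁ - s₀) X₁) := fun a _ =>
    (hasDerivAt_tangentGap ξ X₁ X₂ a).continuousAt.continuousWithinAt
  obtain ⟨α, hα, hα0⟩ := intermediate_value_Icc (by linarith : X₁ - s₀ ≤ X₁) hcont
    (show (0 : ℝ) ∈ Icc _ _ from ⟨(hval s₀).trans (by linarith), hX1⟩)
  -- The tangent with foot `X₁ - 1` touches the critical curve above `X₁`, and the point lies
  -- strictly below that curve. Together with `hX1` this brackets the zero of the convex gap.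
  have hneg : tangentGap ξ X₁ X₂ (X₁ - 1) < 0 := by
    refine (hval 1).trans_lt ?_
    rw [mul_one]
    have : 1 / (1 - ξ) = 1 + ξ / (1 - ξ) := by field_simp; ring
    linarith
  have hα1 : X₁ - 1 < α := by
    rcases lt_or_ge (X₁ - 1) α with h | h
    · exact h
    · have : α = X₁ - 1 := le_antisymm h (by linarith [hα.1])
      rw [this] at hα0
      exact absurd hα0 hneg.ne
  refine ⟨α, hα, ?_, ?_⟩
  · intro a ha
    by_contra! hlt
    rcases eq_or_lt_of_le ha with rfl | ha
    · exact hlt.ne hα0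
    have := hconv.le_max_of_mem_Icc (mem_univ (X₁ - 1)) (mem_univ a) ⟨hα1.le, ha.le⟩
    rw [hα0] at this
    exact absurd this (not_le.2 (max_lt hneg hlt))
  · intro a' ha' hor a ha
    have h0 : tangentGap ξ X₁ X₂ a' ≤ 0 := by
      rcases hor with h | h
      · exact hconv.nonpos_of_mem_Icc hneg.le hα0.le ⟨h, ha'⟩
      · exact h
    exact hconv.nonpos_of_mem_Icc h0 hα0.le ha

/-- The value at `(X₁, X₂)` of the plane that is tangent to the graph of `f` over the lower
boundary at `x₁ = a`. -/
noncomputable def tangentPlane (ξ : ℝ) (f f₁ τ : ℝ → ℝ) (X₁ X₂ a : ℝ) : ℝ :=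
  f a + f₁ a * (X₁ - a) + τ a * (Real.exp (-(ξ * a)) * X₂ - 1 - ξ * (X₁ - a))

/-- The relation between `f₂` and `τ'` is exactly the one that makes the derivative in `a` a
multiple of the gap: infinitesimally close planes meet over the tangent line. With `ξ τ - τ' ≥ 0`
the value therefore rises where the gap is nonpositive, falls where it is nonnegative, and peaks at
the foot of the tangent through the point. -/
theorem hasDerivAt_tangentPlane {ξ : ℝ} (hξ1 : ξ < 1) {f f₁ τ : ℝ → ℝ} {X₁ X₂ a f₂ τ' : ℝ}
    (hf : HasDerivAt f (f₁ a) a) (hf₁ : HasDerivAt f₁ f₂ a) (hτ : HasDerivAt τ τ' a)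
    (h : (1 - ξ) * f₂ = ξ ^ 2 * (τ a - τ')) :
    HasDerivAt (tangentPlane ξ f f₁ τ X₁ X₂) (-((ξ * τ a - τ') * tangentGap ξ X₁ X₂ a)) a := by
  have h1ξ : 1 - ξ ≠ 0 := by linarith
  have h0 : HasDerivAt (fun a => X₁ - a) (-1) a := (hasDerivAt_id a).const_sub X₁
  have h1 : HasDerivAt (fun a => Real.exp (-(ξ * a))) (Real.exp (-(ξ * a)) * -(ξ * 1)) a :=
    (((hasDerivAt_id a).const_mul ξ).neg).exp
  have h2 := (hf.add (hf₁.mul h0)).add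
    (hτ.mul (((h1.mul_const X₂).sub_const 1).sub (h0.const_mul ξ)))
  have hf2 : f₂ = ξ ^ 2 * (τ a - τ') / (1 - ξ) := by
    rw [eq_div_iff h1ξ]; linarith
  refine h2.congr_deriv ?_
  simp only [tangentGap, Pi.sub_apply]
  rw [hf2]
  field_simp
  ring

/-- Data for the Bellman argument in normalized coordinates: `f` is the boundary function, and
the planes given by `f, f', τ` on `[a₀, ∞)` envelope a surface bending the right way. -/
structure TangentFamily (ξ : ℝ) (f f₁ τ : ℝ → ℝ) (a₀ : ℝ) : Prop where
  hasDerivAt : ∀ v, HasDerivAt f (f₁ v) v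
  continuous_deriv : Continuous f₁
  continuous_coeff : Continuous τ
  envelope : ∀ a, a₀ < a → a ≠ 0 → ∃ f₂ τ', HasDerivAt f₁ f₂ a ∧ HasDerivAt τ τ' a ∧
    (1 - ξ) * f₂ = ξ ^ 2 * (τ a - τ') ∧ 0 ≤ ξ * τ a - τ'

namespace TangentFamily

variable {ξ : ℝ} {f f₁ τ : ℝ → ℝ} {a₀ : ℝ}

theorem continuous_tangentPlane (H : TangentFamily ξ f f₁ τ a₀) (X₁ X₂ : ℝ) :
    Continuous (tangentPlane ξ f f₁ τ X₁ X₂) := by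
  have h1 : Continuous f := continuous_iff_continuousAt.2 fun v => (H.hasDerivAt v).continuousAt
  have h2 := H.continuous_deriv
  have h3 := H.continuous_coeff
  unfold tangentPlane
  fun_prop

theorem tangentPlane_le_of_gap_nonpos (H : TangentFamily ξ f f₁ τ a₀) (hξ1 : ξ < 1)
    {X₁ X₂ a₁ a₂ : ℝ} (h₁ : a₀ ≤ a₁) (h₁₂ : a₁ ≤ a₂)
    (hgap : ∀ a ∈ Icc a₁ a₂, tangentGap ξ X₁ X₂ a ≤ 0) :
    tangentPlane ξ f f₁ τ X₁ X₂ a₁ ≤ tangentPlane ξ f f₁ τ X₁ X₂ a₂ := by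
  refine le_of_hasDerivAt_nonneg_off_point (c := 0)
    (g' := deriv (tangentPlane ξ f f₁ τ X₁ X₂)) h₁₂
    (H.continuous_tangentPlane X₁ X₂).continuousOn ?_ ?_
  · intro a ha ha0
    obtain ⟨f₂, τ', h1, h2, h3, -⟩ := H.envelope a (h₁.trans_lt ha.1) ha0
    exact (hasDerivAt_tangentPlane hξ1 (H.hasDerivAt a) h1 h2 h3).differentiableAt.hasDerivAt
  · intro a ha ha0
    obtain ⟨f₂, τ', h1, h2, h3, h4⟩ := H.envelope a (h₁.trans_lt ha.1) ha0
    rw [(hasDerivAt_tangentPlane hξ1 (H.hasDerivAt a) h1 h2 h3).deriv]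
    have := mul_nonpos_of_nonneg_of_nonpos h4 (hgap a (Ioo_subset_Icc_self ha))
    linarith

theorem tangentPlane_le_of_gap_nonneg (H : TangentFamily ξ f f₁ τ a₀) (hξ1 : ξ < 1)
    {X₁ X₂ a₁ a₂ : ℝ} (h₁ : a₀ ≤ a₁) (h₁₂ : a₁ ≤ a₂)
    (hgap : ∀ a ∈ Icc a₁ a₂, 0 ≤ tangentGap ξ X₁ X₂ a) :
    tangentPlane ξ f f₁ τ X₁ X₂ a₂ ≤ tangentPlane ξ f f₁ τ X₁ X₂ a₁ := by
  rw [← neg_le_neg_iff]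
  refine le_of_hasDerivAt_nonneg_off_point (c := 0)
    (g := fun a => -tangentPlane ξ f f₁ τ X₁ X₂ a)
    (g' := fun a => -deriv (tangentPlane ξ f f₁ τ X₁ X₂) a) h₁₂
    (H.continuous_tangentPlane X₁ X₂).neg.continuousOn ?_ ?_
  · intro a ha ha0
    obtain ⟨f₂, τ', h1, h2, h3, -⟩ := H.envelope a (h₁.trans_lt ha.1) ha0
    exact (hasDerivAt_tangentPlane hξ1 (H.hasDerivAt a) h1 h2
      h3).differentiableAt.hasDerivAt.neg
  · intro a ha ha0
    obtain ⟨f₂, τ', h1, h2, h3, h4⟩ := H.envelope a (h₁.trans_lt ha.1) ha0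
    rw [(hasDerivAt_tangentPlane hξ1 (H.hasDerivAt a) h1 h2 h3).deriv]
    have := mul_nonneg h4 (hgap a (Ioo_subset_Icc_self ha))
    linarith

theorem tangentPlane_self (v : ℝ) :
    tangentPlane ξ f f₁ τ v (Real.exp (ξ * v)) v = f v := by
  simp [tangentPlane, ← Real.exp_add]

/-- Over the boundary point with abscissa `v` the gap vanishes for the foot `v` and is nonpositive
for the foot `v - 1`, since `e^ξ (1 - ξ) ≤ 1`. By convexity it is nonpositive in between, so moving
the foot from `a` up to `v`, where the plane takes the value `f v`, only increases the plane. -/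
theorem tangentPlane_le_boundary (H : TangentFamily ξ f f₁ τ a₀) (hξ1 : ξ < 1) {a v : ℝ}
    (ha : a₀ ≤ a) (hav : a ≤ v) (hva : v ≤ a + 1) :
    tangentPlane ξ f f₁ τ v (Real.exp (ξ * v)) a ≤ f v := by
  have h1ξ : 0 < 1 - ξ := by linarith
  rw [← tangentPlane_self (ξ := ξ) (f := f) (f₁ := f₁) (τ := τ) v]
  refine H.tangentPlane_le_of_gap_nonpos hξ1 ha hav fun c hc => ?_
  refine (convexOn_tangentGap (Real.exp_pos _).le).nonpos_of_mem_Icc (x := v - 1) (y := v)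
    ?_ ?_ ⟨by linarith [hc.1], hc.2⟩
  · have h2 : Real.exp ξ ≤ 1 / (1 - ξ) := by
      rw [le_div_iff₀ h1ξ]
      have h3 := Real.add_one_le_exp (-ξ)
      calc Real.exp ξ * (1 - ξ) ≤ Real.exp ξ * Real.exp (-ξ) :=
            mul_le_mul_of_nonneg_left (by linarith) (Real.exp_pos _).le
        _ = 1 := by rw [← Real.exp_add]; simp
    have h3 : 1 / (1 - ξ) = 1 + ξ / (1 - ξ) := by field_simp; ring
    rw [tangentGap, ← Real.exp_add]
    have h4 : -(ξ * (v - 1)) + ξ * v = ξ := by ring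
    rw [h4, sub_sub_cancel, mul_one]
    linarith
  · rw [tangentGap, ← Real.exp_add]
    simp

theorem exists_lipschitz (H : TangentFamily ξ f f₁ τ a₀) (N : ℝ) :
    ∃ K, 0 ≤ K ∧ ∀ a ∈ Icc a₀ N, ∀ v ∈ Icc (-N) N, ∀ w ∈ Icc (-N) N,
      (tangentPlane ξ f f₁ τ v (Real.exp (ξ * v)) a - f v) -
        (tangentPlane ξ f f₁ τ w (Real.exp (ξ * w)) a - f w) ≤ K * |v - w| := by
  have h2 := H.continuous_deriv
  have h3 := H.continuous_coeff
  have hc : Continuous (fun q : ℝ × ℝ =>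
      f₁ q.1 + τ q.1 * (Real.exp (-(ξ * q.1)) * (Real.exp (ξ * q.2) * ξ) - ξ) - f₁ q.2) := by
    fun_prop
  obtain ⟨K, hK⟩ := ((isCompact_Icc (a := a₀) (b := N)).prod
    (isCompact_Icc (a := -N) (b := N))).exists_bound_of_continuousOn hc.continuousOn
  refine ⟨max K 0, le_max_right _ _, fun a ha v hv w hw => ?_⟩
  have hd : ∀ x, HasDerivAt (fun x => tangentPlane ξ f f₁ τ x (Real.exp (ξ * x)) a - f x)
      (f₁ a + τ a * (Real.exp (-(ξ * a)) * (Real.exp (ξ * x) * ξ) - ξ) - f₁ x) x := by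
    intro x
    have e1 : HasDerivAt (fun x => Real.exp (ξ * x)) (Real.exp (ξ * x) * (ξ * 1)) x :=
      ((hasDerivAt_id x).const_mul ξ).exp
    have e2 : HasDerivAt (fun x => x - a) 1 x := (hasDerivAt_id x).sub_const a
    have e3 := (((e2.const_mul (f₁ a)).const_add (f a)).add
      ((((e1.const_mul (Real.exp (-(ξ * a)))).sub_const 1).sub
        (e2.const_mul ξ)).const_mul (τ a))).sub (H.hasDerivAt x)
    refine e3.congr_deriv ?_
    ring
  have := (convex_Icc (-N) N).norm_image_sub_le_of_norm_hasDerivWithin_le (C := max K 0)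
    (fun x _ => (hd x).hasDerivWithinAt)
    (fun x hx => (hK (a, x) ⟨ha, hx⟩).trans (le_max_left _ _)) hw hv
  exact (le_abs_self _).trans this

/-- The integral estimate given by a family of tangent planes, for bounded functions whose
exponentials satisfy a reverse Jensen inequality with a constant smaller than critical. -/
theorem integral_tangentPlane_le (H : TangentFamily ξ f f₁ τ a₀) (hξ1 : ξ < 1)
    {a b N C₀ : ℝ} {ψ : ℝ → ℝ}
    (hint : ∀ g : ℝ → ℝ, Continuous g → IntervalIntegrable (fun x => g (ψ x)) volume a b)
    (hN : ∀ x, |ψ x| ≤ N) (haN : a₀ ≤ N)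
    (hlow : ∀ v ∈ Icc (-N) N, v ≤ a₀ → tangentPlane ξ f f₁ τ v (Real.exp (ξ * v)) a₀ ≤ f v)
    (hC₀ : C₀ * Real.exp ξ < 1 / (1 - ξ))
    (hC : ∀ s t, a ≤ s → s < t → t ≤ b → ∫ x in s..t, Real.exp (ξ * ψ x) ≤
      C₀ * (t - s) * Real.exp (ξ * ((∫ x in s..t, ψ x) / (t - s))))
    {s t : ℝ} (hs : a ≤ s) (hst : s < t) (ht : t ≤ b) {α : ℝ} (hα : α ∈ Icc a₀ N)
    (hm : (∫ x in s..t, ψ x) ≤ (α + 1) * (t - s)) :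
    (t - s) * tangentPlane ξ f f₁ τ ((∫ x in s..t, ψ x) / (t - s))
      ((∫ x in s..t, Real.exp (ξ * ψ x)) / (t - s)) α ≤ ∫ x in s..t, f (ψ x) := by
  have h1ξ : 0 < 1 - ξ := by linarith
  have hfc : Continuous f := continuous_iff_continuousAt.2 fun v => (H.hasDerivAt v).continuousAt
  obtain ⟨K, hK0, hK⟩ := H.exists_lipschitz N
  -- Strict subcriticality of `C₀` leaves room: the foot is at distance at most `s₀ < 1` to the left
  -- of the mean, and `1 - s₀` becomes the margin of the splitting.
  obtain ⟨s₀, hs0, hs1, hs₀⟩ : ∃ s₀ : ℝ, 0 ≤ s₀ ∧ s₀ < 1 ∧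
      C₀ * Real.exp (ξ * s₀) ≤ 1 + ξ * s₀ / (1 - ξ) := by
    have hc : ContinuousAt (fun s => 1 + ξ * s / (1 - ξ) - C₀ * Real.exp (ξ * s)) 1 := by
      fun_prop
    have hpos : 0 < 1 + ξ * 1 / (1 - ξ) - C₀ * Real.exp (ξ * 1) := by
      have h3 : 1 / (1 - ξ) = 1 + ξ / (1 - ξ) := by field_simp; ring
      rw [mul_one]; linarith
    have h1 := (hc.eventually (lt_mem_nhds hpos)).filter_mono
      (nhdsWithin_le_nhds (s := Iio (1 : ℝ)))
    have h2 : ∀ᶠ s : ℝ in nhdsWithin 1 (Iio 1), s ∈ Ioo (0 : ℝ) 1 :=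
      Ioo_mem_nhdsLT (by norm_num)
    obtain ⟨s, hs, hs'⟩ := (h1.and h2).exists
    exact ⟨s, hs'.1.le, hs'.2, by linarith⟩
  have hplane : ∀ s t, a ≤ s → s < t → t ≤ b → ∀ c,
      ∫ x in s..t, tangentPlane ξ f f₁ τ (ψ x) (Real.exp (ξ * ψ x)) c =
        (t - s) * tangentPlane ξ f f₁ τ ((∫ x in s..t, ψ x) / (t - s))
          ((∫ x in s..t, Real.exp (ξ * ψ x)) / (t - s)) c := by
    intro s t hs hst ht c
    have hts : t - s ≠ 0 := (sub_pos.2 hst).ne'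
    have i1 : IntervalIntegrable ψ volume s t := (hint id continuous_id).mono_Icc hs hst.le ht
    have i2 := (hint (fun v => Real.exp (ξ * v)) (by fun_prop)).mono_Icc hs hst.le ht
    have e : ∀ x, tangentPlane ξ f f₁ τ (ψ x) (Real.exp (ξ * ψ x)) c =
        (f c - f₁ c * c + τ c * (ξ * c - 1)) + ((f₁ c - τ c * ξ) * ψ x +
          (τ c * Real.exp (-(ξ * c))) * Real.exp (ξ * ψ x)) := by
      intro x; unfold tangentPlane; ring
    simp_rw [e]
    rw [intervalIntegral.integral_add intervalIntegrable_const
        ((i1.const_mul _).add (i2.const_mul _)),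
      intervalIntegral.integral_add (i1.const_mul _) (i2.const_mul _),
      intervalIntegral.integral_const_mul, intervalIntegral.integral_const_mul,
      intervalIntegral.integral_const, smul_eq_mul, tangentPlane]
    field_simp
    ring
  have hgap : ∀ s t, a ≤ s → s < t → t ≤ b → ∀ c,
      ∫ x in s..t, tangentGap ξ (ψ x) (Real.exp (ξ * ψ x)) c =
        (t - s) * tangentGap ξ ((∫ x in s..t, ψ x) / (t - s))
          ((∫ x in s..t, Real.exp (ξ * ψ x)) / (t - s)) c := by
    intro s t hs hst ht c
    have hts : t - s ≠ 0 := (sub_pos.2 hst).ne'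
    have i1 : IntervalIntegrable ψ volume s t := (hint id continuous_id).mono_Icc hs hst.le ht
    have i2 := (hint (fun v => Real.exp (ξ * v)) (by fun_prop)).mono_Icc hs hst.le ht
    have e : ∀ x, tangentGap ξ (ψ x) (Real.exp (ξ * ψ x)) c =
        (ξ * c / (1 - ξ) - 1) + ((-(ξ / (1 - ξ))) * ψ x +
          (Real.exp (-(ξ * c))) * Real.exp (ξ * ψ x)) := by
      intro x; unfold tangentGap; ring
    simp_rw [e]
    rw [intervalIntegral.integral_add intervalIntegrable_const
        ((i1.const_mul _).add (i2.const_mul _)),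
      intervalIntegral.integral_add (i1.const_mul _) (i2.const_mul _),
      intervalIntegral.integral_const_mul, intervalIntegral.integral_const_mul,
      intervalIntegral.integral_const, smul_eq_mul, tangentGap]
    field_simp
    ring
  rw [← hplane s t hs hst ht]
  -- The parameter `u` is the abscissa of the tangency point, one more than the foot. A plane is
  -- admissible unless the point of averages lies to the right of the tangency point and above the
  -- tangent.
  have := splitting_induction (ℓ := fun u v => tangentPlane ξ f f₁ τ v (Real.exp (ξ * v)) (u - 1))
    (T := fun u v => tangentGap ξ v (Real.exp (ξ * v)) (u - 1)) (r := 1 - s₀) (M := |a₀| + |N| + 1)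
    (U := Icc (a₀ + 1) (N + 1)) hint hN (by linarith) hK0 ?_ ?_ ?_ hfc ?_ ?_ hs hst ht
    (u := α + 1) ⟨by linarith [hα.1], by linarith [hα.2]⟩ (Or.inl hm)
  · simpa using this
  · intro u hu
    rw [abs_le]
    constructor
    · linarith [hu.1, neg_abs_le a₀, abs_nonneg N]
    · linarith [hu.2, le_abs_self N, abs_nonneg a₀]
  · intro u; unfold tangentPlane; fun_prop
  · intro u; unfold tangentGap; fun_prop
  · intro u hu v hv w hw
    exact hK (u - 1) ⟨by linarith [hu.1], by linarith [hu.2]⟩ v hv w hw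
  · intro s t hs hst ht
    have hts : 0 < t - s := sub_pos.2 hst
    have i1 : IntervalIntegrable ψ volume s t := (hint id continuous_id).mono_Icc hs hst.le ht
    have i2 : IntervalIntegrable (fun x => Real.exp (ξ * ψ x)) volume s t :=
      (hint (fun v => Real.exp (ξ * v)) (by fun_prop)).mono_Icc hs hst.le ht
    have hC' := hC s t hs hst ht
    have hp := hplane s t hs hst ht
    have hg := hgap s t hs hst ht
    set X₁ := (∫ x in s..t, ψ x) / (t - s) with hX₁
    set X₂ := (∫ x in s..t, Real.exp (ξ * ψ x)) / (t - s) with hX₂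
    have eX₁ : ∫ x in s..t, ψ x = X₁ * (t - s) := by rw [hX₁]; field_simp
    have eX₂ : ∫ x in s..t, Real.exp (ξ * ψ x) = X₂ * (t - s) := by rw [hX₂]; field_simp
    have hX₁N : X₁ ∈ Icc (-N) N := by
      rw [mem_Icc, ← abs_le, hX₁, abs_div, abs_of_pos hts, div_le_iff₀ hts]
      have := intervalIntegral.norm_integral_le_of_norm_le_const (a := s) (b := t)
        (f := ψ) (C := N) (fun x _ => hN x)
      rwa [abs_of_pos hts] at this
    have hup : X₂ ≤ C₀ * Real.exp (ξ * X₁) := by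
      rw [eX₂] at hC'
      have : X₂ * (t - s) ≤ C₀ * Real.exp (ξ * X₁) * (t - s) := by linarith
      exact le_of_mul_le_mul_right this hts
    have hjen : Real.exp (ξ * X₁) ≤ X₂ := by
      have h1 : ∫ x in s..t, ((Real.exp (ξ * X₁) - Real.exp (ξ * X₁) * ξ * X₁) +
          Real.exp (ξ * X₁) * ξ * ψ x) ≤ ∫ x in s..t, Real.exp (ξ * ψ x) := by
        apply intervalIntegral.integral_mono_on hst.le
          (intervalIntegrable_const.add (i1.const_mul _)) i2
        intro x _
        have h2 := Real.add_one_le_exp (ξ * ψ x - ξ * X₁)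
        have h3 : Real.exp (ξ * ψ x) = Real.exp (ξ * X₁) * Real.exp (ξ * ψ x - ξ * X₁) := by
          rw [← Real.exp_add]; ring_nf
        rw [h3]
        have := mul_le_mul_of_nonneg_left h2 (Real.exp_pos (ξ * X₁)).le
        linarith
      rw [intervalIntegral.integral_add intervalIntegrable_const (i1.const_mul _),
        intervalIntegral.integral_const_mul, intervalIntegral.integral_const, smul_eq_mul,
        eX₁, eX₂] at h1
      have : Real.exp (ξ * X₁) * (t - s) ≤ X₂ * (t - s) := by linarith
      exact le_of_mul_le_mul_right this hts
    obtain ⟨c, hc, hc1, hc2⟩ := exists_tangent_foot hξ1 hs0 hs1.le hs₀ hC₀ hjen hup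
    -- No planes are available with foot below `a₀`; points whose tangent starts there are all
    -- served by the plane at `a₀`, and `hlow` covers the comparison with `f` for these.
    have hmax : max c a₀ ∈ Icc a₀ N := ⟨le_max_right _ _, max_le (hc.2.trans hX₁N.2) haN⟩
    refine ⟨max c a₀ + 1, ⟨by linarith [hmax.1], by linarith [hmax.2]⟩, ?_, ?_, ?_⟩
    · rw [eX₁, ← add_mul]
      apply mul_le_mul_of_nonneg_right _ hts.le
      linarith [hc.1, le_max_left c a₀]
    · intro u' hu' hadm
      simp only [add_sub_cancel_right]
      rw [hp, hp]
      apply mul_le_mul_of_nonneg_left _ hts.le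
      rw [hg, eX₁] at hadm
      have hadm' : X₁ - 1 ≤ u' - 1 ∨ tangentGap ξ X₁ X₂ (u' - 1) ≤ 0 := by
        rcases hadm with h | h
        · left; linarith [le_of_mul_le_mul_right h hts]
        · right
          by_contra! hlt
          exact absurd h (not_le.2 (mul_pos hts hlt))
      have hu1 : a₀ ≤ u' - 1 := by linarith [hu'.1]
      rcases le_or_gt c (u' - 1) with h | h
      · refine H.tangentPlane_le_of_gap_nonneg hξ1 hmax.1 (max_le h hu1) ?_
        intro y hy
        exact hc1 y ((le_max_left _ _).trans hy.1)
      · rw [max_eq_left (hu1.trans h.le)]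
        exact H.tangentPlane_le_of_gap_nonpos hξ1 hu1 h.le (hc2 _ h.le hadm')
    · simp only [add_sub_cancel_right]
      rcases le_total (max c a₀) X₁ with h | h
      · exact H.tangentPlane_le_boundary hξ1 hmax.1 h
          (by linarith [hc.1, le_max_left c a₀])
      · rcases le_total c a₀ with h3 | h3
        · rw [max_eq_right h3] at h ⊢
          exact hlow X₁ hX₁N h
        · rw [max_eq_left h3] at h ⊢
          have h4 : X₁ = c := le_antisymm h hc.2
          rw [← h4, tangentPlane_self]

end TangentFamily

/-! ### The variance bound -/

/-- Reverse Jensen inequality with constant `C` on all subintervals of `(a, b)`. -/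
def ReverseJensen (φ : ℝ → ℝ) (a b C : ℝ) : Prop :=
  ∀ s t, a ≤ s → s < t → t ≤ b →
    ∫ x in s..t, Real.exp (φ x) ≤ C * (t - s) * Real.exp ((∫ x in s..t, φ x) / (t - s))

theorem ReverseJensen.scaled {φ : ℝ → ℝ} {a b C ξ : ℝ} (h : ReverseJensen φ a b C) (hξ : ξ ≠ 0) :
    ∀ s t, a ≤ s → s < t → t ≤ b → ∫ x in s..t, Real.exp (ξ * (φ x / ξ)) ≤
      C * (t - s) * Real.exp (ξ * ((∫ x in s..t, φ x / ξ) / (t - s))) := by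
  intro s t hs hst ht
  have h1 := h s t hs hst ht
  have e1 : ∀ x, ξ * (φ x / ξ) = φ x := fun x => mul_div_cancel₀ _ hξ
  rw [intervalIntegral.integral_div]
  simp_rw [e1]
  have : ξ * ((∫ x in s..t, φ x) / ξ / (t - s)) = (∫ x in s..t, φ x) / (t - s) := by
    field_simp
  rwa [this]

/-- The second derivative of `-v²` is constant, so a constant `τ` solves the envelope equation; its
product with `ξ < 0` is nonnegative. -/
theorem tangentFamily_neg_sq {ξ : ℝ} (hξ : ξ < 0) (a₀ : ℝ) :
    TangentFamily ξ (fun v => -v ^ 2) (fun v => -(2 * v)) (fun _ => -(2 * (1 - ξ) / ξ ^ 2)) a₀ where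
  hasDerivAt v := by
    refine ((hasDerivAt_pow 2 v).neg).congr_deriv ?_
    norm_num
  continuous_deriv := by fun_prop
  continuous_coeff := by fun_prop
  envelope a _ _ := by
    refine ⟨-2, 0, ?_, hasDerivAt_const _ _, ?_, ?_⟩
    · refine (((hasDerivAt_id a).const_mul 2).neg).congr_deriv ?_
      norm_num
    · field_simp [hξ.ne]
      ring
    · have : 0 ≤ 2 * (1 - ξ) / ξ ^ 2 := div_nonneg (by linarith) (by positivity)
      nlinarith

/-- The extremal point is `(0, X)` with `X` the critical constant. Its tangent has foot `-1`, so
that plane is used; there it has the value `f(-1) + f'(-1) + 2 τ-term = -1`, and smaller `X` only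
increases it. -/
theorem integral_sq_le_of_reverseJensen {φ : ℝ → ℝ} {a b N C β : ℝ} (hβ : 0 < β)
    (hint : ∀ g : ℝ → ℝ, Continuous g → IntervalIntegrable (fun x => g (φ x)) volume a b)
    (hN : ∀ x, |φ x| ≤ N) (hJ : ReverseJensen φ a b C) (hC : C * Real.exp (-β) < 1 / (1 + β))
    {s t : ℝ} (hs : a ≤ s) (hst : s < t) (ht : t ≤ b) (h0 : ∫ x in s..t, φ x = 0) :
    ∫ x in s..t, φ x ^ 2 ≤ β ^ 2 * (t - s) := by
  have hts : 0 < t - s := sub_pos.2 hst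
  have hN0 : 0 ≤ N := (abs_nonneg _).trans (hN 0)
  have hβ0 : -β ≠ 0 := by linarith
  have hNβ : 0 ≤ N / β := div_nonneg hN0 hβ.le
  -- The first foot is placed below all values of `φ / (-β)`, so the comparison below `a₀` is
  -- vacuous.
  have key := (tangentFamily_neg_sq (ξ := -β) (by linarith) (-(N / β + 1))).integral_tangentPlane_le
    (by linarith) (a := a) (b := b) (N := N / β) (C₀ := C) (ψ := fun x => φ x / (-β))
    (fun g hg => hint (fun v => g (v / (-β))) (by fun_prop))
    (fun x => by
      rw [abs_div, abs_neg, abs_of_pos hβ]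
      exact div_le_div_of_nonneg_right (hN x) hβ.le)
    (by linarith)
    (fun v hv hv' => by linarith [hv.1])
    (by rw [sub_neg_eq_add]; exact hC) (hJ.scaled hβ0) hs hst ht (α := -1)
    ⟨by linarith, by linarith⟩ (by rw [intervalIntegral.integral_div, h0]; simp)
  have h1 := hJ s t hs hst ht
  have e1 : ∀ x, -β * (φ x / -β) = φ x := fun x => mul_div_cancel₀ _ hβ0
  simp_rw [e1] at key
  rw [intervalIntegral.integral_div, h0] at key
  rw [h0] at h1
  set X := (∫ x in s..t, Real.exp (φ x)) / (t - s) with hX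
  have hXC : X ≤ C := by
    rw [hX, div_le_iff₀ hts]
    simpa using h1
  have e2 : ∫ x in s..t, -(φ x / -β) ^ 2 = -((∫ x in s..t, φ x ^ 2) / β ^ 2) := by
    rw [intervalIntegral.integral_neg, ← intervalIntegral.integral_div]
    congr 1
    apply intervalIntegral.integral_congr
    intro x _
    simp only [div_pow, neg_sq]
  rw [e2] at key
  have h2 : X * Real.exp (-β) ≤ 1 / (1 + β) :=
    (mul_le_mul_of_nonneg_right hXC (Real.exp_pos _).le).trans hC.le
  have h3 : -1 ≤ tangentPlane (-β) (fun v => -v ^ 2) (fun v => -(2 * v))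
      (fun _ => -(2 * (1 - -β) / (-β) ^ 2)) (0 / -β / (t - s)) X (-1) := by
    simp only [tangentPlane]
    have h4 : Real.exp (-(-β * -1)) = Real.exp (-β) := by congr 1; ring
    rw [h4]
    have h5 : 2 * (1 - -β) / (-β) ^ 2 * (Real.exp (-β) * X - 1 + β) ≤ 2 := by
      have h6 : Real.exp (-β) * X - 1 + β ≤ β ^ 2 / (1 + β) := by
        have : β ^ 2 / (1 + β) = 1 / (1 + β) - 1 + β := by field_simp; ring
        rw [this]; linarith
      calc _ ≤ 2 * (1 - -β) / (-β) ^ 2 * (β ^ 2 / (1 + β)) := by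
            apply mul_le_mul_of_nonneg_left h6
            apply div_nonneg <;> nlinarith
        _ = 2 := by field_simp; ring
    simp only [zero_div]
    linarith
  have h4 := mul_le_mul_of_nonneg_left h3 hts.le
  have h5 : (∫ x in s..t, φ x ^ 2) / β ^ 2 ≤ t - s := by linarith
  rw [div_le_iff₀ (by positivity)] at h5
  linarith

/-! ### Exponential moments and the lower bound for `1 < p ≤ 2` -/

/-- `∫₀^∞ e^{-z} |a + z|^p dz`, in a form that is easy to differentiate. -/
noncomputable def expMoment (p a : ℝ) : ℝ :=
  Real.exp a * (Real.Gamma (p + 1) - ∫ y in (0 : ℝ)..a, Real.exp (-y) * |y| ^ p)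

section expMoment

variable {p : ℝ}

theorem continuous_exp_mul_abs_rpow (hp : 0 < p) :
    Continuous fun y : ℝ => Real.exp (-y) * |y| ^ p := by
  have : Continuous fun y : ℝ => |y| ^ p := continuous_abs.rpow_const fun _ => Or.inr hp.le
  fun_prop

/-- The equation `M' = M - |a|^p`, differentiated twice, reads `M'' - M''' = (|a|^p)''`. Up to the
factor `(1 - ξ) / ξ²` this is the envelope equation, so `τ` can be taken proportional to `M''`. -/
theorem hasDerivAt_expMoment (hp : 0 < p) (a : ℝ) :
    HasDerivAt (expMoment p) (expMoment p a - |a| ^ p) a := by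
  have h1 : HasDerivAt (fun a => ∫ y in (0 : ℝ)..a, Real.exp (-y) * |y| ^ p)
      (Real.exp (-a) * |a| ^ p) a :=
    intervalIntegral.integral_hasDerivAt_right
      ((continuous_exp_mul_abs_rpow hp).intervalIntegrable _ _)
      ((continuous_exp_mul_abs_rpow hp).stronglyMeasurableAtFilter _ _)
      (continuous_exp_mul_abs_rpow hp).continuousAt
  refine ((Real.hasDerivAt_exp a).mul (h1.const_sub _)).congr_deriv ?_
  have h2 : Real.exp a * Real.exp (-a) = 1 := by rw [← Real.exp_add]; simp
  rw [expMoment]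
  linear_combination (-|a| ^ p) * h2

theorem continuous_expMoment (hp : 0 < p) : Continuous (expMoment p) :=
  continuous_iff_continuousAt.2 fun a => (hasDerivAt_expMoment hp a).continuousAt

theorem expMoment_neg (a : ℝ) :
    expMoment p (-a) =
      Real.exp (-a) * (Real.Gamma (p + 1) + ∫ y in (0 : ℝ)..a, Real.exp y * |y| ^ p) := by
  rw [expMoment]
  have h := intervalIntegral.integral_comp_neg (a := 0) (b := a)
    (fun y => Real.exp (-y) * |y| ^ p)
  simp only [neg_neg, abs_neg, neg_zero] at h
  rw [h, intervalIntegral.integral_symm]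
  ring

theorem hasDerivAt_rpow_combination {x : ℝ} (hx : 0 < x) (A B D q : ℝ) :
    HasDerivAt (fun x => A * x ^ q + B * x ^ (q - 1) + D * x ^ (q - 2))
      (A * (q * x ^ (q - 1)) + B * ((q - 1) * x ^ (q - 2)) + D * ((q - 2) * x ^ (q - 3))) x := by
  have h1 := (Real.hasDerivAt_rpow_const (x := x) (p := q) (Or.inl hx.ne')).const_mul A
  have h2 := (Real.hasDerivAt_rpow_const (x := x) (p := q - 1) (Or.inl hx.ne')).const_mul B
  have h3 := (Real.hasDerivAt_rpow_const (x := x) (p := q - 2) (Or.inl hx.ne')).const_mul D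
  refine ((h1.add h2).add h3).congr_deriv ?_
  have e1 : q - 1 - 1 = q - 2 := by ring
  have e2 : q - 2 - 1 = q - 3 := by ring
  rw [e1, e2]

theorem tendsto_integral_exp_rpow (hp : 0 < p) :
    Filter.Tendsto (fun b : ℝ => ∫ y in (0 : ℝ)..b, Real.exp (-y) * |y| ^ p) Filter.atTop
      (nhds (Real.Gamma (p + 1))) := by
  have hG := Real.Gamma_eq_integral (s := p + 1) (by linarith)
  have hc := Real.GammaIntegral_convergent (s := p + 1) (by linarith)
  rw [add_sub_cancel_right] at hG hc
  have e : ∀ x ∈ Ioi (0 : ℝ), Real.exp (-x) * x ^ p = Real.exp (-x) * |x| ^ p := fun x hx => by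
    rw [abs_of_pos hx]
  rw [hG, setIntegral_congr_fun measurableSet_Ioi e]
  exact intervalIntegral_tendsto_integral_Ioi 0 (hc.congr_fun e measurableSet_Ioi)
    Filter.tendsto_id

/-- The second derivative of `expMoment p` is at most that of `|a|^p` for `a > 0`. -/
theorem expMoment_second_le_of_pos (hp1 : 1 ≤ p) (hp2 : p ≤ 2) {a : ℝ} (ha : 0 < a) :
    expMoment p a ≤ a ^ p + p * a ^ (p - 1) + p * (p - 1) * a ^ (p - 2) := by
  set V : ℝ → ℝ := fun a => Real.exp (-a) *
    (1 * a ^ p + p * a ^ (p - 1) + p * (p - 1) * a ^ (p - 2)) +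
    ∫ y in (0 : ℝ)..a, Real.exp (-y) * |y| ^ p with hV
  have hp0 : 0 < p := by linarith
  have hd : ∀ x, 0 < x → HasDerivAt V
      (Real.exp (-x) * (p * (p - 1) * (p - 2) * x ^ (p - 3))) x := by
    intro x hx
    have h1 : HasDerivAt (fun a => ∫ y in (0 : ℝ)..a, Real.exp (-y) * |y| ^ p)
        (Real.exp (-x) * |x| ^ p) x :=
      intervalIntegral.integral_hasDerivAt_right
        ((continuous_exp_mul_abs_rpow hp0).intervalIntegrable _ _)
        ((continuous_exp_mul_abs_rpow hp0).stronglyMeasurableAtFilter _ _)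
        (continuous_exp_mul_abs_rpow hp0).continuousAt
    have h2 : HasDerivAt (fun x => Real.exp (-x)) (Real.exp (-x) * -1) x :=
      (hasDerivAt_neg x).exp
    refine ((h2.mul (hasDerivAt_rpow_combination hx 1 p (p * (p - 1)) p)).add h1).congr_deriv ?_
    rw [abs_of_pos hx]
    ring
  have hanti : AntitoneOn V (Ioi 0) := by
    apply antitoneOn_of_deriv_nonpos (convex_Ioi 0)
    · exact fun x hx => (hd x hx).continuousAt.continuousWithinAt
    · rw [interior_Ioi]
      exact fun x hx => (hd x hx).differentiableAt.differentiableWithinAt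
    · rw [interior_Ioi]
      intro x hx
      rw [(hd x hx).deriv]
      have h1 : 0 < Real.exp (-x) * x ^ (p - 3) :=
        mul_pos (Real.exp_pos _) (Real.rpow_pos_of_pos hx _)
      have h2 : p * (p - 1) * (p - 2) ≤ 0 :=
        mul_nonpos_of_nonneg_of_nonpos (mul_nonneg hp0.le (by linarith)) (by linarith)
      nlinarith
  -- `V` decreases and dominates the incomplete Gamma integral, whose limit at infinity is `Γ(p +
  -- 1)`.
  have hge : Real.Gamma (p + 1) ≤ V a := by
    refine le_of_tendsto (tendsto_integral_exp_rpow hp0) ?_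
    filter_upwards [Filter.eventually_ge_atTop a] with b hb
    refine le_trans ?_ (hanti (mem_Ioi.2 ha) (mem_Ioi.2 (ha.trans_le hb)) hb)
    have hb0 := ha.trans_le hb
    have : 0 ≤ Real.exp (-b) * (1 * b ^ p + p * b ^ (p - 1) + p * (p - 1) * b ^ (p - 2)) := by
      have h1 : 0 ≤ p - 1 := by linarith
      positivity
    simp only [hV]
    linarith
  have h2 : Real.exp a * Real.exp (-a) = 1 := by rw [← Real.exp_add]; simp
  rw [expMoment]
  have h3 : Real.Gamma (p + 1) - ∫ y in (0 : ℝ)..a, Real.exp (-y) * |y| ^ p ≤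
      Real.exp (-a) * (1 * a ^ p + p * a ^ (p - 1) + p * (p - 1) * a ^ (p - 2)) := by
    simp only [hV] at hge
    linarith
  calc _ ≤ Real.exp a * (Real.exp (-a) *
        (1 * a ^ p + p * a ^ (p - 1) + p * (p - 1) * a ^ (p - 2))) :=
        mul_le_mul_of_nonneg_left h3 (Real.exp_pos _).le
    _ = _ := by rw [← mul_assoc, h2]; ring

/-- Integration by parts gives `∫ e^y y^p = e - p ∫ e^y y^{p-1}`. Here the last integral is at least
`∫ e^y y = 1`, because `p - 1 ≤ 1`, while `Γ(p + 1) = p Γ(p) ≤ p` by convexity of `Γ` between `1`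
and `2`. -/
theorem Gamma_add_one_le (hp1 : 1 ≤ p) (hp2 : p ≤ 2) :
    Real.Gamma (p + 1) + ∫ y in (0 : ℝ)..1, Real.exp y * |y| ^ p ≤ Real.exp 1 := by
  have hp0 : 0 < p := by linarith
  have hG1 : Real.Gamma p ≤ 1 := by
    have := Real.convexOn_Gamma.le_max_of_mem_Icc (x := 1) (y := 2) (by simp) (by simp)
      ⟨hp1, hp2⟩
    simpa [Real.Gamma_two] using this
  rw [Real.Gamma_add_one hp0.ne']
  have habs : ∀ q : ℝ, ∫ y in (0 : ℝ)..1, Real.exp y * |y| ^ q =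
      ∫ y in (0 : ℝ)..1, Real.exp y * y ^ q := by
    intro q
    apply intervalIntegral.integral_congr
    intro y hy
    rw [uIcc_of_le zero_le_one] at hy
    simp only [abs_of_nonneg hy.1]
  rw [habs]
  have hcp : Continuous fun y : ℝ => y ^ p := Real.continuous_rpow_const hp0.le
  have hcp1 : Continuous fun y : ℝ => y ^ (p - 1) := Real.continuous_rpow_const (by linarith)
  have hparts : ∫ y in (0 : ℝ)..1, (Real.exp y * y ^ p + Real.exp y * (p * y ^ (p - 1))) =
      Real.exp 1 := by
    rw [intervalIntegral.integral_eq_sub_of_hasDerivAt (f := fun y => Real.exp y * y ^ p)]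
    · simp [Real.zero_rpow hp0.ne']
    · intro x _
      exact (Real.hasDerivAt_exp x).mul (Real.hasDerivAt_rpow_const (Or.inr hp1))
    · exact Continuous.intervalIntegrable (by fun_prop) _ _
  have hsum : ∫ y in (0 : ℝ)..1, (Real.exp y * y ^ p + Real.exp y * (p * y ^ (p - 1))) =
      (∫ y in (0 : ℝ)..1, Real.exp y * y ^ p) + p * ∫ y in (0 : ℝ)..1, Real.exp y * y ^ (p - 1) := by
    rw [intervalIntegral.integral_add (Continuous.intervalIntegrable (by fun_prop) _ _)
      (Continuous.intervalIntegrable (by fun_prop) _ _), ← intervalIntegral.integral_const_mul]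
    congr 1
    apply intervalIntegral.integral_congr
    intro y _
    ring
  have hone : ∫ y in (0 : ℝ)..1, Real.exp y * y = 1 := by
    rw [intervalIntegral.integral_eq_sub_of_hasDerivAt (f := fun y => Real.exp y * (y - 1))]
    · simp
    · intro x _
      refine ((Real.hasDerivAt_exp x).mul ((hasDerivAt_id x).sub_const 1)).congr_deriv ?_
      simp only [id]; ring
    · exact Continuous.intervalIntegrable (by fun_prop) _ _
  have hge : 1 ≤ ∫ y in (0 : ℝ)..1, Real.exp y * y ^ (p - 1) := by
    refine hone.symm.le.trans ?_
    apply intervalIntegral.integral_mono_on zero_le_one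
      (Continuous.intervalIntegrable (by fun_prop) _ _)
      (Continuous.intervalIntegrable (by fun_prop) _ _)
    intro y hy
    apply mul_le_mul_of_nonneg_left _ (Real.exp_pos _).le
    rcases eq_or_lt_of_le hy.1 with rfl | hy0
    · exact Real.rpow_nonneg le_rfl _
    · calc y = y ^ (1 : ℝ) := (Real.rpow_one y).symm
        _ ≤ y ^ (p - 1) := Real.rpow_le_rpow_of_exponent_ge hy0 hy.2 (by linarith)
  nlinarith

/-- Multiplied by `e^c`, the difference of the two sides is `Z c - Γ(p + 1)`. Since `Z` decreases on
`(0, 1]`, only `c = 1` matters, which is `Gamma_add_one_le`. The result says `M''(-c) ≤ p c^{p-2}`.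
-/
theorem expMoment_second_le_of_neg (hp1 : 1 ≤ p) (hp2 : p ≤ 2) {c : ℝ} (hc0 : 0 < c)
    (hc1 : c ≤ 1) :
    expMoment p (-c) ≤ c ^ p - p * c ^ (p - 1) + p * c ^ (p - 2) := by
  have hp0 : 0 < p := by linarith
  have hcont : Continuous fun y : ℝ => Real.exp y * |y| ^ p := by
    have : Continuous fun y : ℝ => |y| ^ p := continuous_abs.rpow_const fun _ => Or.inr hp0.le
    fun_prop
  set Z : ℝ → ℝ := fun a => Real.exp a *
    (1 * a ^ p + (-p) * a ^ (p - 1) + p * a ^ (p - 2)) -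
    ∫ y in (0 : ℝ)..a, Real.exp y * |y| ^ p with hZ
  have hd : ∀ x, 0 < x → HasDerivAt Z
      (Real.exp x * (p * ((2 - p) * x ^ (p - 2) - (2 - p) * x ^ (p - 3)))) x := by
    intro x hx
    have h1 : HasDerivAt (fun a => ∫ y in (0 : ℝ)..a, Real.exp y * |y| ^ p)
        (Real.exp x * |x| ^ p) x :=
      intervalIntegral.integral_hasDerivAt_right (hcont.intervalIntegrable _ _)
        (hcont.stronglyMeasurableAtFilter _ _) hcont.continuousAt
    refine (((Real.hasDerivAt_exp x).mul
      (hasDerivAt_rpow_combination hx 1 (-p) p p)).sub h1).congr_deriv ?_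
    rw [abs_of_pos hx]
    ring
  have hanti : AntitoneOn Z (Ioc 0 1) := by
    apply antitoneOn_of_deriv_nonpos (convex_Ioc 0 1)
    · exact fun x hx => (hd x hx.1).continuousAt.continuousWithinAt
    · exact fun x hx => (hd x (interior_subset hx).1).differentiableAt.differentiableWithinAt
    · intro x hx
      have hx' := interior_subset hx
      rw [(hd x hx'.1).deriv]
      have h1 : x ^ (p - 2) ≤ x ^ (p - 3) :=
        Real.rpow_le_rpow_of_exponent_ge hx'.1 hx'.2 (by linarith)
      have h2 : p * ((2 - p) * x ^ (p - 2) - (2 - p) * x ^ (p - 3)) ≤ 0 := by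
        apply mul_nonpos_of_nonneg_of_nonpos hp0.le
        rw [← mul_sub]
        exact mul_nonpos_of_nonneg_of_nonpos (by linarith) (by linarith)
      exact mul_nonpos_of_nonneg_of_nonpos (Real.exp_pos _).le h2
  have h1 := hanti ⟨hc0, hc1⟩ (right_mem_Ioc.2 zero_lt_one) hc1
  have h2 := Gamma_add_one_le hp1 hp2
  simp only [hZ, Real.one_rpow] at h1
  have h3 : Real.Gamma (p + 1) + ∫ y in (0 : ℝ)..c, Real.exp y * |y| ^ p ≤
      Real.exp c * (1 * c ^ p + (-p) * c ^ (p - 1) + p * c ^ (p - 2)) := by linarith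
  rw [expMoment_neg]
  have h4 : Real.exp (-c) * Real.exp c = 1 := by rw [← Real.exp_add]; simp
  calc _ ≤ Real.exp (-c) * (Real.exp c * (1 * c ^ p + (-p) * c ^ (p - 1) + p * c ^ (p - 2))) :=
        mul_le_mul_of_nonneg_left h3 (Real.exp_pos _).le
    _ = _ := by rw [← mul_assoc, h4]; ring

/-- The second derivative of `expMoment p`. -/
noncomputable def expMomentSecond (p a : ℝ) : ℝ :=
  expMoment p a - |a| ^ p - p * |a| ^ (p - 2) * a

/-- This is the sign condition `ξ τ - τ' ≥ 0`. For `a > 0` it holds even without the factor `1 - ξ`;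
for `a < 0` the available bound is larger than `(|a|^p)''` by the factor `1 / (p - 1)`, and `1 - ξ ≤
p - 1` compensates for it. -/
theorem one_sub_mul_expMomentSecond_le (hp1 : 1 < p) (hp2 : p ≤ 2) {ξ : ℝ} (hξ0 : 0 ≤ ξ)
    (hξ1 : ξ < 1) (hξp : 2 - p ≤ ξ) {a : ℝ} (ha : -1 ≤ a) (ha0 : a ≠ 0) :
    (1 - ξ) * expMomentSecond p a ≤ p * (p - 1) * |a| ^ (p - 2) := by
  rcases lt_or_gt_of_ne ha0 with h | h
  · have h1 := expMoment_second_le_of_neg hp1.le hp2 (c := -a) (by linarith) (by linarith)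
    rw [neg_neg] at h1
    have hb : expMomentSecond p a ≤ p * (-a) ^ (p - 2) := by
      have e : (-a) ^ (p - 1) = (-a) ^ (p - 2) * (-a) := by
        rw [← Real.rpow_add_one (by linarith)]; ring_nf
      rw [expMomentSecond, abs_of_neg h]
      rw [e] at h1
      linarith
    rw [abs_of_neg h]
    have hpos : 0 ≤ p * (-a) ^ (p - 2) :=
      mul_nonneg (by linarith) (Real.rpow_nonneg (by linarith) _)
    calc (1 - ξ) * expMomentSecond p a ≤ (1 - ξ) * (p * (-a) ^ (p - 2)) :=
          mul_le_mul_of_nonneg_left hb (by linarith)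
      _ ≤ (p - 1) * (p * (-a) ^ (p - 2)) := mul_le_mul_of_nonneg_right (by linarith) hpos
      _ = _ := by ring
  · have h1 := expMoment_second_le_of_pos hp1.le hp2 h
    have hb : expMomentSecond p a ≤ p * (p - 1) * a ^ (p - 2) := by
      have e : a ^ (p - 1) = a ^ (p - 2) * a := by
        rw [← Real.rpow_add_one h.ne']; ring_nf
      rw [expMomentSecond, abs_of_pos h]
      rw [e] at h1
      linarith
    rw [abs_of_pos h]
    have hpos : 0 ≤ p * (p - 1) * a ^ (p - 2) :=
      mul_nonneg (mul_nonneg (by linarith) (by linarith)) (Real.rpow_nonneg h.le _)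
    calc (1 - ξ) * expMomentSecond p a ≤ (1 - ξ) * (p * (p - 1) * a ^ (p - 2)) :=
          mul_le_mul_of_nonneg_left hb (by linarith)
      _ ≤ 1 * (p * (p - 1) * a ^ (p - 2)) := mul_le_mul_of_nonneg_right (by linarith) hpos
      _ = _ := by ring

theorem hasDerivAt_deriv_abs_rpow {a : ℝ} (ha : a ≠ 0) :
    HasDerivAt (fun x => p * |x| ^ (p - 2) * x) (p * (p - 1) * |a| ^ (p - 2)) a := by
  have key : ∀ y : ℝ, 0 < y → HasDerivAt (fun x => p * x ^ (p - 2) * x)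
      (p * (p - 1) * y ^ (p - 2)) y := by
    intro y hy
    refine (((Real.hasDerivAt_rpow_const (p := p - 2) (Or.inl hy.ne')).const_mul p).mul
      (hasDerivAt_id y)).congr_deriv ?_
    have e : y ^ (p - 2) = y ^ (p - 2 - 1) * y := by
      rw [← Real.rpow_add_one hy.ne']; ring_nf
    simp only [id]
    rw [e]; ring
  rcases lt_or_gt_of_ne ha with h | h
  · have h1 := (key (-a) (by linarith)).comp a (hasDerivAt_neg a)
    rw [abs_of_neg h]
    have h2 := h1.neg
    refine (h2.congr_of_eventuallyEq ?_).congr_deriv (by ring)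
    filter_upwards [Iio_mem_nhds h] with x hx
    simp only [Pi.neg_apply, Function.comp_apply]
    rw [abs_of_neg hx]; ring
  · rw [abs_of_pos h]
    refine (key a h).congr_of_eventuallyEq ?_
    filter_upwards [Ioi_mem_nhds h] with x hx
    rw [abs_of_pos hx]

theorem continuous_deriv_abs_rpow (hp1 : 1 < p) :
    Continuous fun x : ℝ => p * |x| ^ (p - 2) * x := by
  have h1 : (fun x : ℝ => p * |x| ^ (p - 2) * x) = deriv fun x : ℝ => |x| ^ p :=
    funext fun x => ((hasDerivAt_abs_rpow x hp1).deriv).symm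
  rw [h1]
  have h2 : ContDiff ℝ 1 fun x : ℝ => ‖x‖ ^ p := contDiff_norm_rpow hp1
  exact h2.continuous_deriv le_rfl

theorem tangentFamily_abs_rpow (hp1 : 1 < p) (hp2 : p ≤ 2) {ξ : ℝ} (hξ0 : 0 < ξ)
    (hξ1 : ξ < 1) (hξp : 2 - p ≤ ξ) :
    TangentFamily ξ (fun v => |v| ^ p) (fun v => p * |v| ^ (p - 2) * v)
      (fun a => (1 - ξ) / ξ ^ 2 * expMomentSecond p a) (-1) where
  hasDerivAt v := hasDerivAt_abs_rpow v hp1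
  continuous_deriv := continuous_deriv_abs_rpow hp1
  continuous_coeff := by
    have h1 := continuous_deriv_abs_rpow hp1
    have h2 := continuous_expMoment (p := p) (by linarith)
    have h3 : Continuous fun y : ℝ => |y| ^ p :=
      continuous_abs.rpow_const fun _ => Or.inr (by linarith)
    unfold expMomentSecond
    fun_prop
  envelope a ha ha0 := by
    refine ⟨_, _, hasDerivAt_deriv_abs_rpow ha0,
      (((hasDerivAt_expMoment (by linarith) a).sub (hasDerivAt_abs_rpow a hp1)).sub
        (hasDerivAt_deriv_abs_rpow ha0)).const_mul _, ?_, ?_⟩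
    · unfold expMomentSecond
      field_simp
      ring
    · have h1 := one_sub_mul_expMomentSecond_le hp1 hp2 hξ0.le hξ1 hξp ha.le ha0
      have h2 : 0 ≤ (1 - ξ) / ξ ^ 2 := div_nonneg (by linarith) (by positivity)
      have e : ξ * ((1 - ξ) / ξ ^ 2 * expMomentSecond p a) - (1 - ξ) / ξ ^ 2 *
          (expMoment p a - |a| ^ p - p * |a| ^ (p - 2) * a - p * (p - 1) * |a| ^ (p - 2)) =
          (1 - ξ) / ξ ^ 2 *
            (p * (p - 1) * |a| ^ (p - 2) - (1 - ξ) * expMomentSecond p a) := by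
        unfold expMomentSecond; ring
      rw [e]
      exact mul_nonneg h2 (by linarith)

/-- Both sides agree to first order at `0`, and their second derivatives compare through `(1 +
y)^{p-2} ≥ e^{-ξ y}`, a consequence of `log (1 + y) ≤ y` and `2 - p ≤ ξ`. It puts the plane with
foot `-1` below `|v|^p` for `v ≤ -1`, where the tangent family stops. -/
theorem rpow_taylor_lower (hp1 : 1 < p) (hp2 : p ≤ 2) {ξ : ℝ} (hξ0 : 0 < ξ)
    (hξp : 2 - p ≤ ξ) {y : ℝ} (hy : 0 ≤ y) :
    1 + p * y + p * (p - 1) / ξ ^ 2 * (Real.exp (-(ξ * y)) - 1 + ξ * y) ≤ (1 + y) ^ p := by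
  have hE : ∀ y, HasDerivAt (fun y => Real.exp (-(ξ * y))) (Real.exp (-(ξ * y)) * -(ξ * 1)) y :=
    fun y => (((hasDerivAt_id y).const_mul ξ).neg).exp
  have hR : ∀ q : ℝ, ∀ y : ℝ, 0 ≤ y → HasDerivAt (fun y => (1 + y) ^ q)
      (q * (1 + y) ^ (q - 1)) y := by
    intro q y hy
    refine (((hasDerivAt_id y).const_add 1).rpow_const (p := q)
      (Or.inl (by simp only [id]; linarith))).congr_deriv ?_
    simp only [id]; ring
  set G₁ : ℝ → ℝ := fun y => p * (1 + y) ^ (p - 1) - p - p * (p - 1) / ξ *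
    (1 - Real.exp (-(ξ * y))) with hG₁
  set G : ℝ → ℝ := fun y => (1 + y) ^ p - (1 + p * y + p * (p - 1) / ξ ^ 2 *
    (Real.exp (-(ξ * y)) - 1 + ξ * y)) with hG
  have hG₁d : ∀ y, 0 ≤ y → HasDerivAt G₁
      (p * (p - 1) * ((1 + y) ^ (p - 2) - Real.exp (-(ξ * y)))) y := by
    intro y hy
    refine (((((hR (p - 1) y hy).const_mul p).sub_const p).sub
      (((hE y).const_sub 1).const_mul (p * (p - 1) / ξ)))).congr_deriv ?_
    have : p - 1 - 1 = p - 2 := by ring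
    rw [this]
    field_simp
  have hGd : ∀ y, 0 ≤ y → HasDerivAt G (G₁ y) y := by
    intro y hy
    refine ((hR p y hy).sub ((((hasDerivAt_id y).const_mul p).const_add 1).add
      ((((hE y).sub_const 1).add ((hasDerivAt_id y).const_mul ξ)).const_mul
        (p * (p - 1) / ξ ^ 2)))).congr_deriv ?_
    simp only [hG₁]
    field_simp
    ring
  have mono : ∀ g g' : ℝ → ℝ, (∀ y, 0 ≤ y → HasDerivAt g (g' y) y) → (∀ y, 0 ≤ y → 0 ≤ g' y) →
      g 0 = 0 → ∀ y, 0 ≤ y → 0 ≤ g y := by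
    intro g g' hd hn h0 y hy
    rw [← h0]
    refine le_of_hasDerivAt_nonneg_off_point (c := -1) (g' := g') hy
      (fun x hx => (hd x hx.1).continuousAt.continuousWithinAt)
      (fun x hx _ => hd x hx.1.le) (fun x hx _ => hn x hx.1.le)
  have h1 := mono G₁ _ hG₁d (fun y hy => by
    apply mul_nonneg (mul_nonneg (by linarith) (by linarith))
    rw [sub_nonneg, Real.rpow_def_of_pos (by linarith), Real.exp_le_exp]
    have h2 : Real.log (1 + y) ≤ y := by
      have := Real.log_le_sub_one_of_pos (x := 1 + y) (by linarith)
      linarith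
    have h3 : 0 ≤ Real.log (1 + y) := Real.log_nonneg (by linarith)
    nlinarith) (by simp [hG₁])
  have h2 := mono G _ hGd h1 (by simp [hG]) y hy
  simp only [hG] at h2
  linarith

/-- The plane with foot `-1`, evaluated above `X₁ = 0`. It is affine in the average of `e^φ`, and at
the critical average its value is `ξ^p M(-1)`. -/
theorem integral_abs_rpow_ge_of_reverseJensen_lt (hp1 : 1 < p) (hp2 : p ≤ 2) {φ : ℝ → ℝ}
    {a b N C ξ : ℝ} (hξ0 : 0 < ξ) (hξ1 : ξ < 1) (hξp : 2 - p ≤ ξ)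
    (hint : ∀ g : ℝ → ℝ, Continuous g → IntervalIntegrable (fun x => g (φ x)) volume a b)
    (hN : ∀ x, |φ x| ≤ N) (hJ : ReverseJensen φ a b C) (hC : C * Real.exp ξ < 1 / (1 - ξ))
    {s t : ℝ} (hs : a ≤ s) (hst : s < t) (ht : t ≤ b) (h0 : ∫ x in s..t, φ x = 0) :
    (t - s) * (ξ ^ p * (1 - p + (1 - ξ) / ξ ^ 2 * expMomentSecond p (-1) *
      (Real.exp ξ * ((∫ x in s..t, Real.exp (φ x)) / (t - s)) - 1 - ξ))) ≤
      ∫ x in s..t, |φ x| ^ p := by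
  have hN0 : 0 ≤ N := (abs_nonneg _).trans (hN 0)
  have hNξ : 0 ≤ N / ξ := div_nonneg hN0 hξ0.le
  have hneg1 : (1 - ξ) / ξ ^ 2 * expMomentSecond p (-1) ≤ p * (p - 1) / ξ ^ 2 := by
    have h1 := one_sub_mul_expMomentSecond_le hp1 hp2 hξ0.le hξ1 hξp le_rfl (by norm_num)
    rw [abs_neg, abs_one, Real.one_rpow, mul_one] at h1
    rw [div_mul_eq_mul_div]
    exact div_le_div_of_nonneg_right h1 (by positivity)
  have key := (tangentFamily_abs_rpow hp1 hp2 hξ0 hξ1 hξp).integral_tangentPlane_le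
    hξ1 (a := a) (b := b) (N := N / ξ) (C₀ := C) (ψ := fun x => φ x / ξ)
    (fun g hg => hint (fun v => g (v / ξ)) (by fun_prop))
    (fun x => by
      rw [abs_div, abs_of_pos hξ0]
      exact div_le_div_of_nonneg_right (hN x) hξ0.le)
    (by linarith)
    (fun v hv hv' => by
      have h1 := rpow_taylor_lower hp1 hp2 hξ0 hξp (y := -1 - v) (by linarith)
      have e1 : 1 + (-1 - v) = |v| := by rw [abs_of_neg (by linarith)]; ring
      rw [e1] at h1
      simp only [tangentPlane]
      have e2 : Real.exp (-(ξ * -1)) * Real.exp (ξ * v) = Real.exp (-(ξ * (-1 - v))) := by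
        rw [← Real.exp_add]; congr 1; ring
      rw [e2, abs_neg, abs_one, Real.one_rpow, Real.one_rpow]
      have h2 : 0 ≤ Real.exp (-(ξ * (-1 - v))) - 1 + ξ * (-1 - v) := by
        have := Real.add_one_le_exp (-(ξ * (-1 - v)))
        linarith
      have h3 := mul_le_mul_of_nonneg_right hneg1 h2
      have e3 : Real.exp (-(ξ * (-1 - v))) - 1 - ξ * (v - -1) =
          Real.exp (-(ξ * (-1 - v))) - 1 + ξ * (-1 - v) := by ring
      rw [e3]
      linarith)
    (by exact hC) (hJ.scaled hξ0.ne') hs hst ht (α := -1)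
    ⟨by linarith, by linarith⟩ (by rw [intervalIntegral.integral_div, h0]; simp)
  have e1 : ∀ x, ξ * (φ x / ξ) = φ x := fun x => mul_div_cancel₀ _ hξ0.ne'
  simp_rw [e1] at key
  rw [intervalIntegral.integral_div, h0] at key
  have e2 : ∫ x in s..t, |φ x / ξ| ^ p = (∫ x in s..t, |φ x| ^ p) / ξ ^ p := by
    rw [← intervalIntegral.integral_div]
    apply intervalIntegral.integral_congr
    intro x _
    simp only [abs_div, abs_of_pos hξ0]
    rw [Real.div_rpow (abs_nonneg _) hξ0.le]
  rw [e2, le_div_iff₀ (Real.rpow_pos_of_pos hξ0 p)] at key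
  refine le_trans (le_of_eq ?_) key
  simp only [tangentPlane, abs_neg, abs_one, Real.one_rpow, zero_div]
  ring_nf

theorem strictAntiOn_one_sub_mul_exp :
    StrictAntiOn (fun ξ : ℝ => (1 - ξ) * Real.exp ξ) (Ici 0) := by
  apply strictAntiOn_of_deriv_neg (convex_Ici 0) (by fun_prop)
  intro x hx
  rw [interior_Ici, mem_Ioi] at hx
  rw [(hasDerivAt_one_sub_mul_exp x).deriv]
  have := mul_pos hx (Real.exp_pos x)
  linarith

theorem strictMonoOn_one_sub_mul_exp :
    StrictMonoOn (fun ξ : ℝ => (1 - ξ) * Real.exp ξ) (Iic 0) := by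
  apply strictMonoOn_of_deriv_pos (convex_Iic 0) (by fun_prop)
  intro x hx
  rw [interior_Iic, mem_Iio] at hx
  rw [(hasDerivAt_one_sub_mul_exp x).deriv]
  exact mul_pos (by linarith) (Real.exp_pos x)

/-- The `L^p` lower bound with the critical constant, for functions with mean zero. -/
theorem integral_abs_rpow_ge_of_reverseJensen (hp1 : 1 < p) (hp2 : p ≤ 2) {φ : ℝ → ℝ}
    {a b N C ξ : ℝ} (hξ0 : 0 < ξ) (hξ1 : ξ < 1) (hξp : 2 - p ≤ ξ)
    (hint : ∀ g : ℝ → ℝ, Continuous g → IntervalIntegrable (fun x => g (φ x)) volume a b)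
    (hN : ∀ x, |φ x| ≤ N) (hJ : ReverseJensen φ a b C) (hC : C * ((1 - ξ) * Real.exp ξ) = 1)
    {s t : ℝ} (hs : a ≤ s) (hst : s < t) (ht : t ≤ b) (h0 : ∫ x in s..t, φ x = 0) :
    (t - s) * (ξ ^ p * (1 - p + (1 - ξ) / ξ ^ 2 * expMomentSecond p (-1) *
      (Real.exp ξ * ((∫ x in s..t, Real.exp (φ x)) / (t - s)) - 1 - ξ))) ≤
      ∫ x in s..t, |φ x| ^ p := by
  set X := (∫ x in s..t, Real.exp (φ x)) / (t - s)
  have hc : ContinuousAt (fun ξ : ℝ => (t - s) * (ξ ^ p * (1 - p + (1 - ξ) / ξ ^ 2 *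
      expMomentSecond p (-1) * (Real.exp ξ * X - 1 - ξ)))) ξ := by
    have h1 : ContinuousAt (fun ξ : ℝ => ξ ^ p) ξ :=
      Real.continuousAt_rpow_const _ _ (Or.inl hξ0.ne')
    have h2 : ContinuousAt (fun ξ : ℝ => (1 - ξ) / ξ ^ 2) ξ :=
      ContinuousAt.div (by fun_prop) (by fun_prop) (by positivity)
    fun_prop
  -- For every `ξ' > ξ` the constant `C` is strictly subcritical, and the bound is continuous in
  -- `ξ'`.
  refine le_of_tendsto (hc.tendsto.mono_left (nhdsWithin_le_nhds (s := Ioi ξ))) ?_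
  filter_upwards [Ioo_mem_nhdsGT hξ1] with ξ' hξ'
  refine integral_abs_rpow_ge_of_reverseJensen_lt hp1 hp2 (hξ0.trans hξ'.1) hξ'.2
    (hξp.trans hξ'.1.le) hint hN hJ ?_ hs hst ht h0
  have h1 : (1 - ξ') * Real.exp ξ' < (1 - ξ) * Real.exp ξ :=
    strictAntiOn_one_sub_mul_exp (mem_Ici.2 hξ0.le) (mem_Ici.2 (hξ0.trans hξ'.1).le) hξ'.1
  have hC0 : 0 < C := by
    by_contra! h
    have : 0 < (1 - ξ) * Real.exp ξ := mul_pos (by linarith) (Real.exp_pos _)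
    nlinarith
  rw [lt_div_iff₀ (by linarith [hξ'.2])]
  nlinarith

end expMoment

/-- The variance bound with the critical constant, for functions with mean zero. -/
theorem integral_sq_le_of_reverseJensen_eq {φ : ℝ → ℝ} {a b N C β : ℝ} (hβ : 0 ≤ β)
    (hint : ∀ g : ℝ → ℝ, Continuous g → IntervalIntegrable (fun x => g (φ x)) volume a b)
    (hN : ∀ x, |φ x| ≤ N) (hJ : ReverseJensen φ a b C)
    (hC : C * ((1 + β) * Real.exp (-β)) = 1)
    {s t : ℝ} (hs : a ≤ s) (hst : s < t) (ht : t ≤ b) (h0 : ∫ x in s..t, φ x = 0) :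
    ∫ x in s..t, φ x ^ 2 ≤ β ^ 2 * (t - s) := by
  have hc : ContinuousAt (fun β : ℝ => β ^ 2 * (t - s)) β := by fun_prop
  refine ge_of_tendsto (hc.tendsto.mono_left (nhdsWithin_le_nhds (s := Ioi β))) ?_
  filter_upwards [self_mem_nhdsWithin] with β' hβ'
  rw [mem_Ioi] at hβ'
  refine integral_sq_le_of_reverseJensen (hβ.trans_lt hβ') hint hN hJ ?_ hs hst ht h0
  have h1 := strictMonoOn_one_sub_mul_exp (mem_Iic.2 (by linarith : -β' ≤ 0))
    (mem_Iic.2 (by linarith : -β ≤ 0)) (by linarith : -β' < -β)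
  simp only [sub_neg_eq_add] at h1
  have hC0 : 0 < C := by
    by_contra! h
    have : 0 < (1 + β) * Real.exp (-β) := mul_pos (by linarith) (Real.exp_pos _)
    nlinarith
  rw [lt_div_iff₀ (by linarith)]
  nlinarith

/-! ### The angle between two tangents and the `L¹` bound -/

/-- The two tangents from the point `(0, 1)` to the curve `x₂ = C e^{x₁}`: they touch it over
`x > 0` and `y < 0`. -/
structure TangentPair (C x y : ℝ) : Prop where
  x_pos : 0 < x
  x_lt_one : x < 1
  y_neg : y < 0
  hx : C * ((1 - x) * Real.exp x) = 1
  hy : C * ((1 - y) * Real.exp y) = 1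

/-- The position of an interval of length `l` on which `φ` and `e^φ` have integrals `A` and `E`:
it is below one of the two tangents or its mean lies between the tangency points. -/
def BetweenTangents (x y l A E : ℝ) : Prop :=
  E - l - 1 / (1 - x) * A ≤ 0 ∨ E - l - 1 / (1 - y) * A ≤ 0 ∨ (y * l ≤ A ∧ A ≤ x * l)

namespace TangentPair

variable {C x y : ℝ}

theorem mul_exp_x (H : TangentPair C x y) : C * Real.exp x = 1 / (1 - x) := by
  have := H.x_lt_one
  rw [eq_div_iff (by linarith)]
  linarith [H.hx]

theorem mul_exp_y (H : TangentPair C x y) : C * Real.exp y = 1 / (1 - y) := by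
  have := H.y_neg
  rw [eq_div_iff (by linarith)]
  linarith [H.hy]

theorem slope_x (H : TangentPair C x y) : 1 / (1 - x) = 1 + 1 / (1 - x) * x := by
  have := H.x_lt_one
  have : 1 - x ≠ 0 := by linarith
  field_simp
  ring

theorem slope_y (H : TangentPair C x y) : 1 / (1 - y) = 1 + 1 / (1 - y) * y := by
  have := H.y_neg
  have : 1 - y ≠ 0 := by linarith
  field_simp
  ring

theorem slope_lt (H : TangentPair C x y) : 1 / (1 - y) < 1 / (1 - x) :=
  one_div_lt_one_div_of_lt (by linarith [H.x_lt_one]) (by linarith [H.x_pos, H.y_neg])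

theorem one_le (H : TangentPair C x y) : 1 ≤ C := by
  have h1 : (1 - x) * Real.exp x ≤ 1 := by
    have h3 := Real.add_one_le_exp (-x)
    calc (1 - x) * Real.exp x ≤ Real.exp (-x) * Real.exp x :=
          mul_le_mul_of_nonneg_right (by linarith) (Real.exp_pos _).le
      _ = 1 := by rw [← Real.exp_add]; simp
  have h0 : 0 < (1 - x) * Real.exp x :=
    mul_pos (by linarith [H.x_lt_one]) (Real.exp_pos _)
  have h2 := H.hx
  by_contra! h
  nlinarith

/-- Two adjacent intervals beyond the two tangency points cannot lie above the tangents. -/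
theorem chord_contradiction (H : TangentPair C x y) {l₁ l₂ A₁ A₂ E₁ E₂ : ℝ}
    (hl : 0 < l₁ + l₂) (hA₁ : x * l₁ ≤ A₁) (hA₂ : A₂ ≤ y * l₂)
    (hpos : 0 < (E₁ - l₁ - 1 / (1 - x) * A₁) + (E₂ - l₂ - 1 / (1 - y) * A₂))
    (hy : y * (l₁ + l₂) ≤ A₁ + A₂) (hx : A₁ + A₂ ≤ x * (l₁ + l₂))
    (hE : E₁ + E₂ ≤ C * (l₁ + l₂) * Real.exp ((A₁ + A₂) / (l₁ + l₂))) : False := by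
  have hxy : 0 < x - y := by linarith [H.x_pos, H.y_neg]
  set l := l₁ + l₂ with hl'
  set θ := ((A₁ + A₂) / l - y) / (x - y) with hθ
  have hθ0 : 0 ≤ θ := div_nonneg (by rw [sub_nonneg, le_div_iff₀ hl]; exact hy) hxy.le
  have hθ1 : θ ≤ 1 := by
    rw [hθ, div_le_one hxy, sub_le_sub_iff_right, div_le_iff₀ hl]; exact hx
  have hm : (A₁ + A₂) / l = θ * x + (1 - θ) * y := by
    rw [hθ]; field_simp; ring
  have hA : A₁ + A₂ = (θ * x + (1 - θ) * y) * l := by rw [← hm]; field_simp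
  have hconv : Real.exp ((A₁ + A₂) / l) ≤ θ * Real.exp x + (1 - θ) * Real.exp y := by
    rw [hm]
    exact convexOn_exp.2 (mem_univ x) (mem_univ y) hθ0 (by linarith) (by ring)
  have h3 : C * l * Real.exp ((A₁ + A₂) / l) ≤
      l * (θ * (1 / (1 - x)) + (1 - θ) * (1 / (1 - y))) := by
    rw [← H.mul_exp_x, ← H.mul_exp_y]
    have hC : 0 ≤ C * l := mul_nonneg (by linarith [H.one_le]) hl.le
    have := mul_le_mul_of_nonneg_left hconv hC
    linarith
  -- The whole point lies under the chord joining the two tangency points, whose weights are `θ` and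
  -- `1 - θ`. One of the pieces has at least its weight's share of the length, and either case shows
  -- that the first piece has at least the share `l θ x` of the integral. As the right tangent is
  -- steeper, the point would have to lie above the chord.
  have key : l * θ * x ≤ A₁ := by
    rcases le_total (θ * l) l₁ with h | h
    · have := mul_le_mul_of_nonneg_left h H.x_pos.le
      linarith
    · have h4 : (1 - θ) * l ≤ l₂ := by linarith
      have := mul_le_mul_of_nonpos_left h4 H.y_neg.le
      linarith
  have hs := H.slope_lt
  have ex := H.slope_x
  have ey := H.slope_y
  set p := 1 / (1 - x)
  set n := 1 / (1 - y)
  have e1 : l * (θ * p + (1 - θ) * n) = l + p * (l * θ * x) + n * (l * (1 - θ) * y) := by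
    nth_rewrite 1 [ex]
    nth_rewrite 1 [ey]
    ring
  have h5 : 0 ≤ (p - n) * (A₁ - l * θ * x) := mul_nonneg (by linarith) (by linarith)
  have h6 : A₂ = l * θ * x + l * (1 - θ) * y - A₁ := by linarith
  rw [h6] at hpos
  rw [e1] at h3
  linarith

/-- Moving the end point of a piece that is not between the tangents until it is. -/
theorem exists_split (H : TangentPair C x y) {A E len : ℝ → ℝ} {m z l AI EI : ℝ}
    (hA : ContinuousOn A (uIcc m z)) (hE : ContinuousOn E (uIcc m z))
    (hlen : ContinuousOn len (uIcc m z)) (hAz : A z = AI) (hlz : len z = l)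
    (hpos : ∀ u ∈ uIcc m z, 0 < len u)
    (hdom : ∀ u ∈ uIcc m z, E u ≤ C * len u * Real.exp (A u / len u))
    (hI : EI ≤ C * l * Real.exp (AI / l)) (hl : 0 < l)
    (hy : y * l < AI) (hx : AI < x * l)
    (hm : ¬ BetweenTangents x y (len m) (A m) (E m)) :
    ∃ u ∈ uIcc m z, u ≠ m ∧ u ≠ z ∧
      (E u - len u - 1 / (1 - x) * A u ≤ 0 ∨ E u - len u - 1 / (1 - y) * A u ≤ 0) ∧
      BetweenTangents x y (l - len u) (AI - A u) (EI - E u) := by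
  rw [BetweenTangents, not_or, not_or, not_and_or] at hm
  push Not at hm
  obtain ⟨hR, hN, hor⟩ := hm
  have hdomx : ∀ u ∈ uIcc m z, A u = x * len u → E u - len u - 1 / (1 - x) * A u ≤ 0 := by
    intro u hu h
    have h1 := hdom u hu
    rw [h, mul_div_assoc, div_self (hpos u hu).ne', mul_one] at h1
    have h2 := H.mul_exp_x
    have h3 : E u ≤ len u * (1 / (1 - x)) := by rw [← h2]; linarith
    rw [h]
    nth_rewrite 1 [H.slope_x] at h3
    linarith
  have hdomy : ∀ u ∈ uIcc m z, A u = y * len u → E u - len u - 1 / (1 - y) * A u ≤ 0 := by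
    intro u hu h
    have h1 := hdom u hu
    rw [h, mul_div_assoc, div_self (hpos u hu).ne', mul_one] at h1
    have h2 := H.mul_exp_y
    have h3 : E u ≤ len u * (1 / (1 - y)) := by rw [← h2]; linarith
    rw [h]
    nth_rewrite 1 [H.slope_y] at h3
    linarith
  by_cases hgt : x * len m < A m
  · obtain ⟨u, hu, hum, huz, hA0, hR0, hex⟩ := exists_exit_point
      (A := fun u => A u - x * len u) (Y := fun u => E u - len u - 1 / (1 - x) * A u)
      (m := m) (d := z) (by fun_prop) (by fun_prop) (by linarith) hR
      (by simp only [hAz, hlz]; linarith)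
    -- The moving piece stops either on the tangent or with its mean at the tangency abscissa, where
    -- the upper curve is the tangent itself.
    have hterm : E u - len u - 1 / (1 - x) * A u ≤ 0 := by
      rcases hex with h | h
      · exact hdomx u hu (by linarith)
      · exact h
    refine ⟨u, hu, hum, huz, Or.inl hterm, ?_⟩
    by_contra hb
    rw [BetweenTangents, not_or, not_or, not_and_or] at hb
    push Not at hb
    obtain ⟨-, hN', hor'⟩ := hb
    have hlt : AI - A u < y * (l - len u) := by
      rcases hor' with h | h
      · exact h
      · linarith
    refine H.chord_contradiction (l₁ := len u) (l₂ := l - len u) (A₁ := A u) (A₂ := AI - A u)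
      (E₁ := E u) (E₂ := EI - E u) (by linarith) (by linarith) hlt.le
      (by linarith) ?_ ?_ ?_
    · rw [add_sub_cancel, add_sub_cancel]; exact hy.le
    · rw [add_sub_cancel, add_sub_cancel]; exact hx.le
    · rw [add_sub_cancel, add_sub_cancel, add_sub_cancel]; exact hI
  · have hlt : A m < y * len m := by
      rcases hor with h | h
      · exact h
      · exact absurd h hgt
    obtain ⟨u, hu, hum, huz, hA0, hN0, hex⟩ := exists_exit_point
      (A := fun u => y * len u - A u) (Y := fun u => E u - len u - 1 / (1 - y) * A u)
      (m := m) (d := z) (by fun_prop) (by fun_prop) (by linarith) hN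
      (by simp only [hAz, hlz]; linarith)
    have hterm : E u - len u - 1 / (1 - y) * A u ≤ 0 := by
      rcases hex with h | h
      · exact hdomy u hu (by linarith)
      · exact h
    refine ⟨u, hu, hum, huz, Or.inr hterm, ?_⟩
    by_contra hb
    rw [BetweenTangents, not_or, not_or, not_and_or] at hb
    push Not at hb
    obtain ⟨hR', -, hor'⟩ := hb
    have hlt : x * (l - len u) < AI - A u := by
      rcases hor' with h | h
      · linarith
      · exact h
    refine H.chord_contradiction (l₁ := l - len u) (l₂ := len u) (A₁ := AI - A u) (A₂ := A u)
      (E₁ := EI - E u) (E₂ := E u) (by linarith) hlt.le (by linarith)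
      (by linarith) ?_ ?_ ?_
    · rw [sub_add_cancel, sub_add_cancel]; exact hy.le
    · rw [sub_add_cancel, sub_add_cancel]; exact hx.le
    · rw [sub_add_cancel, sub_add_cancel, sub_add_cancel]; exact hI

/-- Between the tangency abscissae `e^m` lies below the chords from `0`, hence below the tangents.
The coefficient makes the expression equal to `m` on the right tangent and to `-m` on the left one.
-/
theorem plane_le_abs (H : TangentPair C x y) {m : ℝ} (hm : m ∈ Icc y x) :
    2 / (1 / (1 - x) - 1 / (1 - y)) * (Real.exp m - 1 - 1 / (1 - x) * m) + m ≤ |m| := by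
  have hs := H.slope_lt
  have hC := H.one_le
  have hβ : 0 < 2 / (1 / (1 - x) - 1 / (1 - y)) := div_pos two_pos (by linarith)
  have hβe : 2 / (1 / (1 - x) - 1 / (1 - y)) * (1 / (1 - x) - 1 / (1 - y)) = 2 :=
    div_mul_cancel₀ _ (by linarith)
  have hchord : ∀ z, z ≠ 0 → 0 ≤ m / z → m / z ≤ 1 → C * Real.exp z = 1 / (1 - z) →
      1 / (1 - z) = 1 + 1 / (1 - z) * z → Real.exp m ≤ 1 + 1 / (1 - z) * m := by
    intro z hz h0 h1 hCz hsz
    have h2 : Real.exp m ≤ (1 - m / z) * Real.exp 0 + m / z * Real.exp z := by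
      have := convexOn_exp.2 (mem_univ 0) (mem_univ z) (by linarith : 0 ≤ 1 - m / z) h0
        (by ring)
      simp only [smul_eq_mul, mul_zero, zero_add] at this
      rwa [div_mul_cancel₀ _ hz] at this
    have h3 : Real.exp z ≤ 1 + 1 / (1 - z) * z := by
      rw [← hsz, ← hCz]
      nlinarith [Real.exp_pos z]
    rw [Real.exp_zero] at h2
    have h4 := mul_le_mul_of_nonneg_left h3 h0
    have h5 : m / z * (1 / (1 - z) * z) = 1 / (1 - z) * m := by field_simp
    nlinarith
  rcases le_total 0 m with h0 | h0
  · have h1 := hchord x H.x_pos.ne' (div_nonneg h0 H.x_pos.le)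
      ((div_le_one H.x_pos).2 hm.2) H.mul_exp_x H.slope_x
    rw [abs_of_nonneg h0]
    have := mul_nonpos_of_nonneg_of_nonpos hβ.le
      (by linarith : Real.exp m - 1 - 1 / (1 - x) * m ≤ 0)
    linarith
  · have h1 := hchord y H.y_neg.ne (div_nonneg_of_nonpos h0 H.y_neg.le)
      ((div_le_one_of_neg H.y_neg).2 hm.1) H.mul_exp_y H.slope_y
    rw [abs_of_nonpos h0]
    have h2 := mul_nonpos_of_nonneg_of_nonpos hβ.le
      (by linarith : Real.exp m - 1 - 1 / (1 - y) * m ≤ 0)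
    have h3 : (2 / (1 / (1 - x) - 1 / (1 - y)) * (1 / (1 - x) - 1 / (1 - y))) * m = 2 * m := by
      rw [hβe]
    linarith

end TangentPair

set_option maxHeartbeats 1000000 in
/-- The `L¹` lower bound for bounded functions with a reverse Jensen inequality. -/
theorem integral_abs_ge_of_reverseJensen {C x y : ℝ} (H : TangentPair C x y) {φ : ℝ → ℝ}
    {a b N : ℝ}
    (hint : ∀ g : ℝ → ℝ, Continuous g → IntervalIntegrable (fun x => g (φ x)) volume a b)
    (hN : ∀ x, |φ x| ≤ N) (hJ : ReverseJensen φ a b C)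
    {s t : ℝ} (hs : a ≤ s) (hst : s < t) (ht : t ≤ b) (h0 : ∫ x in s..t, φ x = 0) :
    2 / (1 / (1 - x) - 1 / (1 - y)) * ((∫ x in s..t, Real.exp (φ x)) - (t - s)) ≤
      ∫ x in s..t, |φ x| := by
  have hφ : IntervalIntegrable φ volume a b := hint id continuous_id
  have hφe : IntervalIntegrable (fun x => Real.exp (φ x)) volume a b :=
    hint _ Real.continuous_exp
  have hab : a ≤ b := hs.trans (hst.le.trans ht)
  have hN0 : 0 ≤ N := (abs_nonneg _).trans (hN 0)
  have hs' := H.slope_lt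
  have hplane := fun m (hm : m ∈ Icc y x) => H.plane_le_abs hm
  set p := 1 / (1 - x) with hp
  set n := 1 / (1 - y) with hn
  set β := 2 / (p - n) with hβd
  have hβ : 0 < β := div_pos two_pos (by linarith)
  have hβe : β * (p - n) = 2 := div_mul_cancel₀ _ (by linarith)
  set G : ℝ → ℝ := fun v => β * (Real.exp v - 1 - p * v) + v - |v| with hG
  obtain ⟨K, hK0, hK⟩ : ∃ K, 0 ≤ K ∧ ∀ v ∈ Icc (-N) N, ∀ w ∈ Icc (-N) N,
      G v - G w ≤ K * |v - w| := by
    refine ⟨β * (Real.exp N + |p|) + 2, by positivity, fun v hv w hw => ?_⟩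
    have h1 : |Real.exp v - Real.exp w| ≤ Real.exp N * |v - w| := by
      refine (convex_Icc (-N) N).norm_image_sub_le_of_norm_hasDerivWithin_le
        (f := Real.exp) (f' := Real.exp)
        (fun x _ => (Real.hasDerivAt_exp x).hasDerivWithinAt) (fun x hx => ?_) hw hv
      rw [Real.norm_eq_abs, Real.abs_exp]
      exact Real.exp_le_exp.2 hx.2
    have h2 : p * (w - v) ≤ |p| * |v - w| := by
      rw [abs_sub_comm, ← abs_mul]; exact le_abs_self _
    have h3 : |w| - |v| ≤ |v - w| := by
      rw [abs_sub_comm]; exact (le_abs_self _).trans (abs_abs_sub_abs_le _ _)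
    have h4 := le_abs_self (v - w)
    have h5 := (le_abs_self _).trans h1
    have h6 : β * ((Real.exp v - Real.exp w) + p * (w - v)) ≤
        β * (Real.exp N * |v - w| + |p| * |v - w|) :=
      mul_le_mul_of_nonneg_left (add_le_add h5 h2) hβ.le
    simp only [hG]
    linarith
  have key : ∀ ε > 0, β * ((∫ x in s..t, Real.exp (φ x)) - (t - s)) ≤
      (∫ x in s..t, |φ x|) + K * ε := by
    intro ε hε
    obtain ⟨h, hh, e, hei, he0, heε, hosc⟩ := exists_oscillation_bound hab hφ hε
    -- Below a tangent no further splitting is needed: the plane is then at most `∫ φ` or `-∫ φ`, so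
    -- the triangle inequality suffices.
    have hterm : ∀ s t, a ≤ s → s ≤ t → t ≤ b →
        ((∫ x in s..t, Real.exp (φ x)) - (t - s) - p * ∫ x in s..t, φ x) ≤ 0 ∨
        ((∫ x in s..t, Real.exp (φ x)) - (t - s) - n * ∫ x in s..t, φ x) ≤ 0 →
        β * ((∫ x in s..t, Real.exp (φ x)) - (t - s) - p * ∫ x in s..t, φ x) +
          (∫ x in s..t, φ x) ≤ (∫ x in s..t, |φ x|) + K * ∫ x in s..t, e x := by
      intro s t hs hst ht hor
      have h1 := intervalIntegral.abs_integral_le_integral_abs (μ := volume) hst (f := φ)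
      have h2 : 0 ≤ K * ∫ x in s..t, e x :=
        mul_nonneg hK0 (intervalIntegral.integral_nonneg hst fun x _ => he0 x)
      rcases hor with h | h
      · have := mul_nonpos_of_nonneg_of_nonpos hβ.le h
        linarith [le_abs_self (∫ x in s..t, φ x)]
      · have h3 := mul_nonpos_of_nonneg_of_nonpos hβ.le h
        have h4 : β * (p - n) * (∫ x in s..t, φ x) = 2 * ∫ x in s..t, φ x := by rw [hβe]
        linarith [neg_abs_le (∫ x in s..t, φ x)]
    have claim : ∀ k : ℕ, ∀ s t, a ≤ s → s < t → t ≤ b → (t - s) * (1 / 2) ^ k ≤ h →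
        BetweenTangents x y (t - s) (∫ x in s..t, φ x) (∫ x in s..t, Real.exp (φ x)) →
        β * ((∫ x in s..t, Real.exp (φ x)) - (t - s) - p * ∫ x in s..t, φ x) +
          (∫ x in s..t, φ x) ≤ (∫ x in s..t, |φ x|) + K * ∫ x in s..t, e x := by
      intro k
      induction k with
      | zero =>
        intro s t hs hst ht hlen hbt
        have hts : 0 < t - s := sub_pos.2 hst
        rcases hbt with hb | hb | ⟨hb1, hb2⟩
        · exact hterm s t hs hst.le ht (Or.inl hb)
        · exact hterm s t hs hst.le ht (Or.inr hb)
        · have i1 := hφ.mono_Icc hs hst.le ht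
          have i2 := hφe.mono_Icc hs hst.le ht
          set A := ∫ x in s..t, φ x with hA
          set m := A / (t - s) with hm
          have hmxy : m ∈ Icc y x :=
            ⟨by rwa [hm, le_div_iff₀ hts], by rwa [hm, div_le_iff₀ hts]⟩
          have hmN : m ∈ Icc (-N) N := by
            rw [mem_Icc, ← abs_le, hm, abs_div, abs_of_pos hts, div_le_iff₀ hts]
            have := intervalIntegral.norm_integral_le_of_norm_le_const (a := s) (b := t)
              (f := φ) (C := N) (fun x _ => hN x)
            rwa [abs_of_pos hts] at this
          have hGm : G m ≤ 0 := by
            have := hplane m hmxy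
            simp only [hG]; linarith
          have h1 : ∫ x in s..t, ((β * ((Real.exp (φ x) - 1) - p * φ x) + φ x) - |φ x|) ≤
              ∫ x in s..t, K * |φ x - m| := by
            apply intervalIntegral.integral_mono_on hst.le
              (((((i2.sub intervalIntegrable_const).sub (i1.const_mul p)).const_mul β).add
                i1).sub i1.abs) ((i1.sub intervalIntegrable_const).abs.const_mul K)
            intro z _
            have := hK (φ z) (abs_le.1 (hN z)) m hmN
            have e1 : G (φ z) = (β * ((Real.exp (φ z) - 1) - p * φ z) + φ z) - |φ z| := rfl
            rw [← e1]
            linarith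
          rw [intervalIntegral.integral_sub ((((i2.sub intervalIntegrable_const).sub
              (i1.const_mul p)).const_mul β).add i1) i1.abs,
            intervalIntegral.integral_add (((i2.sub intervalIntegrable_const).sub
              (i1.const_mul p)).const_mul β) i1,
            intervalIntegral.integral_const_mul,
            intervalIntegral.integral_sub (i2.sub intervalIntegrable_const) (i1.const_mul p),
            intervalIntegral.integral_sub i2 intervalIntegrable_const,
            intervalIntegral.integral_const_mul, intervalIntegral.integral_const,
            smul_eq_mul, mul_one, intervalIntegral.integral_const_mul] at h1
          have h2 := hosc s t hs hst ht (by simpa using hlen)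
          have h3 := mul_le_mul_of_nonneg_left h2 hK0
          linarith
      | succ k ih =>
        intro s t hs hst ht hlen hbt
        have hts : 0 < t - s := sub_pos.2 hst
        by_cases hfin : ((∫ x in s..t, Real.exp (φ x)) - (t - s) - p * ∫ x in s..t, φ x) ≤ 0 ∨
            ((∫ x in s..t, Real.exp (φ x)) - (t - s) - n * ∫ x in s..t, φ x) ≤ 0
        · exact hterm s t hs hst.le ht hfin
        have hfin' := hfin
        rw [not_or, not_le, not_le] at hfin'
        obtain ⟨hRI, hNI⟩ := hfin'
        obtain ⟨hy1, hx1⟩ : y * (t - s) ≤ (∫ x in s..t, φ x) ∧ (∫ x in s..t, φ x) ≤ x * (t - s) := by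
          rcases hbt with hb | hb | hb
          · exact absurd hb (not_le.2 hRI)
          · exact absurd hb (not_le.2 hNI)
          · exact hb
        have hdomI := hJ s t hs hst ht
        have hsplit : ∀ g : ℝ → ℝ, IntervalIntegrable g volume a b → ∀ m, s ≤ m → m ≤ t →
            ∫ x in s..t, g x = (∫ x in s..m, g x) + ∫ x in m..t, g x := by
          intro g hg m h1 h2
          exact (intervalIntegral.integral_add_adjacent_intervals
            (hg.mono_Icc hs h1 (h2.trans ht)) (hg.mono_Icc (hs.trans h1) h2 ht)).symm
        have hx2 : (∫ x in s..t, φ x) < x * (t - s) := by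
          refine lt_of_le_of_ne hx1 fun he => ?_
          rw [he, mul_div_assoc, div_self hts.ne', mul_one] at hdomI
          rw [he] at hRI
          have e1 := H.mul_exp_x
          have e2 := H.slope_x
          rw [← hp] at e1 e2
          have e3 : C * (t - s) * Real.exp x = (t - s) * p := by rw [← e1]; ring
          have e4 : (t - s) * p = (t - s) + p * (x * (t - s)) := by
            nth_rewrite 1 [e2]; ring
          linarith
        have hy2 : y * (t - s) < (∫ x in s..t, φ x) := by
          refine lt_of_le_of_ne hy1 fun he => ?_
          rw [← he, mul_div_assoc, div_self hts.ne', mul_one] at hdomI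
          rw [← he] at hNI
          have e1 := H.mul_exp_y
          have e2 := H.slope_y
          rw [← hn] at e1 e2
          have e3 : C * (t - s) * Real.exp y = (t - s) * n := by rw [← e1]; ring
          have e4 : (t - s) * n = (t - s) + n * (y * (t - s)) := by
            nth_rewrite 1 [e2]; ring
          linarith
        -- In each cut, a piece to which the induction hypothesis is applied has at most half the
        -- length; a longer piece lies below a tangent and is settled by `hterm`.
        have hl : ∀ z, z ≤ (t - s) / 2 → z * (1 / 2) ^ k ≤ h := by
          intro z hz
          refine le_trans ?_ hlen
          rw [pow_succ']
          calc z * (1 / 2) ^ k ≤ (t - s) / 2 * (1 / 2) ^ k :=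
                mul_le_mul_of_nonneg_right hz (by positivity)
            _ = _ := by ring
        have hcomb : ∀ m, s < m → m < t →
            β * ((∫ x in s..m, Real.exp (φ x)) - (m - s) - p * ∫ x in s..m, φ x) +
              (∫ x in s..m, φ x) ≤ (∫ x in s..m, |φ x|) + K * ∫ x in s..m, e x →
            β * ((∫ x in m..t, Real.exp (φ x)) - (t - m) - p * ∫ x in m..t, φ x) +
              (∫ x in m..t, φ x) ≤ (∫ x in m..t, |φ x|) + K * ∫ x in m..t, e x →
            β * ((∫ x in s..t, Real.exp (φ x)) - (t - s) - p * ∫ x in s..t, φ x) +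
              (∫ x in s..t, φ x) ≤ (∫ x in s..t, |φ x|) + K * ∫ x in s..t, e x := by
          intro m h1 h2 c1 c2
          rw [hsplit _ hφ m h1.le h2.le, hsplit _ hφe m h1.le h2.le,
            hsplit _ hφ.abs m h1.le h2.le, hsplit _ hei m h1.le h2.le]
          linarith
        have hcont : ∀ g : ℝ → ℝ, IntervalIntegrable g volume a b →
            ContinuousOn (fun y => ∫ x in s..y, g x) (Icc s t) := by
          intro g hg
          have hg' : IntegrableOn g (uIcc s t) := by
            rw [uIcc_of_le hst.le, integrableOn_Icc_iff_integrableOn_Ioc]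
            exact (intervalIntegrable_iff_integrableOn_Ioc_of_le hst.le).1
              (hg.mono_Icc hs hst.le ht)
          have := intervalIntegral.continuousOn_primitive_interval hg'
          rwa [uIcc_of_le hst.le] at this
        have c1 := hcont φ hφ
        have c2 := hcont _ hφe
        set m := (s + t) / 2 with hm
        have hsm : s < m := by rw [hm]; linarith
        have hmt : m < t := by rw [hm]; linarith
        by_cases ha1 : BetweenTangents x y (m - s) (∫ x in s..m, φ x)
            (∫ x in s..m, Real.exp (φ x))
        · by_cases ha2 : BetweenTangents x y (t - m) (∫ x in m..t, φ x)
              (∫ x in m..t, Real.exp (φ x))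
          · exact hcomb m hsm hmt
              (ih s m hs hsm (hmt.le.trans ht) (hl _ (by rw [hm]; linarith)) ha1)
              (ih m t (hs.trans hsm.le) hmt ht (hl _ (by rw [hm]; linarith)) ha2)
          · have hsub : uIcc m s ⊆ Icc s t := by
              rw [uIcc_of_ge hsm.le]; exact Icc_subset_Icc_right hmt.le
            have esuf : ∀ g : ℝ → ℝ, IntervalIntegrable g volume a b → ∀ u ∈ Icc s t,
                (∫ x in s..t, g x) - ∫ x in s..u, g x = ∫ x in u..t, g x := by
              intro g hg u hu
              rw [hsplit g hg u hu.1 hu.2]; ring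
            obtain ⟨u, hu, hum, hus, hor, hbet⟩ := H.exists_split
              (A := fun u => (∫ x in s..t, φ x) - ∫ x in s..u, φ x)
              (E := fun u => (∫ x in s..t, Real.exp (φ x)) - ∫ x in s..u, Real.exp (φ x))
              (len := fun u => t - u) (m := m) (z := s) (l := t - s)
              (continuousOn_const.sub (c1.mono hsub)) (continuousOn_const.sub (c2.mono hsub))
              (by fun_prop) (by simp only [intervalIntegral.integral_same, sub_zero]) rfl
              (fun u hu => by rw [uIcc_of_ge hsm.le] at hu; linarith [hu.2])
              (fun u hu => by
                rw [esuf _ hφ u (hsub hu), esuf _ hφe u (hsub hu)]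
                rw [uIcc_of_ge hsm.le] at hu
                exact hJ u t (hs.trans hu.1) (hu.2.trans_lt hmt) ht)
              hdomI hts hy2 hx2
              (by
                rwa [esuf _ hφ m ⟨hsm.le, hmt.le⟩, esuf _ hφe m ⟨hsm.le, hmt.le⟩])
            have hu' := hsub hu
            rw [esuf _ hφ u hu', esuf _ hφe u hu'] at hor hbet
            rw [uIcc_of_ge hsm.le] at hu
            have hsu : s < u := lt_of_le_of_ne hu.1 (Ne.symm hus)
            have hut : u < t := hu.2.trans_lt hmt
            refine hcomb u hsu hut (ih s u hs hsu (hut.le.trans ht)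
              (hl _ (by linarith [hu.2])) ?_)
              (hterm u t (hs.trans hsu.le) hut.le ht hor)
            have e1 := esuf _ hφ u hu'
            have e2 := esuf _ hφe u hu'
            have e3 : (∫ x in s..t, φ x) - ∫ x in u..t, φ x = ∫ x in s..u, φ x := by linarith
            have e4 : (∫ x in s..t, Real.exp (φ x)) - ∫ x in u..t, Real.exp (φ x) =
              ∫ x in s..u, Real.exp (φ x) := by linarith
            have e5 : t - s - (t - u) = u - s := by ring
            rwa [e3, e4, e5] at hbet
        · have hsub : uIcc m t ⊆ Icc s t := by
            rw [uIcc_of_le hmt.le]; exact Icc_subset_Icc_left hsm.le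
          obtain ⟨u, hu, hum, hut, hor, hbet⟩ := H.exists_split
            (A := fun u => ∫ x in s..u, φ x) (E := fun u => ∫ x in s..u, Real.exp (φ x))
            (len := fun u => u - s) (m := m) (z := t) (l := t - s)
            (c1.mono hsub) (c2.mono hsub) (by fun_prop) rfl rfl
            (fun u hu => by rw [uIcc_of_le hmt.le] at hu; linarith [hu.1])
            (fun u hu => by
              rw [uIcc_of_le hmt.le] at hu
              exact hJ s u hs (hsm.trans_le hu.1) (hu.2.trans ht))
            hdomI hts hy2 hx2 ha1
          rw [uIcc_of_le hmt.le] at hu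
          have hut' : u < t := lt_of_le_of_ne hu.2 hut
          have hsu : s < u := hsm.trans_le hu.1
          have e3 : (∫ x in s..t, φ x) - ∫ x in s..u, φ x = ∫ x in u..t, φ x := by
            rw [hsplit _ hφ u hsu.le hut'.le]; ring
          have e4 : (∫ x in s..t, Real.exp (φ x)) - ∫ x in s..u, Real.exp (φ x) =
            ∫ x in u..t, Real.exp (φ x) := by
            rw [hsplit _ hφe u hsu.le hut'.le]; ring
          have e5 : t - s - (u - s) = t - u := by ring
          rw [e3, e4, e5] at hbet
          exact hcomb u hsu hut' (hterm s u hs hsu.le (hut'.le.trans ht) hor)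
            (ih u t (hs.trans hsu.le) hut' ht (hl _ (by linarith [hu.1])) hbet)
    obtain ⟨k, hk⟩ := exists_pow_lt_of_lt_one (x := h / (t - s))
      (div_pos hh (sub_pos.2 hst)) (by norm_num : (1 / 2 : ℝ) < 1)
    have hts : 0 < t - s := sub_pos.2 hst
    have hc := claim k s t hs hst ht (by
      rw [lt_div_iff₀ hts] at hk
      linarith) (Or.inr (Or.inr (by
        rw [h0]
        exact ⟨mul_nonpos_of_nonpos_of_nonneg H.y_neg.le hts.le, mul_nonneg H.x_pos.le hts.le⟩)))
    rw [h0, mul_zero, sub_zero, add_zero] at hc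
    have h1 : ∫ x in s..t, e x ≤ ∫ x in a..b, e x :=
      intervalIntegral.integral_mono_interval hs hst.le ht
        (Filter.Eventually.of_forall he0) hei
    have h2 := mul_le_mul_of_nonneg_left (h1.trans heε) hK0
    linarith
  refine le_of_forall_pos_le_add fun ε hε => ?_
  have h1 := key (ε / (K + 1)) (by positivity)
  have h2 : K * (ε / (K + 1)) ≤ ε := by
    rw [mul_div_assoc', div_le_iff₀ (by linarith)]
    nlinarith
  linarith

/-! ### Monotone contractions and truncation -/

theorem ConvexOn.rightDeriv_tangent {Φ : ℝ → ℝ} (h : ConvexOn ℝ univ Φ) (y z : ℝ) :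
    Φ y + derivWithin Φ (Ioi y) y * z ≤ Φ (y + z) := by
  have hint : ∀ x : ℝ, x ∈ interior (univ : Set ℝ) := fun x => by simp
  rcases lt_trichotomy z 0 with hz | rfl | hz
  · have h1 := h.slope_le_leftDeriv_of_mem_interior (mem_univ (y + z)) (hint y) (by linarith)
    have h2 := h1.trans (h.leftDeriv_le_rightDeriv_of_mem_interior (hint y))
    rw [slope_def_field, div_le_iff₀ (by linarith)] at h2
    nlinarith
  · simp
  · have h1 := h.rightDeriv_le_slope_of_mem_interior (hint y) (mem_univ (y + z)) (by linarith)
    rw [slope_def_field, le_div_iff₀ (by linarith)] at h1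
    nlinarith

/-- Applying a nondecreasing contraction to a function decreases its centered convex moments. -/
theorem integral_convex_contraction_le {α : Type*} [MeasurableSpace α] {μ : Measure α}
    {X : α → ℝ} {f Φ : ℝ → ℝ} {m m' M : ℝ} (hf : Monotone f) (hg : Monotone fun x => x - f x)
    (hX : Integrable (fun ω => X ω - m) μ) (hfX : Integrable (fun ω => f (X ω) - m') μ)
    (hm : ∫ ω, (X ω - m) ∂μ = 0) (hm' : ∫ ω, (f (X ω) - m') ∂μ = 0)
    (hM : ∀ ω, |f (X ω)| ≤ M) (hΦ : ConvexOn ℝ univ Φ)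
    (hΦX : Integrable (fun ω => Φ (X ω - m)) μ)
    (hΦf : Integrable (fun ω => Φ (f (X ω) - m')) μ) :
    ∫ ω, Φ (f (X ω) - m') ∂μ ≤ ∫ ω, Φ (X ω - m) ∂μ := by
  set D : ℝ → ℝ := fun y => derivWithin Φ (Ioi y) y with hD
  have hDmono : Monotone D := by
    have := hΦ.monotoneOn_rightDeriv
    rw [interior_univ] at this
    exact monotoneOn_univ.1 this
  set Z : α → ℝ := fun ω => (X ω - m) - (f (X ω) - m') with hZ
  have hb : ∀ ω, D (-M - m') ≤ D (f (X ω) - m') ∧ D (f (X ω) - m') ≤ D (M - m') := fun ω =>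
    ⟨hDmono (by linarith [(abs_le.1 (hM ω)).1]), hDmono (by linarith [(abs_le.1 (hM ω)).2])⟩
  -- Both factors on the right are nondecreasing functions of `X`. So `κ` can be the value of `D`
  -- where `Z` changes sign, taken as the supremum over `Z < 0`, which is finite because `f (X)` is
  -- bounded. As `Z` has mean zero, the first-order term in the convexity inequality has nonnegative
  -- integral.
  obtain ⟨κ, hκ⟩ : ∃ κ, ∀ ω, κ * Z ω ≤ D (f (X ω) - m') * Z ω := by
    by_cases hne : ∃ ω, Z ω < 0
    · obtain ⟨ω₀, hω₀⟩ := hne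
      have hbdd : BddAbove ((fun ω => D (f (X ω) - m')) '' {ω | Z ω < 0}) :=
        ⟨D (M - m'), by rintro _ ⟨ω, -, rfl⟩; exact (hb ω).2⟩
      refine ⟨sSup ((fun ω => D (f (X ω) - m')) '' {ω | Z ω < 0}), fun ω => ?_⟩
      rcases lt_or_ge (Z ω) 0 with h | h
      · exact mul_le_mul_of_nonpos_right (le_csSup hbdd ⟨ω, h, rfl⟩) h.le
      · apply mul_le_mul_of_nonneg_right _ h
        apply csSup_le (Set.Nonempty.image _ ⟨ω₀, hω₀⟩)
        rintro _ ⟨ω', hω', rfl⟩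
        apply hDmono
        have hlt : Z ω' < Z ω := lt_of_lt_of_le hω' h
        have : X ω' ≤ X ω := by
          by_contra! hc
          have := hg hc.le
          simp only [hZ] at hlt
          simp only at this
          linarith
        linarith [hf this]
    · push Not at hne
      exact ⟨D (-M - m'), fun ω => mul_le_mul_of_nonneg_right (hb ω).1 (hne ω)⟩
  have hZi : Integrable Z μ := hX.sub hfX
  have hZ0 : ∫ ω, Z ω ∂μ = 0 := by
    simp only [hZ]
    rw [integral_sub hX hfX, hm, hm', sub_zero]
  have h1 : ∫ ω, (Φ (f (X ω) - m') + κ * Z ω) ∂μ ≤ ∫ ω, Φ (X ω - m) ∂μ := by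
    apply integral_mono (hΦf.add (hZi.const_mul κ)) hΦX
    intro ω
    have h2 := hΦ.rightDeriv_tangent (f (X ω) - m') (Z ω)
    have h3 : f (X ω) - m' + Z ω = X ω - m := by simp only [hZ]; ring
    rw [h3] at h2
    have := hκ ω
    simp only [hD] at this
    simp only [Pi.add_apply]
    linarith
  rwa [integral_add hΦf (hZi.const_mul κ), integral_const_mul, hZ0, mul_zero, add_zero] at h1

theorem convexOn_abs_rpow {p : ℝ} (hp : 1 ≤ p) : ConvexOn ℝ univ fun x : ℝ => |x| ^ p := by
  refine ⟨convex_univ, fun x _ y _ a b ha hb hab => ?_⟩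
  have h1 : |a • x + b • y| ≤ a • |x| + b • |y| := by
    simp only [smul_eq_mul]
    calc |a * x + b * y| ≤ |a * x| + |b * y| := abs_add_le _ _
      _ = _ := by rw [abs_mul, abs_mul, abs_of_nonneg ha, abs_of_nonneg hb]
  exact (Real.rpow_le_rpow (abs_nonneg _) h1 (by linarith)).trans
    ((convexOn_rpow hp).2 (abs_nonneg x) (abs_nonneg y) ha hb hab)

/-- Truncation at the levels `±N`. -/
noncomputable def clampAt (N x : ℝ) : ℝ := max (-N) (min N x)

theorem clampAt_mono (N : ℝ) : Monotone (clampAt N) := fun _ _ h =>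
  max_le_max le_rfl (min_le_min le_rfl h)

theorem continuous_clampAt (N : ℝ) : Continuous (clampAt N) := by
  unfold clampAt; fun_prop

theorem sub_clampAt_mono (N : ℝ) : Monotone fun x => x - clampAt N x := by
  intro x y h
  simp only [clampAt]
  rcases max_cases (-N) (min N x) with h1 | h1 <;> rcases max_cases (-N) (min N y) with h2 | h2 <;>
  rcases min_cases N x with h3 | h3 <;> rcases min_cases N y with h4 | h4 <;> linarith

theorem abs_clampAt_le {N : ℝ} (hN : 0 ≤ N) (x : ℝ) : |clampAt N x| ≤ N :=
  abs_le.2 ⟨le_max_left _ _, max_le (by linarith) (min_le_left _ _)⟩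

theorem clampAt_of_abs_le {N x : ℝ} (h : |x| ≤ N) : clampAt N x = x := by
  rw [clampAt, min_eq_right (abs_le.1 h).2, max_eq_right (abs_le.1 h).1]

theorem abs_clampAt_le_abs {N : ℝ} (hN : 0 ≤ N) (x : ℝ) : |clampAt N x| ≤ |x| := by
  rcases le_total |x| N with h | h
  · rw [clampAt_of_abs_le h]
  · exact (abs_clampAt_le hN x).trans h

theorem tendsto_clampAt (x : ℝ) :
    Filter.Tendsto (fun n : ℕ => clampAt n x) Filter.atTop (nhds x) := by
  apply tendsto_const_nhds.congr'
  filter_upwards [Filter.eventually_ge_atTop ⌈|x|⌉₊] with n hn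
  exact (clampAt_of_abs_le ((Nat.le_ceil _).trans (by exact_mod_cast hn))).symm

theorem IntervalIntegrable.comp_clampAt {φ : ℝ → ℝ} {a b N : ℝ} (hN : 0 ≤ N) (hab : a ≤ b)
    (hφ : IntervalIntegrable φ volume a b) {g : ℝ → ℝ} (hg : Continuous g) :
    IntervalIntegrable (fun x => g (clampAt N (φ x))) volume a b := by
  rw [intervalIntegrable_iff_integrableOn_Ioc_of_le hab] at hφ ⊢
  obtain ⟨K, hK⟩ := (isCompact_Icc (a := -N) (b := N)).exists_bound_of_continuousOn hg.continuousOn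
  have hm : AEStronglyMeasurable (fun x => g (clampAt N (φ x))) (volume.restrict (Ioc a b)) :=
    (hg.comp (continuous_clampAt N)).comp_aestronglyMeasurable hφ.aestronglyMeasurable
  exact Integrable.of_bound hm K
    (Filter.Eventually.of_forall fun x => hK _ (abs_le.1 (abs_clampAt_le hN _)))

section interval

variable {φ : ℝ → ℝ} {s t : ℝ}

theorem integral_sub_average (hst : s < t) (hφ : IntervalIntegrable φ volume s t) :
    ∫ x in s..t, (φ x - (∫ y in s..t, φ y) / (t - s)) = 0 := by
  have hts : t - s ≠ 0 := (sub_pos.2 hst).ne'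
  rw [intervalIntegral.integral_sub hφ intervalIntegrable_const, intervalIntegral.integral_const,
    smul_eq_mul, mul_div_cancel₀ _ hts, sub_self]

theorem integral_convex_clampAt_le {Φ : ℝ → ℝ} (hΦ : ConvexOn ℝ univ Φ) (hΦc : Continuous Φ)
    {N : ℝ} (hN : 0 ≤ N) (hst : s < t) (hφ : IntervalIntegrable φ volume s t)
    (hi : IntervalIntegrable (fun x => Φ (φ x - (∫ y in s..t, φ y) / (t - s))) volume s t) :
    ∫ x in s..t, Φ (clampAt N (φ x) - (∫ y in s..t, clampAt N (φ y)) / (t - s)) ≤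
      ∫ x in s..t, Φ (φ x - (∫ y in s..t, φ y) / (t - s)) := by
  have hc : IntervalIntegrable (fun x => clampAt N (φ x)) volume s t :=
    hφ.comp_clampAt hN hst.le continuous_id
  have h1 := integral_sub_average hst hφ
  have h2 := integral_sub_average hst hc
  set m := (∫ y in s..t, φ y) / (t - s)
  set m' := (∫ y in s..t, clampAt N (φ y)) / (t - s)
  have h3 : IntervalIntegrable (fun x => Φ (clampAt N (φ x) - m')) volume s t :=
    hφ.comp_clampAt hN hst.le (g := fun v => Φ (v - m')) (by fun_prop)
  have h4 : IntervalIntegrable (fun x => φ x - m) volume s t := hφ.sub intervalIntegrable_const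
  have h5 : IntervalIntegrable (fun x => clampAt N (φ x) - m') volume s t :=
    hc.sub intervalIntegrable_const
  rw [intervalIntegrable_iff_integrableOn_Ioc_of_le hst.le] at h3 h4 h5 hi
  rw [intervalIntegral.integral_of_le hst.le] at h1 h2 ⊢
  rw [intervalIntegral.integral_of_le hst.le]
  exact integral_convex_contraction_le (clampAt_mono N) (sub_clampAt_mono N) h4 h5 h1 h2
    (fun x => abs_clampAt_le hN _) hΦ hi h3

theorem tendsto_integral_clampAt (hst : s < t) (hφ : IntervalIntegrable φ volume s t) :
    Filter.Tendsto (fun n : ℕ => (∫ y in s..t, clampAt n (φ y)) / (t - s)) Filter.atTop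
      (nhds ((∫ y in s..t, φ y) / (t - s))) := by
  refine Filter.Tendsto.div_const ?_ _
  refine intervalIntegral.tendsto_integral_filter_of_dominated_convergence (fun x => |φ x|)
    (Filter.Eventually.of_forall fun n => ?_) (Filter.Eventually.of_forall fun n =>
      Filter.Eventually.of_forall fun x _ => abs_clampAt_le_abs n.cast_nonneg _) hφ.abs
    (Filter.Eventually.of_forall fun x _ => tendsto_clampAt _)
  rw [uIoc_of_le hst.le]
  exact (continuous_clampAt _).comp_aestronglyMeasurable
    ((intervalIntegrable_iff_integrableOn_Ioc_of_le hst.le).1 hφ).aestronglyMeasurable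

theorem tendsto_integral_exp_clampAt (hst : s < t) (hφ : IntervalIntegrable φ volume s t)
    (hφe : IntervalIntegrable (fun x => Real.exp (φ x)) volume s t) :
    Filter.Tendsto (fun n : ℕ => ∫ y in s..t, Real.exp (clampAt n (φ y))) Filter.atTop
      (nhds (∫ y in s..t, Real.exp (φ y))) := by
  refine intervalIntegral.tendsto_integral_filter_of_dominated_convergence
    (fun x => Real.exp (φ x) + 1)
    (Filter.Eventually.of_forall fun n => ?_) (Filter.Eventually.of_forall fun n =>
      Filter.Eventually.of_forall fun x _ => ?_) (hφe.add intervalIntegrable_const)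
    (Filter.Eventually.of_forall fun x _ =>
      (Real.continuous_exp.tendsto _).comp (tendsto_clampAt _))
  · rw [uIoc_of_le hst.le]
    exact (Real.continuous_exp.comp (continuous_clampAt _)).comp_aestronglyMeasurable
      ((intervalIntegrable_iff_integrableOn_Ioc_of_le hst.le).1 hφ).aestronglyMeasurable
  · rw [Real.norm_eq_abs, Real.abs_exp]
    have h1 : clampAt n (φ x) ≤ max 0 (φ x) :=
      max_le (by have := n.cast_nonneg (α := ℝ); exact le_max_of_le_left (by linarith))
        ((min_le_right _ _).trans (le_max_right _ _))
    rcases max_cases 0 (φ x) with h | h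
    · rw [h.1] at h1
      have := Real.exp_le_exp.2 h1
      rw [Real.exp_zero] at this
      linarith [Real.exp_pos (φ x)]
    · rw [h.1] at h1
      linarith [Real.exp_le_exp.2 h1]

/-- Uniform bounds for centered truncations pass to the limit. -/
theorem lintegral_le_of_clampAt {Φ : ℝ → ℝ} (hΦc : Continuous Φ) (hΦ0 : ∀ x, 0 ≤ Φ x) {B : ℝ}
    (hst : s < t) (hφ : IntervalIntegrable φ volume s t)
    (h : ∀ n : ℕ, ∫ x in s..t,
      Φ (clampAt n (φ x) - (∫ y in s..t, clampAt n (φ y)) / (t - s)) ≤ B) :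
    ∫⁻ x in Ioo s t, ENNReal.ofReal (Φ (φ x - (∫ y in s..t, φ y) / (t - s))) ≤
      ENNReal.ofReal B := by
  have hm := tendsto_integral_clampAt hst hφ
  have hlim : ∀ x, ENNReal.ofReal (Φ (φ x - (∫ y in s..t, φ y) / (t - s))) =
      Filter.liminf (fun n : ℕ => ENNReal.ofReal
        (Φ (clampAt n (φ x) - (∫ y in s..t, clampAt n (φ y)) / (t - s)))) Filter.atTop := by
    intro x
    refine (Filter.Tendsto.liminf_eq ?_).symm
    exact (ENNReal.continuous_ofReal.tendsto _).comp
      ((hΦc.tendsto _).comp ((tendsto_clampAt _).sub hm))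
  simp_rw [hlim]
  have hmeas : AEStronglyMeasurable φ (volume.restrict (Ioo s t)) :=
    ((intervalIntegrable_iff_integrableOn_Ioo_of_le hst.le).1 hφ).aestronglyMeasurable
  -- Fatou's lemma, so that no integrability of `Φ` of the centered function is presupposed.
  refine (lintegral_liminf_le' fun n => ?_).trans ?_
  · refine ENNReal.measurable_ofReal.comp_aemeasurable ?_
    have hc : Continuous fun v =>
        Φ (clampAt n v - (∫ y in s..t, clampAt n (φ y)) / (t - s)) := by
      have := continuous_clampAt (n : ℝ)
      fun_prop
    exact (hc.comp_aestronglyMeasurable hmeas).aemeasurable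
  · refine Filter.liminf_le_of_le (by isBoundedDefault) fun c hc => ?_
    obtain ⟨n, hn⟩ := hc.exists
    refine hn.trans ?_
    have hi : IntervalIntegrable (fun x =>
        Φ (clampAt n (φ x) - (∫ y in s..t, clampAt n (φ y)) / (t - s))) volume s t :=
      hφ.comp_clampAt n.cast_nonneg hst.le
        (g := fun v => Φ (v - (∫ y in s..t, clampAt n (φ y)) / (t - s))) (by fun_prop)
    rw [← ofReal_integral_eq_lintegral_ofReal
      ((intervalIntegrable_iff_integrableOn_Ioo_of_le hst.le).1 hi)
      (Filter.Eventually.of_forall fun x => hΦ0 _)]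
    apply ENNReal.ofReal_le_ofReal
    rw [← integral_Ioc_eq_integral_Ioo, ← intervalIntegral.integral_of_le hst.le]
    exact h n

/-- The centered moments of a truncation are at most those of the function. -/
theorem ofReal_integral_clampAt_le {p : ℝ} (hp : 1 ≤ p) {N : ℝ} (hN : 0 ≤ N) (hst : s < t)
    (hφ : IntervalIntegrable φ volume s t) :
    ENNReal.ofReal (∫ x in s..t,
      |clampAt N (φ x) - (∫ y in s..t, clampAt N (φ y)) / (t - s)| ^ p) ≤
    ∫⁻ x in Ioo s t, ENNReal.ofReal (|φ x - (∫ y in s..t, φ y) / (t - s)| ^ p) := by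
  by_cases htop : ∫⁻ x in Ioo s t,
      ENNReal.ofReal (|φ x - (∫ y in s..t, φ y) / (t - s)| ^ p) = ⊤
  · rw [htop]; exact le_top
  have hc : Continuous fun v : ℝ => |v - (∫ y in s..t, φ y) / (t - s)| ^ p :=
    Continuous.rpow_const (by fun_prop) fun _ => Or.inr (by linarith)
  have hi : IntegrableOn (fun x => |φ x - (∫ y in s..t, φ y) / (t - s)| ^ p) (Ioo s t) := by
    refine (lintegral_ofReal_ne_top_iff_integrable ?_ ?_).1 htop
    · exact hc.comp_aestronglyMeasurable
        ((intervalIntegrable_iff_integrableOn_Ioo_of_le hst.le).1 hφ).aestronglyMeasurable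
    · exact Filter.Eventually.of_forall fun x => Real.rpow_nonneg (abs_nonneg _) _
  rw [← ofReal_integral_eq_lintegral_ofReal hi
    (Filter.Eventually.of_forall fun x => Real.rpow_nonneg (abs_nonneg _) _)]
  apply ENNReal.ofReal_le_ofReal
  rw [← integral_Ioc_eq_integral_Ioo, ← intervalIntegral.integral_of_le hst.le]
  exact integral_convex_clampAt_le (convexOn_abs_rpow hp)
    (continuous_abs.rpow_const fun _ => Or.inr (by linarith)) hN hst hφ
    ((intervalIntegrable_iff_integrableOn_Ioo_of_le hst.le).2 hi)

theorem setAverage_Ioo (hst : s < t) :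
    ⨍ x in Ioo s t, φ x = (∫ x in s..t, φ x) / (t - s) := by
  rw [setAverage_eq, intervalIntegral.integral_of_le hst.le, integral_Ioc_eq_integral_Ioo,
    Measure.real, Real.volume_Ioo, ENNReal.toReal_ofReal (by linarith), smul_eq_mul,
    div_eq_inv_mul]

theorem bmoOsc_Ioo {p : ℝ} (hst : s < t) (hφ : IntervalIntegrable φ volume s t) :
    bmoOsc p φ (Ioo s t) = ((∫⁻ x in Ioo s t,
      ENNReal.ofReal (|φ x - (∫ y in s..t, φ y) / (t - s)| ^ p)) / ENNReal.ofReal (t - s)) ^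
        (1 / p) := by
  rw [bmoOsc, if_pos ((intervalIntegrable_iff_integrableOn_Ioo_of_le hst.le).1 hφ),
    setLAverage_eq, setAverage_Ioo hst, Real.volume_Ioo]

theorem ofReal_rpow_mul {B p l : ℝ} (hp : 0 < p) (hB : 0 ≤ B) (hl : 0 < l) :
    (ENNReal.ofReal (B ^ p * l) / ENNReal.ofReal l) ^ (1 / p) = ENNReal.ofReal B := by
  rw [← ENNReal.ofReal_div_of_pos hl, mul_div_cancel_right₀ _ hl.ne',
    ENNReal.ofReal_rpow_of_nonneg (Real.rpow_nonneg hB _) (by positivity), ← Real.rpow_mul hB,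
    mul_one_div_cancel hp.ne', Real.rpow_one]

theorem bmoOsc_le_ofReal {p B : ℝ} (hp : 0 < p) (hB : 0 ≤ B) (hst : s < t)
    (hφ : IntervalIntegrable φ volume s t)
    (h : ∫⁻ x in Ioo s t, ENNReal.ofReal (|φ x - (∫ y in s..t, φ y) / (t - s)| ^ p) ≤
      ENNReal.ofReal (B ^ p * (t - s))) :
    bmoOsc p φ (Ioo s t) ≤ ENNReal.ofReal B := by
  rw [bmoOsc_Ioo hst hφ, ← ofReal_rpow_mul hp hB (sub_pos.2 hst)]
  exact ENNReal.rpow_le_rpow (ENNReal.div_le_div_right h _) (by positivity)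

theorem ofReal_le_bmoOsc {p B : ℝ} (hp : 0 < p) (hB : 0 ≤ B) (hst : s < t)
    (hφ : IntervalIntegrable φ volume s t)
    (h : ENNReal.ofReal (B ^ p * (t - s)) ≤
      ∫⁻ x in Ioo s t, ENNReal.ofReal (|φ x - (∫ y in s..t, φ y) / (t - s)| ^ p)) :
    ENNReal.ofReal B ≤ bmoOsc p φ (Ioo s t) := by
  rw [bmoOsc_Ioo hst hφ, ← ofReal_rpow_mul hp hB (sub_pos.2 hst)]
  exact ENNReal.rpow_le_rpow (ENNReal.div_le_div_right h _) (by positivity)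

/-- The real number `⟨e^φ⟩ e^{-⟨φ⟩}` of the interval `(s, t)`. -/
noncomputable def expRatio (φ : ℝ → ℝ) (s t : ℝ) : ℝ :=
  (∫ x in s..t, Real.exp (φ x)) / (t - s) * Real.exp (-((∫ x in s..t, φ x) / (t - s)))

theorem aInftyRatio_eq (hst : s < t) (hφ : IntervalIntegrable φ volume s t)
    (hφe : IntervalIntegrable (fun x => Real.exp (φ x)) volume s t) :
    aInftyRatio (fun x => Real.exp (φ x)) (Ioo s t) = ENNReal.ofReal (expRatio φ s t) := by
  have hts := sub_pos.2 hst
  have hlog : (fun x => Real.log (Real.exp (φ x))) = φ := funext fun x => Real.log_exp _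
  rw [aInftyRatio, hlog, if_pos ((intervalIntegrable_iff_integrableOn_Ioo_of_le hst.le).1 hφ),
    setLAverage_eq,
    setAverage_Ioo hst, Real.volume_Ioo, ← ofReal_integral_eq_lintegral_ofReal
      ((intervalIntegrable_iff_integrableOn_Ioo_of_le hst.le).1 hφe)
      (Filter.Eventually.of_forall fun x => (Real.exp_pos _).le),
    ← integral_Ioc_eq_integral_Ioo, ← intervalIntegral.integral_of_le hst.le,
    ← ENNReal.ofReal_div_of_pos hts, ← ENNReal.ofReal_mul, expRatio]
  exact div_nonneg (intervalIntegral.integral_nonneg hst.le fun x _ => (Real.exp_pos _).le) hts.le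

theorem integrable_of_aInftyRatio_ne_top (hst : s < t)
    (h : aInftyRatio (fun x => Real.exp (φ x)) (Ioo s t) ≠ ⊤) :
    IntervalIntegrable φ volume s t ∧ IntervalIntegrable (fun x => Real.exp (φ x)) volume s t := by
  have hlog : (fun x => Real.log (Real.exp (φ x))) = φ := funext fun x => Real.log_exp _
  rw [aInftyRatio, hlog] at h
  have hφ : IntegrableOn φ (Ioo s t) := by
    by_contra hc
    rw [if_neg hc] at h
    exact h rfl
  rw [if_pos hφ, setLAverage_eq, Real.volume_Ioo] at h
  refine ⟨(intervalIntegrable_iff_integrableOn_Ioo_of_le hst.le).2 hφ,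
    (intervalIntegrable_iff_integrableOn_Ioo_of_le hst.le).2 ?_⟩
  refine (lintegral_ofReal_ne_top_iff_integrable
    (Real.continuous_exp.comp_aestronglyMeasurable hφ.aestronglyMeasurable)
    (Filter.Eventually.of_forall fun x => (Real.exp_pos _).le)).1 fun htop => ?_
  rw [htop, ENNReal.top_div_of_ne_top ENNReal.ofReal_ne_top, ENNReal.top_mul] at h
  · exact h rfl
  · simpa using Real.exp_pos _

theorem one_le_expRatio (hst : s < t) (hφ : IntervalIntegrable φ volume s t)
    (hφe : IntervalIntegrable (fun x => Real.exp (φ x)) volume s t) : 1 ≤ expRatio φ s t := by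
  have hts := sub_pos.2 hst
  have h0 := integral_sub_average hst hφ
  rw [expRatio]
  set m := (∫ x in s..t, φ x) / (t - s)
  have h1 : ∫ x in s..t, (Real.exp m * (φ x - m) + Real.exp m) ≤ ∫ x in s..t, Real.exp (φ x) := by
    apply intervalIntegral.integral_mono_on hst.le
      (((hφ.sub intervalIntegrable_const).const_mul _).add intervalIntegrable_const) hφe
    intro x _
    have h2 := mul_le_mul_of_nonneg_left (Real.add_one_le_exp (φ x - m)) (Real.exp_pos m).le
    rw [← Real.exp_add, add_sub_cancel] at h2
    linarith
  rw [intervalIntegral.integral_add ((hφ.sub intervalIntegrable_const).const_mul _)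
    intervalIntegrable_const, intervalIntegral.integral_const_mul, h0,
    intervalIntegral.integral_const, smul_eq_mul, mul_zero, zero_add] at h1
  have h3 : Real.exp m ≤ (∫ x in s..t, Real.exp (φ x)) / (t - s) := by
    rw [le_div_iff₀ hts]; linarith
  calc (1 : ℝ) = Real.exp m * Real.exp (-m) := by rw [← Real.exp_add]; simp
    _ ≤ _ := mul_le_mul_of_nonneg_right h3 (Real.exp_pos _).le

theorem expRatio_le_iff {C : ℝ} (hst : s < t) :
    expRatio φ s t ≤ C ↔ ∫ x in s..t, Real.exp (φ x) ≤
      C * (t - s) * Real.exp ((∫ x in s..t, φ x) / (t - s)) := by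
  have hts := sub_pos.2 hst
  rw [expRatio, Real.exp_neg, ← div_eq_mul_inv, div_le_iff₀ (Real.exp_pos _), div_le_iff₀ hts]
  constructor <;> intro h <;> linarith

theorem expRatio_eq_integral (φ : ℝ → ℝ) (s t : ℝ) :
    expRatio φ s t = (∫ x in s..t, Real.exp (φ x - (∫ y in s..t, φ y) / (t - s))) / (t - s) := by
  simp_rw [Real.exp_sub, div_eq_mul_inv (Real.exp _) (Real.exp _), ← Real.exp_neg]
  rw [intervalIntegral.integral_mul_const, expRatio]
  ring

end interval

/-- The ratio `⟨e^φ⟩ e^{-⟨φ⟩}` is the centered moment of `φ` for the convex function `exp`, hence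
does not grow under truncation. -/
theorem ReverseJensen.clampAt {φ : ℝ → ℝ} {a b C N : ℝ} (hN : 0 ≤ N) (h : ReverseJensen φ a b C)
    (hφ : IntervalIntegrable φ volume a b)
    (hφe : IntervalIntegrable (fun x => Real.exp (φ x)) volume a b) :
    ReverseJensen (fun x => clampAt N (φ x)) a b C := by
  intro s t hs hst ht
  have h1 := hφ.mono_Icc hs hst.le ht
  have h2 := hφe.mono_Icc hs hst.le ht
  have h3 := (expRatio_le_iff hst).2 (h s t hs hst ht)
  rw [← expRatio_le_iff hst]
  refine le_trans ?_ h3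
  rw [expRatio_eq_integral, expRatio_eq_integral]
  apply div_le_div_of_nonneg_right _ (sub_pos.2 hst).le
  refine integral_convex_clampAt_le convexOn_exp Real.continuous_exp hN hst h1 ?_
  simp_rw [Real.exp_sub]
  exact h2.div_const _

theorem ReverseJensen.sub_const {φ : ℝ → ℝ} {a b C : ℝ} (h : ReverseJensen φ a b C)
    (hφ : IntervalIntegrable φ volume a b) (c : ℝ) :
    ReverseJensen (fun x => φ x - c) a b C := by
  intro s t hs hst ht
  have hts := sub_pos.2 hst
  have h1 := h s t hs hst ht
  rw [intervalIntegral.integral_sub (hφ.mono_Icc hs hst.le ht) intervalIntegrable_const,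
    intervalIntegral.integral_const, smul_eq_mul, sub_div, mul_div_cancel_left₀ _ hts.ne',
    Real.exp_sub]
  simp_rw [Real.exp_sub]
  rw [intervalIntegral.integral_div, mul_div_assoc']
  exact div_le_div_of_nonneg_right h1 (Real.exp_pos _).le

theorem aInftyRatio_le_aInftyChar {w : ℝ → ℝ} {a b s t : ℝ} (hs : a ≤ s) (hst : s < t)
    (ht : t ≤ b) : aInftyRatio w (Ioo s t) ≤ aInftyChar w (Ioo a b) :=
  le_iSup_of_le s (le_iSup_of_le t (le_iSup_of_le hst
    (le_iSup_of_le (Ioo_subset_Ioo hs ht) le_rfl)))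

theorem bmoOsc_le_bmoNorm {p : ℝ} {φ : ℝ → ℝ} {a b s t : ℝ} (hs : a ≤ s) (hst : s < t)
    (ht : t ≤ b) : bmoOsc p φ (Ioo s t) ≤ bmoNorm p φ (Ioo a b) :=
  le_iSup_of_le s (le_iSup_of_le t (le_iSup_of_le hst
    (le_iSup_of_le (Ioo_subset_Ioo hs ht) le_rfl)))

theorem aInftyChar_le {w : ℝ → ℝ} {a b : ℝ} {B : ℝ≥0∞}
    (h : ∀ s t, a ≤ s → s < t → t ≤ b → aInftyRatio w (Ioo s t) ≤ B) :
    aInftyChar w (Ioo a b) ≤ B := by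
  refine iSup_le fun s => iSup_le fun t => iSup_le fun hst => iSup_le fun hsub => ?_
  obtain ⟨h1, h2⟩ := (Ioo_subset_Ioo_iff hst).1 hsub
  exact h s t h1 hst h2

theorem bmoNorm_le {p : ℝ} {φ : ℝ → ℝ} {a b : ℝ} {B : ℝ≥0∞}
    (h : ∀ s t, a ≤ s → s < t → t ≤ b → bmoOsc p φ (Ioo s t) ≤ B) :
    bmoNorm p φ (Ioo a b) ≤ B := by
  refine iSup_le fun s => iSup_le fun t => iSup_le fun hst => iSup_le fun hsub => ?_
  obtain ⟨h1, h2⟩ := (Ioo_subset_Ioo_iff hst).1 hsub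
  exact h s t h1 hst h2

/-! ### From bounded functions to `A_∞` weights -/

/-- `e^φ` has the exact characteristic `C` on `(a, b)`, in terms of real integrals. -/
structure ExactChar (φ : ℝ → ℝ) (a b C : ℝ) : Prop where
  integrable : IntervalIntegrable φ volume a b
  integrable_exp : IntervalIntegrable (fun x => Real.exp (φ x)) volume a b
  reverseJensen : ReverseJensen φ a b C
  one_le : 1 ≤ C
  exists_lt : ∀ X₀ < C, ∃ s t, a ≤ s ∧ s < t ∧ t ≤ b ∧ X₀ < expRatio φ s t

theorem exactChar_of_aInftyChar_eq {φ : ℝ → ℝ} {a b C : ℝ} (hab : a < b)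
    (h : aInftyChar (fun x => Real.exp (φ x)) (Ioo a b) = ENNReal.ofReal C) :
    ExactChar φ a b C := by
  obtain ⟨h1, h2⟩ := integrable_of_aInftyRatio_ne_top hab
    (ne_top_of_le_ne_top (h ▸ ENNReal.ofReal_ne_top : aInftyChar _ _ ≠ ⊤)
      (aInftyRatio_le_aInftyChar le_rfl hab le_rfl))
  have heq : ∀ s t, a ≤ s → s < t → t ≤ b → aInftyRatio (fun x => Real.exp (φ x)) (Ioo s t) =
      ENNReal.ofReal (expRatio φ s t) := fun s t hs hst ht =>
    aInftyRatio_eq hst (h1.mono_Icc hs hst.le ht) (h2.mono_Icc hs hst.le ht)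
  have hle : ∀ s t, a ≤ s → s < t → t ≤ b → 1 ≤ expRatio φ s t ∧ expRatio φ s t ≤ C := by
    intro s t hs hst ht
    have h3 := one_le_expRatio hst (h1.mono_Icc hs hst.le ht) (h2.mono_Icc hs hst.le ht)
    refine ⟨h3, ?_⟩
    have h4 := aInftyRatio_le_aInftyChar (w := fun x => Real.exp (φ x)) hs hst ht
    rw [h, heq s t hs hst ht, ENNReal.ofReal_le_ofReal_iff'] at h4
    rcases h4 with h4 | h4
    · exact h4
    · linarith
  have hC : 1 ≤ C := (hle a b le_rfl hab le_rfl).1.trans (hle a b le_rfl hab le_rfl).2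
  refine ⟨h1, h2, fun s t hs hst ht => (expRatio_le_iff hst).1 (hle s t hs hst ht).2, hC, ?_⟩
  intro X₀ hX₀
  by_contra! hc
  have h5 : aInftyChar (fun x => Real.exp (φ x)) (Ioo a b) ≤ ENNReal.ofReal (max X₀ 0) := by
    apply aInftyChar_le
    intro s t hs hst ht
    rw [heq s t hs hst ht]
    exact ENNReal.ofReal_le_ofReal ((hc s t hs hst ht).trans (le_max_left _ _))
  rw [h, ENNReal.ofReal_le_ofReal_iff (le_max_right _ _)] at h5
  have := max_lt hX₀ (by linarith : 0 < C)
  linarith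

section truncation

variable {φ : ℝ → ℝ} {a b C s t : ℝ}

/-- The truncation of `φ` at level `N`, centered on `(s, t)`. -/
noncomputable def centeredClamp (φ : ℝ → ℝ) (s t N x : ℝ) : ℝ :=
  clampAt N (φ x) - (∫ y in s..t, clampAt N (φ y)) / (t - s)

theorem intervalIntegrable_comp_centeredClamp (hab : a ≤ b) (hφ : IntervalIntegrable φ volume a b)
    {N : ℝ} (hN : 0 ≤ N) {g : ℝ → ℝ} (hg : Continuous g) :
    IntervalIntegrable (fun x => g (centeredClamp φ s t N x)) volume a b :=
  hφ.comp_clampAt hN hab (g := fun v => g (v - (∫ y in s..t, clampAt N (φ y)) / (t - s)))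
    (by fun_prop)

theorem abs_centeredClamp_le {N : ℝ} (hN : 0 ≤ N) (x : ℝ) :
    |centeredClamp φ s t N x| ≤ N + |(∫ y in s..t, clampAt N (φ y)) / (t - s)| :=
  (abs_sub _ _).trans (add_le_add (abs_clampAt_le hN _) le_rfl)

theorem ExactChar.reverseJensen_centeredClamp (H : ExactChar φ a b C) (hab : a ≤ b) {N : ℝ}
    (hN : 0 ≤ N) : ReverseJensen (centeredClamp φ s t N) a b C :=
  (H.reverseJensen.clampAt hN H.integrable H.integrable_exp).sub_const
    (H.integrable.comp_clampAt hN hab continuous_id) _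

theorem integral_centeredClamp (hst : s < t) (hφ : IntervalIntegrable φ volume s t) {N : ℝ}
    (hN : 0 ≤ N) : ∫ x in s..t, centeredClamp φ s t N x = 0 :=
  integral_sub_average hst (hφ.comp_clampAt hN hst.le continuous_id)

theorem tendsto_expRatio_clampAt (hst : s < t) (hφ : IntervalIntegrable φ volume s t)
    (hφe : IntervalIntegrable (fun x => Real.exp (φ x)) volume s t) :
    Filter.Tendsto (fun n : ℕ => expRatio (fun x => clampAt n (φ x)) s t) Filter.atTop
      (nhds (expRatio φ s t)) :=
  ((tendsto_integral_exp_clampAt hst hφ hφe).div_const _).mul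
    ((Real.continuous_exp.tendsto _).comp (tendsto_integral_clampAt hst hφ).neg)

/-- Transfer of a lower bound for the `p`-th moments of bounded functions to the `BMO^p` norm. -/
theorem ExactChar.ofReal_le_bmoNorm (H : ExactChar φ a b C) {p : ℝ} (hp : 1 ≤ p) (hab : a < b)
    {F : ℝ → ℝ} (hF : Continuous F)
    (hcore : ∀ (ψ : ℝ → ℝ) (N : ℝ) (s t : ℝ),
      (∀ g : ℝ → ℝ, Continuous g → IntervalIntegrable (fun x => g (ψ x)) volume a b) →
      (∀ x, |ψ x| ≤ N) → ReverseJensen ψ a b C → a ≤ s → s < t → t ≤ b →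
      ∫ x in s..t, ψ x = 0 →
      (t - s) * F ((∫ x in s..t, Real.exp (ψ x)) / (t - s)) ≤ ∫ x in s..t, |ψ x| ^ p) :
    ENNReal.ofReal ((max (F C) 0) ^ (1 / p)) ≤ bmoNorm p φ (Ioo a b) := by
  have hp0 : 0 < p := by linarith
  have hJ : ∀ s t, a ≤ s → s < t → t ≤ b →
      ENNReal.ofReal ((max (F (expRatio φ s t)) 0) ^ (1 / p)) ≤ bmoNorm p φ (Ioo a b) := by
    intro s t hs hst ht
    have hts := sub_pos.2 hst
    have hφ := H.integrable.mono_Icc hs hst.le ht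
    have hφe := H.integrable_exp.mono_Icc hs hst.le ht
    refine (ofReal_le_bmoOsc hp0 (Real.rpow_nonneg (le_max_right _ _) _) hst hφ ?_).trans
      (bmoOsc_le_bmoNorm hs hst ht)
    rw [← Real.rpow_mul (le_max_right _ _), one_div_mul_cancel hp0.ne', Real.rpow_one]
    have h1 : ∀ n : ℕ, ENNReal.ofReal
        ((t - s) * F (expRatio (fun x => clampAt n (φ x)) s t)) ≤
        ∫⁻ x in Ioo s t, ENNReal.ofReal (|φ x - (∫ y in s..t, φ y) / (t - s)| ^ p) := by
      intro n
      refine le_trans (ENNReal.ofReal_le_ofReal ?_)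
        (ofReal_integral_clampAt_le hp (n.cast_nonneg) hst hφ)
      rw [expRatio_eq_integral]
      exact hcore (centeredClamp φ s t n) _ s t
        (fun g hg => intervalIntegrable_comp_centeredClamp hab.le H.integrable n.cast_nonneg hg)
        (abs_centeredClamp_le n.cast_nonneg)
        (H.reverseJensen_centeredClamp hab.le n.cast_nonneg) hs hst ht
        (integral_centeredClamp hst hφ n.cast_nonneg)
    have h2 : ENNReal.ofReal ((t - s) * F (expRatio φ s t)) ≤
        ∫⁻ x in Ioo s t, ENNReal.ofReal (|φ x - (∫ y in s..t, φ y) / (t - s)| ^ p) := by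
      refine le_of_tendsto ((ENNReal.continuous_ofReal.tendsto _).comp
        (((hF.tendsto _).comp (tendsto_expRatio_clampAt hst hφ hφe)).const_mul (t - s)))
        (Filter.Eventually.of_forall h1)
    rcases le_total (F (expRatio φ s t)) 0 with h | h
    · rw [max_eq_right h]; simp
    · rw [max_eq_left h, mul_comm]; exact h2
  have hG : Continuous fun X => ENNReal.ofReal ((max (F X) 0) ^ (1 / p)) :=
    ENNReal.continuous_ofReal.comp
      ((hF.max continuous_const).rpow_const fun _ => Or.inr (by positivity))
  -- The characteristic need not be attained on any interval, but ratios approach it from below, and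
  -- `F` is continuous.
  refine le_of_forall_lt fun y hy => ?_
  have h1 := (hG.tendsto C).eventually (lt_mem_nhds hy)
  obtain ⟨l, hl, hl'⟩ := exists_Ioc_subset_of_mem_nhds h1 ⟨C - 1, by linarith⟩
  obtain ⟨s, t, hs, hst, ht, hX⟩ := H.exists_lt l hl
  have h2 : expRatio φ s t ≤ C := (expRatio_le_iff hst).2 (H.reverseJensen s t hs hst ht)
  exact lt_of_lt_of_le (hl' ⟨hX, h2⟩) (hJ s t hs hst ht)

end truncation

section estimates

variable {φ : ℝ → ℝ} {a b C : ℝ}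

theorem xiPlus_mul {C : ℝ} (hC : 1 ≤ C) : C * ((1 - xiPlus C) * Real.exp (xiPlus C)) = 1 :=
  (exp_neg_eq_iff _ _).1 (xiPlus_spec hC).2

theorem xiMinus_mul {C : ℝ} (hC : 1 ≤ C) : C * ((1 - xiMinus C) * Real.exp (xiMinus C)) = 1 :=
  (exp_neg_eq_iff _ _).1 (xiMinus_spec hC).2

theorem xiPlus_pos {C : ℝ} (hC : 1 < C) : 0 < xiPlus C := by
  refine lt_of_le_of_ne (xiPlus_spec hC.le).1.1 fun h => ?_
  have := xiPlus_mul hC.le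
  rw [← h] at this
  simp at this
  linarith

theorem xiMinus_neg {C : ℝ} (hC : 1 < C) : xiMinus C < 0 := by
  refine lt_of_le_of_ne (xiMinus_spec hC.le).1 fun h => ?_
  have := xiMinus_mul hC.le
  rw [h] at this
  simp at this
  linarith

theorem one_lt_threshold {p : ℝ} (hp1 : 1 < p) (hp2 : p < 2) :
    1 < Real.exp (p - 2) / (p - 1) := by
  rw [one_lt_div (by linarith)]
  have := Real.add_one_lt_exp (x := p - 2) (by linarith)
  linarith

/-- The threshold is the value of `C` for which `ξ⁺ = 2 - p`, and `(1 - ξ) e^ξ = 1 / C` makes `ξ⁺`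
increase with `C`. -/
theorem two_sub_le_xiPlus {p : ℝ} (hp1 : 1 < p) (hp2 : p ≤ 2) (hC1 : 1 ≤ C)
    (hC : Real.exp (p - 2) / (p - 1) ≤ C) : 2 - p ≤ xiPlus C := by
  by_contra! h
  have h1 := strictAntiOn_one_sub_mul_exp (mem_Ici.2 (xiPlus_spec hC1).1.1)
    (mem_Ici.2 (by linarith : 0 ≤ 2 - p)) h
  have h2 := xiPlus_mul hC1
  simp only at h1
  rw [div_le_iff₀ (by linarith)] at hC
  have h3 : Real.exp (p - 2) * Real.exp (2 - p) = 1 := by rw [← Real.exp_add]; simp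
  have h4 := mul_le_mul_of_nonneg_right hC (Real.exp_pos (2 - p)).le
  have h5 : C * ((1 - (2 - p)) * Real.exp (2 - p)) < 1 := by
    have h6 := mul_lt_mul_of_pos_left h1 (by linarith : 0 < C)
    linarith
  have h6 : C * ((1 - (2 - p)) * Real.exp (2 - p)) = C * (p - 1) * Real.exp (2 - p) := by ring
  linarith

theorem expMoment_neg_one_pos {p : ℝ} (hp : 0 < p) : 0 < expMoment p (-1) := by
  rw [expMoment_neg]
  apply mul_pos (Real.exp_pos _)
  have h1 := Real.Gamma_pos_of_pos (by linarith : 0 < p + 1)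
  have h2 : 0 ≤ ∫ y in (0 : ℝ)..1, Real.exp y * |y| ^ p :=
    intervalIntegral.integral_nonneg zero_le_one fun y _ => by positivity
  linarith

theorem ExactChar.bmoNorm_two_le (H : ExactChar φ a b C) (hab : a < b) :
    bmoNorm 2 φ (Ioo a b) ≤ ENNReal.ofReal |xiMinus C| := by
  have hβ : |xiMinus C| = -xiMinus C := abs_of_nonpos (xiMinus_spec H.one_le).1
  apply bmoNorm_le
  intro s t hs hst ht
  have hφ := H.integrable.mono_Icc hs hst.le ht
  refine bmoOsc_le_ofReal two_pos (abs_nonneg _) hst hφ ?_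
  refine lintegral_le_of_clampAt (Φ := fun x => |x| ^ (2 : ℝ))
    (continuous_abs.rpow_const fun _ => Or.inr two_pos.le)
    (fun x => Real.rpow_nonneg (abs_nonneg _) _) hst hφ fun n => ?_
  have h1 := integral_sq_le_of_reverseJensen_eq (abs_nonneg (xiMinus C))
    (fun g hg => intervalIntegrable_comp_centeredClamp (s := s) (t := t) hab.le H.integrable
      n.cast_nonneg hg)
    (abs_centeredClamp_le n.cast_nonneg) (H.reverseJensen_centeredClamp hab.le n.cast_nonneg)
    (by rw [hβ, neg_neg, ← sub_eq_add_neg]; exact xiMinus_mul H.one_le) hs hst ht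
    (integral_centeredClamp hst hφ n.cast_nonneg)
  simp only [Real.rpow_two, sq_abs] at h1 ⊢
  exact h1

theorem ExactChar.le_bmoNorm (H : ExactChar φ a b C) (hab : a < b) {p : ℝ} (hp1 : 1 < p)
    (hp2 : p ≤ 2) (hξ0 : 0 < xiPlus C) (hξp : 2 - p ≤ xiPlus C) :
    ENNReal.ofReal (expMoment p (-1) ^ (1 / p)) * ENNReal.ofReal (xiPlus C) ≤
      bmoNorm p φ (Ioo a b) := by
  have hξ1 := (xiPlus_spec H.one_le).1.2
  have hmul := xiPlus_mul H.one_le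
  set ξ := xiPlus C
  have hM := expMoment_neg_one_pos (p := p) (by linarith)
  have h1 := H.ofReal_le_bmoNorm hp1.le hab (F := fun X => ξ ^ p * (1 - p + (1 - ξ) / ξ ^ 2 *
    expMomentSecond p (-1) * (Real.exp ξ * X - 1 - ξ))) (by fun_prop)
    (fun ψ N s t hint hN hJ hs hst ht h0 =>
      integral_abs_rpow_ge_of_reverseJensen hp1 hp2 hξ0 hξ1 hξp hint hN hJ hmul hs hst ht h0)
  have h2 : ξ ^ p * (1 - p + (1 - ξ) / ξ ^ 2 * expMomentSecond p (-1) *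
      (Real.exp ξ * C - 1 - ξ)) = ξ ^ p * expMoment p (-1) := by
    have e1 : Real.exp ξ * C = 1 / (1 - ξ) := by
      rw [eq_div_iff (by linarith)]; linarith
    have h1ξ : 1 - ξ ≠ 0 := by linarith
    rw [e1, expMomentSecond, abs_neg, abs_one, Real.one_rpow, Real.one_rpow]
    field_simp
    ring
  rw [h2, max_eq_left (mul_nonneg (Real.rpow_nonneg hξ0.le _) hM.le),
    Real.mul_rpow (Real.rpow_nonneg hξ0.le _) hM.le, ← Real.rpow_mul hξ0.le,
    mul_one_div_cancel (by linarith), Real.rpow_one, mul_comm,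
    ENNReal.ofReal_mul (Real.rpow_nonneg hM.le _)] at h1
  exact h1

theorem ExactChar.kFun_le_bmoNorm (H : ExactChar φ a b C) (hab : a < b) :
    ENNReal.ofReal (kFun C) ≤ bmoNorm 1 φ (Ioo a b) := by
  rcases eq_or_lt_of_le H.one_le with h | hC
  · rw [kFun, if_pos h.symm]; simp
  have HT : TangentPair C (xiPlus C) (xiMinus C) := ⟨xiPlus_pos hC, (xiPlus_spec hC.le).1.2,
    xiMinus_neg hC, xiPlus_mul hC.le, xiMinus_mul hC.le⟩
  have h1 := H.ofReal_le_bmoNorm le_rfl hab (F := fun X => 2 / (1 / (1 - xiPlus C) -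
    1 / (1 - xiMinus C)) * (X - 1)) (by fun_prop)
    (fun ψ N s t hint hN hJ hs hst ht h0 => by
      have h2 := integral_abs_ge_of_reverseJensen HT hint hN hJ hs hst ht h0
      simp only [Real.rpow_one]
      refine le_trans (le_of_eq ?_) h2
      have : t - s ≠ 0 := (sub_pos.2 hst).ne'
      field_simp)
  simp only [div_one, Real.rpow_one] at h1
  refine le_trans (ENNReal.ofReal_le_ofReal ?_) h1
  rw [kFun, if_neg hC.ne']
  refine le_trans (le_of_eq ?_) (le_max_left _ _)
  have e1 : 1 - xiPlus C ≠ 0 := by linarith [HT.x_lt_one]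
  have e2 : 1 - xiMinus C ≠ 0 := by linarith [HT.y_neg]
  have e3 : xiPlus C - xiMinus C ≠ 0 := by linarith [HT.x_pos, HT.y_neg]
  have e4 : 1 / (1 - xiPlus C) - 1 / (1 - xiMinus C) =
      (xiPlus C - xiMinus C) / ((1 - xiPlus C) * (1 - xiMinus C)) := by
    field_simp; ring
  rw [e4]
  field_simp

end estimates

theorem intervalIntegral.integral_congr_uIoc {f g : ℝ → ℝ} {a b : ℝ}
    (h : ∀ x ∈ uIoc a b, f x = g x) : ∫ x in a..b, f x = ∫ x in a..b, g x :=
  intervalIntegral.integral_congr_ae (Filter.Eventually.of_forall h)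

/-! ### Oscillations of the logarithm -/

section logarithm

theorem intervalIntegrable_neg_log : IntervalIntegrable (fun u => -Real.log u) volume 0 1 :=
  intervalIntegral.intervalIntegrable_log'.neg

theorem integral_neg_log : ∫ u in (0 : ℝ)..1, -Real.log u = 1 := by
  rw [intervalIntegral.integral_neg, integral_log]
  simp

theorem intervalIntegrable_neg_log_sub (m : ℝ) :
    IntervalIntegrable (fun u => -Real.log u - m) volume 0 1 :=
  intervalIntegrable_neg_log.sub intervalIntegrable_const

theorem exp_mul_neg_log_sub {α u : ℝ} (hu : 0 < u) :
    Real.exp (α * (-Real.log u - 1)) = Real.exp (-α) * u ^ (-α) := by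
  rw [Real.rpow_def_of_pos hu, ← Real.exp_add]
  ring_nf

theorem exp_mul_neg_log {α : ℝ} (hα : α < 1) :
    IntervalIntegrable (fun u => Real.exp (α * (-Real.log u - 1))) volume 0 1 ∧
      ∫ u in (0 : ℝ)..1, Real.exp (α * (-Real.log u - 1)) = Real.exp (-α) / (1 - α) := by
  have e : ∀ u ∈ uIoc (0 : ℝ) 1, Real.exp (-α) * u ^ (-α) =
      Real.exp (α * (-Real.log u - 1)) := by
    intro u hu
    rw [uIoc_of_le zero_le_one] at hu
    exact (exp_mul_neg_log_sub hu.1).symm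
  refine ⟨((intervalIntegral.intervalIntegrable_rpow' (by linarith)).const_mul _).congr e, ?_⟩
  rw [← intervalIntegral.integral_congr_uIoc e, intervalIntegral.integral_const_mul,
    integral_rpow (Or.inl (by linarith)), Real.one_rpow, Real.zero_rpow (by linarith),
    neg_add_eq_sub, sub_zero, mul_one_div]

theorem image_exp_neg_Ioi : (fun y : ℝ => Real.exp (-(y + 1))) '' Ioi (-1) = Ioo 0 1 := by
  ext u
  constructor
  · rintro ⟨y, hy, rfl⟩
    exact ⟨Real.exp_pos _, Real.exp_lt_one_iff.2 (by linarith [mem_Ioi.1 hy])⟩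
  · rintro ⟨h0, h1⟩
    refine ⟨-Real.log u - 1, ?_, ?_⟩
    · have := Real.log_neg h0 h1
      rw [mem_Ioi]; linarith
    · simp only [sub_add_cancel, neg_neg]
      exact Real.exp_log h0

/-- The substitution `u = e^{-(y+1)}` turns `-log u - 1` into `y` on `(-1, ∞)` with weight
`e^{-(y+1)}`. Thus the moment that governs the lower bound is that of the logarithm. -/
theorem abs_rpow_neg_log {p : ℝ} (hp : 0 < p) :
    IntervalIntegrable (fun u => |-Real.log u - 1| ^ p) volume 0 1 ∧
      ∫ u in (0 : ℝ)..1, |-Real.log u - 1| ^ p = expMoment p (-1) := by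
  have hd : ∀ y ∈ Ioi (-1 : ℝ), HasDerivWithinAt (fun y : ℝ => Real.exp (-(y + 1)))
      (-Real.exp (-(y + 1))) (Ioi (-1)) y := fun y _ => by
    have := (((hasDerivAt_id y).add_const 1).neg).exp
    exact (this.congr_deriv (by simp)).hasDerivWithinAt
  have hinj : InjOn (fun y : ℝ => Real.exp (-(y + 1))) (Ioi (-1)) := fun x _ y _ h => by
    have := Real.exp_injective h
    linarith
  have hfun : ∀ y : ℝ, |-Real.exp (-(y + 1))| • |-Real.log (Real.exp (-(y + 1))) - 1| ^ p =
      Real.exp (-1) * (Real.exp (-y) * |y| ^ p) := fun y => by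
    rw [abs_neg, abs_of_pos (Real.exp_pos _), Real.log_exp, neg_neg, add_sub_cancel_right,
      smul_eq_mul, neg_add, add_comm, Real.exp_add]
    ring
  have e : ∀ x ∈ Ioi (0 : ℝ), Real.exp (-x) * x ^ p = Real.exp (-x) * |x| ^ p := fun x hx => by
    rw [abs_of_pos hx]
  have hG := Real.Gamma_eq_integral (s := p + 1) (by linarith)
  have hc := Real.GammaIntegral_convergent (s := p + 1) (by linarith)
  rw [add_sub_cancel_right] at hG hc
  rw [setIntegral_congr_fun measurableSet_Ioi e] at hG
  replace hc : IntegrableOn (fun x => Real.exp (-x) * |x| ^ p) (Ioi 0) :=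
    hc.congr_fun e measurableSet_Ioi
  have hi : IntervalIntegrable (fun x => Real.exp (-x) * |x| ^ p) volume (-1) 0 :=
    (continuous_exp_mul_abs_rpow hp).intervalIntegrable _ _
  have hc' : IntegrableOn (fun x => Real.exp (-x) * |x| ^ p) (Ioi (-1)) := by
    rw [← Ioc_union_Ioi_eq_Ioi (by norm_num : (-1 : ℝ) ≤ 0)]
    exact ((intervalIntegrable_iff_integrableOn_Ioc_of_le (by norm_num)).1 hi).union hc
  constructor
  · rw [intervalIntegrable_iff_integrableOn_Ioo_of_le zero_le_one, ← image_exp_neg_Ioi,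
      integrableOn_image_iff_integrableOn_abs_deriv_smul measurableSet_Ioi hd hinj]
    simp_rw [hfun]
    exact hc'.const_mul _
  · rw [intervalIntegral.integral_of_le zero_le_one, integral_Ioc_eq_integral_Ioo,
      ← image_exp_neg_Ioi, integral_image_eq_integral_abs_deriv_smul measurableSet_Ioi hd hinj]
    simp_rw [hfun]
    rw [integral_const_mul, ← intervalIntegral.integral_interval_add_Ioi' hi hc, ← hG, expMoment,
      intervalIntegral.integral_symm]
    ring

theorem expMoment_two_neg_one : expMoment 2 (-1) = 1 := by
  have h1 := (abs_rpow_neg_log two_pos).2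
  have h2 : ∀ y : ℝ, HasDerivAt (fun y => (y ^ 2 - 2 * y + 2) * Real.exp y)
      (Real.exp y * |y| ^ (2 : ℝ)) y := fun y => by
    refine ((((hasDerivAt_pow 2 y).sub ((hasDerivAt_id y).const_mul 2)).add_const 2).mul
      (Real.hasDerivAt_exp y)).congr_deriv ?_
    rw [Real.rpow_two, sq_abs]
    simp only [Pi.sub_apply, id]
    push_cast
    ring
  have hcont : Continuous fun y : ℝ => Real.exp y * |y| ^ (2 : ℝ) :=
    Real.continuous_exp.mul (continuous_abs.rpow_const fun _ => Or.inr two_pos.le)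
  rw [expMoment_neg, intervalIntegral.integral_eq_sub_of_hasDerivAt (fun y _ => h2 y)
    (hcont.intervalIntegrable _ _)]
  have h3 : Real.Gamma (2 + 1) = 2 := by
    rw [Real.Gamma_add_one two_ne_zero, Real.Gamma_two, mul_one]
  rw [h3, Real.exp_zero, Real.exp_neg]
  have := Real.exp_pos 1
  field_simp
  ring

/-- `-log (c + l e^{-x})` with `x` replaced by its positive part. -/
noncomputable def logShift (c l x : ℝ) : ℝ := -Real.log (c + l * Real.exp (-max x 0))

variable {c l : ℝ}

theorem logShift_arg_pos (hc : 0 < c) (hl : 0 < l) (x : ℝ) : 0 < c + l * Real.exp (-max x 0) := by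
  positivity

theorem logShift_mono (hc : 0 < c) (hl : 0 < l) : Monotone (logShift c l) := by
  intro x y h
  have : max x 0 ≤ max y 0 := max_le_max h le_rfl
  unfold logShift
  have := logShift_arg_pos hc hl y
  gcongr

/-- So `logShift` is a monotone contraction taking `-log u` to `-log (c + l u)` on `(0, 1]`, which
compares an interval away from the singularity with one starting there. The positive part keeps it
bounded on the whole line. -/
theorem sub_logShift_mono (hc : 0 < c) (hl : 0 < l) : Monotone fun x => x - logShift c l x := by
  intro x y h
  have h1 : max y 0 - max x 0 ≤ y - x := by
    rcases max_cases x 0 with h2 | h2 <;> rcases max_cases y 0 with h3 | h3 <;> linarith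
  have h2 : max x 0 ≤ max y 0 := max_le_max h le_rfl
  have h3 : c + l * Real.exp (-max x 0) ≤
      Real.exp (max y 0 - max x 0) * (c + l * Real.exp (-max y 0)) := by
    have e : Real.exp (max y 0 - max x 0) * Real.exp (-max y 0) = Real.exp (-max x 0) := by
      rw [← Real.exp_add]; ring_nf
    have h4 : 1 ≤ Real.exp (max y 0 - max x 0) := Real.one_le_exp (by linarith)
    rw [mul_add, mul_left_comm, e]
    nlinarith
  have h4 := Real.log_le_log (logShift_arg_pos hc hl x) h3
  rw [Real.log_mul (Real.exp_pos _).ne' (logShift_arg_pos hc hl y).ne', Real.log_exp] at h4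
  simp only [logShift]
  linarith

theorem abs_logShift_le (hc : 0 < c) (hl : 0 < l) (x : ℝ) :
    |logShift c l x| ≤ max |Real.log c| |Real.log (c + l)| := by
  rw [logShift, abs_neg]
  refine abs_le_max_abs_abs (Real.log_le_log hc ?_) (Real.log_le_log (logShift_arg_pos hc hl x) ?_)
  · have := Real.exp_pos (-max x 0)
    nlinarith
  · have : Real.exp (-max x 0) ≤ 1 := Real.exp_le_one_iff.2 (by simp)
    nlinarith

theorem logShift_neg_log {u : ℝ} (hu : u ∈ Ioc (0 : ℝ) 1) :
    logShift c l (-Real.log u) = -Real.log (c + l * u) := by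
  have := Real.log_nonpos hu.1.le hu.2
  rw [logShift, max_eq_left (by linarith), neg_neg, Real.exp_log hu.1]

theorem integral_log_add_mul_zero (hl : 0 < l) {u : ℝ} (hu : u ∈ uIoc (0 : ℝ) 1) :
    -Real.log (0 + l * u) - (∫ v in (0 : ℝ)..1, -Real.log (0 + l * v)) = -Real.log u - 1 := by
  have e : ∀ v ∈ uIoc (0 : ℝ) 1, -Real.log v + -Real.log l = -Real.log (0 + l * v) := by
    intro v hv
    rw [uIoc_of_le zero_le_one] at hv
    rw [zero_add, Real.log_mul hl.ne' hv.1.ne']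
    ring
  rw [← intervalIntegral.integral_congr_uIoc e, ← e u hu, intervalIntegral.integral_add
    intervalIntegrable_neg_log intervalIntegrable_const, integral_neg_log]
  simp

theorem intervalIntegrable_log_add_mul (hc : 0 ≤ c) (hl : 0 < l) :
    IntervalIntegrable (fun u => -Real.log (c + l * u)) volume 0 1 := by
  rcases hc.eq_or_lt with rfl | hc
  · have h := (intervalIntegrable_neg_log_sub 1).congr
      (fun u hu => (integral_log_add_mul_zero hl hu).symm)
    simpa using h.add (intervalIntegrable_const (c := ∫ v in (0 : ℝ)..1, -Real.log (0 + l * v)))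
  · apply ContinuousOn.intervalIntegrable
    rw [uIcc_of_le zero_le_one]
    refine (ContinuousOn.log (by fun_prop) fun u hu => ?_).neg
    have := mul_nonneg hl.le hu.1
    linarith

/-- The oscillations of `-log` over intervals away from `0` are dominated by those over intervals
starting at `0`. -/
theorem integral_convex_log_le {Φ : ℝ → ℝ} (hΦ : ConvexOn ℝ univ Φ) (hΦc : Continuous Φ)
    (hi : IntervalIntegrable (fun u => Φ (-Real.log u - 1)) volume 0 1) (hc : 0 ≤ c) (hl : 0 < l) :
    IntervalIntegrable (fun u => Φ (-Real.log (c + l * u) -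
      ∫ v in (0 : ℝ)..1, -Real.log (c + l * v))) volume 0 1 ∧
    ∫ u in (0 : ℝ)..1, Φ (-Real.log (c + l * u) - ∫ v in (0 : ℝ)..1, -Real.log (c + l * v)) ≤
      ∫ u in (0 : ℝ)..1, Φ (-Real.log u - 1) := by
  rcases hc.eq_or_lt with rfl | hc
  · have e := fun u hu => congrArg Φ (integral_log_add_mul_zero hl (u := u) hu)
    exact ⟨hi.congr fun u hu => (e u hu).symm, (intervalIntegral.integral_congr_uIoc e).le⟩
  · set m := ∫ v in (0 : ℝ)..1, -Real.log (c + l * v) with hm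
    have hI := intervalIntegrable_log_add_mul hc.le hl
    have e : ∀ u ∈ Ioc (0 : ℝ) 1, logShift c l (-Real.log u) = -Real.log (c + l * u) :=
      fun u hu => logShift_neg_log hu
    have hcont : ContinuousOn (fun u => Φ (-Real.log (c + l * u) - m)) (Icc 0 1) := by
      refine hΦc.comp_continuousOn (ContinuousOn.sub (ContinuousOn.log (by fun_prop)
        fun u hu => ?_).neg continuousOn_const)
      have := mul_nonneg hl.le hu.1
      linarith
    have hI2 : IntervalIntegrable (fun u => Φ (-Real.log (c + l * u) - m)) volume 0 1 :=
      (by rwa [uIcc_of_le zero_le_one] : ContinuousOn _ (uIcc (0 : ℝ) 1)).intervalIntegrable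
    refine ⟨hI2, ?_⟩
    have e2 : ∀ G : ℝ → ℝ, ∫ u in (0 : ℝ)..1, G (-Real.log (c + l * u)) =
        ∫ u in (0 : ℝ)..1, G (logShift c l (-Real.log u)) := fun G =>
      intervalIntegral.integral_congr_uIoc fun u hu => by
        rw [uIoc_of_le zero_le_one] at hu
        simp only [e u hu]
    have i2 : ∀ G : ℝ → ℝ, IntervalIntegrable (fun u => G (-Real.log (c + l * u))) volume 0 1 →
        IntegrableOn (fun u => G (logShift c l (-Real.log u))) (Ioc 0 1) := fun G hG =>
      ((intervalIntegrable_iff_integrableOn_Ioc_of_le zero_le_one).1 hG).congr_fun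
        (fun u hu => by simp only [e u hu]) measurableSet_Ioc
    rw [e2 fun x => Φ (x - m)]
    have hz : ∫ u in (0 : ℝ)..1, (logShift c l (-Real.log u) - m) = 0 := by
      rw [← e2 fun x => x - m, intervalIntegral.integral_sub hI intervalIntegrable_const, ← hm]
      simp
    have hz1 : ∫ u in (0 : ℝ)..1, (-Real.log u - 1) = 0 := by
      rw [intervalIntegral.integral_sub intervalIntegrable_neg_log
        intervalIntegrable_const, integral_neg_log]
      simp
    rw [intervalIntegral.integral_of_le zero_le_one] at hz hz1 ⊢
    rw [intervalIntegral.integral_of_le zero_le_one]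
    exact integral_convex_contraction_le (logShift_mono hc hl) (sub_logShift_mono hc hl)
      ((intervalIntegrable_iff_integrableOn_Ioc_of_le zero_le_one).1
        (intervalIntegrable_neg_log_sub 1))
      (i2 (fun x => x - m) (hI.sub intervalIntegrable_const)) hz1 hz
      (fun u => abs_logShift_le hc hl _) hΦ
      ((intervalIntegrable_iff_integrableOn_Ioc_of_le zero_le_one).1 hi)
      (i2 (fun x => Φ (x - m)) hI2)

end logarithm

section unitInterval

variable {g : ℝ → ℝ} {c d : ℝ}

theorem integral_eq_integral_unitInterval (g : ℝ → ℝ) (hcd : c < d) :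
    ∫ t in c..d, g t = (d - c) * ∫ u in (0 : ℝ)..1, g (c + (d - c) * u) := by
  have hdc : d - c ≠ 0 := (sub_pos.2 hcd).ne'
  rw [intervalIntegral.integral_comp_add_mul g hdc, smul_eq_mul, mul_inv_cancel_left₀ hdc,
    mul_zero, add_zero, mul_one, add_sub_cancel]

theorem intervalIntegrable_of_unitInterval (hcd : c < d)
    (h : IntervalIntegrable (fun u => g (c + (d - c) * u)) volume 0 1) :
    IntervalIntegrable g volume c d := by
  have hdc : d - c ≠ 0 := (sub_pos.2 hcd).ne'
  have h1 := (h.comp_mul_left (c := (d - c)⁻¹)).comp_sub_right c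
  convert h1 using 1
  · ext t
    rw [mul_inv_cancel_left₀ hdc, add_sub_cancel]
  · simp
  · simp

end unitInterval

/-! ### Extremal functions -/

section extremal

variable {a b c d α : ℝ}

/-- A multiple of the logarithm with its singularity at `a`. -/
noncomputable def logProfile (a α t : ℝ) : ℝ := α * -Real.log (t - a)

theorem logProfile_affine (a α c l u : ℝ) :
    logProfile a α (c + l * u) = α * -Real.log (c - a + l * u) := by
  rw [logProfile, add_sub_right_comm]

theorem intervalIntegrable_logProfile (hac : a ≤ c) (hcd : c < d) (α : ℝ) :
    IntervalIntegrable (logProfile a α) volume c d := by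
  apply intervalIntegrable_of_unitInterval hcd
  simp_rw [logProfile_affine]
  exact (intervalIntegrable_log_add_mul (sub_nonneg.2 hac) (sub_pos.2 hcd)).const_mul α

theorem average_logProfile (a α : ℝ) (hcd : c < d) :
    (∫ t in c..d, logProfile a α t) / (d - c) =
      α * ∫ u in (0 : ℝ)..1, -Real.log (c - a + (d - c) * u) := by
  rw [integral_eq_integral_unitInterval _ hcd, mul_div_cancel_left₀ _ (sub_pos.2 hcd).ne']
  simp_rw [logProfile_affine]
  rw [intervalIntegral.integral_const_mul]

theorem logProfile_sub_average (a α : ℝ) (hcd : c < d) (u : ℝ) :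
    logProfile a α (c + (d - c) * u) - (∫ t in c..d, logProfile a α t) / (d - c) =
      α * (-Real.log (c - a + (d - c) * u) -
        ∫ v in (0 : ℝ)..1, -Real.log (c - a + (d - c) * v)) := by
  rw [average_logProfile a α hcd, logProfile_affine]
  ring

theorem ConvexOn.comp_const_mul {Φ : ℝ → ℝ} (h : ConvexOn ℝ univ Φ) (α : ℝ) :
    ConvexOn ℝ univ fun x => Φ (α * x) :=
  h.comp_linearMap (LinearMap.mulLeft ℝ α)

theorem logProfile_convex_le {Φ : ℝ → ℝ} (hΦ : ConvexOn ℝ univ Φ) (hΦc : Continuous Φ)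
    (hi : IntervalIntegrable (fun u => Φ (α * (-Real.log u - 1))) volume 0 1)
    (hac : a ≤ c) (hcd : c < d) :
    IntervalIntegrable (fun t => Φ (logProfile a α t -
      (∫ s in c..d, logProfile a α s) / (d - c))) volume c d ∧
    ∫ t in c..d, Φ (logProfile a α t - (∫ s in c..d, logProfile a α s) / (d - c)) ≤
      (d - c) * ∫ u in (0 : ℝ)..1, Φ (α * (-Real.log u - 1)) := by
  have hdc := sub_pos.2 hcd
  have h := integral_convex_log_le (hΦ.comp_const_mul α) (by fun_prop) hi (sub_nonneg.2 hac) hdc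
  simp_rw [← logProfile_sub_average a α hcd] at h
  refine ⟨intervalIntegrable_of_unitInterval hcd h.1, ?_⟩
  rw [integral_eq_integral_unitInterval _ hcd]
  exact mul_le_mul_of_nonneg_left h.2 hdc.le

theorem integral_comp_logProfile (Φ : ℝ → ℝ) (hab : a < b) :
    ∫ t in a..b, Φ (logProfile a α t - (∫ s in a..b, logProfile a α s) / (b - a)) =
      (b - a) * ∫ u in (0 : ℝ)..1, Φ (α * (-Real.log u - 1)) := by
  rw [integral_eq_integral_unitInterval _ hab]
  congr 1
  refine intervalIntegral.integral_congr_uIoc fun u hu => ?_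
  rw [logProfile_sub_average a α hab, sub_self,
    integral_log_add_mul_zero (sub_pos.2 hab) hu]

theorem intervalIntegrable_exp_logProfile (hα : α < 1) (hac : a ≤ c) (hcd : c < d) :
    IntervalIntegrable (fun t => Real.exp (logProfile a α t)) volume c d := by
  have h := (logProfile_convex_le convexOn_exp Real.continuous_exp
    (exp_mul_neg_log hα).1 hac hcd).1
  have h2 := h.const_mul (Real.exp ((∫ s in c..d, logProfile a α s) / (d - c)))
  simpa only [← Real.exp_add, add_sub_cancel] using h2

theorem expRatio_logProfile_le (hα : α < 1) (hac : a ≤ c) (hcd : c < d) :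
    expRatio (logProfile a α) c d ≤ Real.exp (-α) / (1 - α) := by
  have h := (logProfile_convex_le convexOn_exp Real.continuous_exp
    (exp_mul_neg_log hα).1 hac hcd).2
  rw [(exp_mul_neg_log hα).2] at h
  rwa [expRatio_eq_integral, div_le_iff₀ (sub_pos.2 hcd), mul_comm]

theorem expRatio_logProfile (hα : α < 1) (hab : a < b) :
    expRatio (logProfile a α) a b = Real.exp (-α) / (1 - α) := by
  rw [expRatio_eq_integral, integral_comp_logProfile Real.exp hab, (exp_mul_neg_log hα).2,
    mul_div_cancel_left₀ _ (sub_pos.2 hab).ne']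

theorem aInftyChar_logProfile (hα : α < 1) (hab : a < b) :
    aInftyChar (fun t => Real.exp (logProfile a α t)) (Ioo a b) =
      ENNReal.ofReal (Real.exp (-α) / (1 - α)) := by
  apply le_antisymm
  · apply aInftyChar_le
    intro s t hs hst _
    rw [aInftyRatio_eq hst (intervalIntegrable_logProfile hs hst α)
      (intervalIntegrable_exp_logProfile hα hs hst)]
    exact ENNReal.ofReal_le_ofReal (expRatio_logProfile_le hα hs hst)
  · rw [← expRatio_logProfile hα hab, ← aInftyRatio_eq hab
      (intervalIntegrable_logProfile le_rfl hab α)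
      (intervalIntegrable_exp_logProfile hα le_rfl hab)]
    exact aInftyRatio_le_aInftyChar le_rfl hab le_rfl

theorem memAInfty_logProfile (hα : α < 1) (hab : a < b) :
    MemAInfty (fun t => Real.exp (logProfile a α t)) (Ioo a b) where
  pos := Filter.Eventually.of_forall fun _ => Real.exp_pos _
  locallyIntegrableOn := ((intervalIntegrable_iff_integrableOn_Ioo_of_le hab.le).1
    (intervalIntegrable_exp_logProfile hα le_rfl hab)).locallyIntegrableOn
  locallyIntegrableOn_log := by
    simp_rw [Real.log_exp]
    exact ((intervalIntegrable_iff_integrableOn_Ioo_of_le hab.le).1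
      (intervalIntegrable_logProfile le_rfl hab α)).locallyIntegrableOn
  char_lt_top := by
    rw [aInftyChar_logProfile hα hab]
    exact ENNReal.ofReal_lt_top

theorem abs_mul_rpow_neg_log {p : ℝ} (hp : 0 < p) (α : ℝ) :
    IntervalIntegrable (fun u => |α * (-Real.log u - 1)| ^ p) volume 0 1 ∧
      ∫ u in (0 : ℝ)..1, |α * (-Real.log u - 1)| ^ p = |α| ^ p * expMoment p (-1) := by
  simp_rw [abs_mul, Real.mul_rpow (abs_nonneg _) (abs_nonneg _)]
  rw [intervalIntegral.integral_const_mul, (abs_rpow_neg_log hp).2]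
  exact ⟨(abs_rpow_neg_log hp).1.const_mul _, rfl⟩

/-- Every oscillation is at most that of `α (-log u - 1)` on the unit interval, and the full
interval attains it because its left end is the singularity. -/
theorem bmoNorm_logProfile {p : ℝ} (hp : 1 ≤ p) (α : ℝ) (hab : a < b) :
    bmoNorm p (logProfile a α) (Ioo a b) =
      ENNReal.ofReal (expMoment p (-1) ^ (1 / p)) * ENNReal.ofReal |α| := by
  have hp0 : 0 < p := by linarith
  have hM := (expMoment_neg_one_pos hp0).le
  have hMp := Real.rpow_nonneg hM (1 / p)
  have hB : 0 ≤ expMoment p (-1) ^ (1 / p) * |α| := mul_nonneg hMp (abs_nonneg _)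
  have hBp : (expMoment p (-1) ^ (1 / p) * |α|) ^ p = |α| ^ p * expMoment p (-1) := by
    rw [Real.mul_rpow hMp (abs_nonneg _), ← Real.rpow_mul hM, one_div_mul_cancel hp0.ne',
      Real.rpow_one, mul_comm]
  have hcont : Continuous fun x : ℝ => |x| ^ p :=
    continuous_abs.rpow_const fun _ => Or.inr hp0.le
  have hlint : ∀ s t, a ≤ s → s < t → ∫⁻ x in Ioo s t, ENNReal.ofReal
      (|logProfile a α x - (∫ y in s..t, logProfile a α y) / (t - s)| ^ p) =
      ENNReal.ofReal (∫ x in s..t,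
        |logProfile a α x - (∫ y in s..t, logProfile a α y) / (t - s)| ^ p) := by
    intro s t hs hst
    have h := (logProfile_convex_le (convexOn_abs_rpow hp) hcont
      (abs_mul_rpow_neg_log hp0 α).1 hs hst).1
    generalize (∫ y in s..t, logProfile a α y) / (t - s) = m at h ⊢
    rw [intervalIntegral.integral_of_le hst.le, integral_Ioc_eq_integral_Ioo,
      ofReal_integral_eq_lintegral_ofReal
        ((intervalIntegrable_iff_integrableOn_Ioo_of_le hst.le).1 h)
        (Filter.Eventually.of_forall fun x => by positivity)]
  rw [← ENNReal.ofReal_mul hMp]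
  apply le_antisymm
  · apply bmoNorm_le
    intro s t hs hst _
    refine bmoOsc_le_ofReal hp0 hB hst (intervalIntegrable_logProfile hs hst α) ?_
    rw [hlint s t hs hst, hBp, mul_comm, ← (abs_mul_rpow_neg_log hp0 α).2]
    exact ENNReal.ofReal_le_ofReal (logProfile_convex_le (convexOn_abs_rpow hp) hcont
      (abs_mul_rpow_neg_log hp0 α).1 hs hst).2
  · refine (ofReal_le_bmoOsc hp0 hB hab (intervalIntegrable_logProfile le_rfl hab α) ?_).trans
      (bmoOsc_le_bmoNorm le_rfl hab le_rfl)
    rw [hlint a b le_rfl hab, hBp, integral_comp_logProfile (fun x => |x| ^ p) hab,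
      (abs_mul_rpow_neg_log hp0 α).2, mul_comm]

end extremal

/-! ### The John–Nirenberg constant -/

section johnNirenberg

variable {φ : ℝ → ℝ} {a b : ℝ} {p : ℝ}

theorem bmoNorm_clampAt_le (hp : 1 ≤ p) (hφ : IntervalIntegrable φ volume a b) {N : ℝ}
    (hN : 0 ≤ N) : bmoNorm p (fun x => clampAt N (φ x)) (Ioo a b) ≤ bmoNorm p φ (Ioo a b) := by
  apply bmoNorm_le
  intro s t hs hst ht
  refine le_trans ?_ (bmoOsc_le_bmoNorm hs hst ht)
  have h := hφ.mono_Icc hs hst.le ht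
  have h1 : IntervalIntegrable (fun x => clampAt N (φ x)) volume s t :=
    h.comp_clampAt hN hst.le continuous_id
  rw [bmoOsc_Ioo hst h, bmoOsc_Ioo hst h1]
  have hp0 : 0 < p := by linarith
  refine ENNReal.rpow_le_rpow (ENNReal.div_le_div_right ?_ _) (by positivity)
  refine le_trans (le_of_eq ?_) (ofReal_integral_clampAt_le hp hN hst h)
  have hc : Continuous fun v : ℝ => |v - (∫ y in s..t, clampAt N (φ y)) / (t - s)| ^ p :=
    (continuous_abs.comp (continuous_sub_right _)).rpow_const fun _ => Or.inr hp0.le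
  have hi := h.comp_clampAt hN hst.le hc
  generalize (∫ y in s..t, clampAt N (φ y)) / (t - s) = m at hi ⊢
  rw [intervalIntegral.integral_of_le hst.le, integral_Ioc_eq_integral_Ioo,
    ofReal_integral_eq_lintegral_ofReal
      ((intervalIntegrable_iff_integrableOn_Ioo_of_le hst.le).1 hi)
      (Filter.Eventually.of_forall fun x => by positivity)]

theorem aInftyChar_clampAt_lt_top (hφ : IntervalIntegrable φ volume a b) {N : ℝ}
    (hN : 0 ≤ N) : aInftyChar (fun x => Real.exp (clampAt N (φ x))) (Ioo a b) < ⊤ := by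
  refine lt_of_le_of_lt (aInftyChar_le (B := ENNReal.ofReal (Real.exp N * Real.exp N)) ?_)
    ENNReal.ofReal_lt_top
  intro s t hs hst ht
  have h := hφ.mono_Icc hs hst.le ht
  have h1 : IntervalIntegrable (fun x => clampAt N (φ x)) volume s t :=
    h.comp_clampAt hN hst.le continuous_id
  have h2 := h.comp_clampAt hN hst.le Real.continuous_exp
  have hts := sub_pos.2 hst
  rw [aInftyRatio_eq hst h1 h2]
  apply ENNReal.ofReal_le_ofReal
  have h3 : ∫ x in s..t, Real.exp (clampAt N (φ x)) ≤ ∫ x in s..t, Real.exp N :=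
    intervalIntegral.integral_mono_on hst.le h2 intervalIntegrable_const fun x _ =>
      Real.exp_le_exp.2 (abs_le.1 (abs_clampAt_le hN _)).2
  have h4 : ∫ x in s..t, -N ≤ ∫ x in s..t, clampAt N (φ x) :=
    intervalIntegral.integral_mono_on hst.le intervalIntegrable_const h1 fun x _ =>
      (abs_le.1 (abs_clampAt_le hN _)).1
  rw [intervalIntegral.integral_const, smul_eq_mul] at h3 h4
  rw [expRatio]
  gcongr
  · rw [div_le_iff₀ hts]; linarith
  · rw [neg_le, le_div_iff₀ hts]; linarith

theorem intervalIntegrable_of_bmoOsc_ne_top (hab : a < b) (h : bmoOsc p φ (Ioo a b) ≠ ⊤) :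
    IntervalIntegrable φ volume a b := by
  rw [intervalIntegrable_iff_integrableOn_Ioo_of_le hab.le]
  by_contra hc
  exact h (by rw [bmoOsc, if_neg hc])

/-- Above the threshold the lower `BMO^p` bound gives `ξ⁺ ≤ ε / M(-1)^{1/p} < 1`, and `C = e^{-ξ⁺} /
(1 - ξ⁺)` is then controlled. -/
theorem ExactChar.le_of_bmoNorm_le {C ε : ℝ} (H : ExactChar φ a b C) (hab : a < b) (hp1 : 1 < p)
    (hp2 : p < 2) (hε0 : 0 ≤ ε) (hε : ε < expMoment p (-1) ^ (1 / p))
    (h : bmoNorm p φ (Ioo a b) ≤ ENNReal.ofReal ε) :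
    C ≤ max (Real.exp (p - 2) / (p - 1)) (1 / (1 - ε / expMoment p (-1) ^ (1 / p))) := by
  have hM := Real.rpow_pos_of_pos (expMoment_neg_one_pos (by linarith : 0 < p)) (1 / p)
  rcases le_total C (Real.exp (p - 2) / (p - 1)) with hC | hC
  · exact hC.trans (le_max_left _ _)
  · refine le_trans ?_ (le_max_right _ _)
    have hξ := two_sub_le_xiPlus hp1 hp2.le H.one_le hC
    have h1 := (H.le_bmoNorm hab hp1 hp2.le (by linarith) hξ).trans h
    rw [← ENNReal.ofReal_mul hM.le, ENNReal.ofReal_le_ofReal_iff hε0, mul_comm,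
      ← le_div_iff₀ hM] at h1
    have h2 : ε / expMoment p (-1) ^ (1 / p) < 1 := (div_lt_one hM).2 hε
    rw [le_div_iff₀ (by linarith)]
    have hC0 := H.one_le
    calc C * (1 - ε / expMoment p (-1) ^ (1 / p)) ≤ C * (1 - xiPlus C) := by gcongr
      _ = Real.exp (-xiPlus C) := (xiPlus_spec H.one_le).2.symm
      _ ≤ 1 := Real.exp_le_one_iff.2 (by linarith)

theorem johnNirenbergHolds_of_lt (hp1 : 1 < p) (hp2 : p < 2) {ε : ℝ≥0}
    (hε : (ε : ℝ) < expMoment p (-1) ^ (1 / p)) : JohnNirenbergHolds p ε := by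
  set K := max (Real.exp (p - 2) / (p - 1)) (1 / (1 - ε / expMoment p (-1) ^ (1 / p))) with hK
  have hK0 : 0 ≤ K := le_max_of_le_left (div_nonneg (Real.exp_pos _).le (by linarith))
  refine ⟨K.toNNReal, fun φ _ hφ c d hcd hsub => ?_⟩
  obtain ⟨hc, hd⟩ := (Ioo_subset_Ioo_iff hcd).1 hsub
  have hdc := sub_pos.2 hcd
  have h01 : IntervalIntegrable φ volume 0 1 := by
    refine intervalIntegrable_of_bmoOsc_ne_top (p := p) zero_lt_one (ne_top_of_le_ne_top ?_
      ((bmoOsc_le_bmoNorm le_rfl zero_lt_one le_rfl).trans hφ))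
    exact ENNReal.coe_ne_top
  have hi := h01.mono_Icc hc hcd.le hd
  have h1 : ∀ n : ℕ, ∫ x in c..d, Real.exp (clampAt n (φ x) -
      (∫ y in c..d, clampAt n (φ y)) / (d - c)) ≤ K * (d - c) := by
    intro n
    have hn : (0 : ℝ) ≤ n := n.cast_nonneg
    -- The weight `e^φ` is not known to be in `A_∞`. Truncations are, with bounds depending on the
    -- level, and the estimate then replaces these by the uniform `K`.
    have hC := exactChar_of_aInftyChar_eq (φ := fun x => clampAt n (φ x)) zero_lt_one
      (ENNReal.ofReal_toReal (aInftyChar_clampAt_lt_top h01 hn).ne).symm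
    have h2 := hC.le_of_bmoNorm_le zero_lt_one hp1 hp2 ε.coe_nonneg hε
      (((bmoNorm_clampAt_le hp1.le h01 hn).trans hφ).trans_eq ENNReal.ofReal_coe_nnreal.symm)
    have h3 := (expRatio_le_iff hcd).2 (hC.reverseJensen c d hc hcd hd)
    rw [expRatio_eq_integral, div_le_iff₀ hdc] at h3
    exact h3.trans (mul_le_mul_of_nonneg_right h2 hdc.le)
  have h2 := lintegral_le_of_clampAt Real.continuous_exp (fun x => (Real.exp_pos x).le) hcd hi h1
  rw [setAverage_Ioo hcd, setLAverage_eq, Real.volume_Ioo]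
  set m := (∫ y in c..d, φ y) / (d - c)
  have h3 : ∀ x, ENNReal.ofReal (Real.exp (φ x)) =
      ENNReal.ofReal (Real.exp m) * ENNReal.ofReal (Real.exp (φ x - m)) := fun x => by
    rw [← ENNReal.ofReal_mul (Real.exp_pos _).le, ← Real.exp_add, add_sub_cancel]
  simp_rw [h3]
  rw [lintegral_const_mul' _ _ ENNReal.ofReal_ne_top]
  refine ENNReal.div_le_of_le_mul ?_
  rw [mul_right_comm, mul_comm]
  refine mul_le_mul_left (h2.trans_eq ?_) _
  rw [ENNReal.ofReal_mul hK0]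
  rfl

theorem not_intervalIntegrable_exp_logProfile_one :
    ¬IntervalIntegrable (fun t => Real.exp (logProfile 0 1 t)) volume 0 1 := by
  intro h
  have h1 : IntervalIntegrable (fun x : ℝ => x⁻¹) volume 0 1 := by
    refine h.congr fun t ht => ?_
    rw [uIoc_of_le zero_le_one] at ht
    simp only [logProfile]
    rw [sub_zero, one_mul, Real.exp_neg, Real.exp_log ht.1]
  rw [intervalIntegrable_inv_iff] at h1
  simp at h1

theorem le_of_johnNirenbergHolds (hp : 1 ≤ p) {ε : ℝ≥0} (h : JohnNirenbergHolds p ε) :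
    (ε : ℝ≥0∞) ≤ ENNReal.ofReal (expMoment p (-1) ^ (1 / p)) := by
  by_contra! hlt
  obtain ⟨K, hK⟩ := h
  have hi := (intervalIntegrable_iff_integrableOn_Ioo_of_le zero_le_one).1
    (intervalIntegrable_logProfile le_rfl zero_lt_one (a := 0) 1)
  -- The exponent `α = 1` is the borderline: `-log t` has norm `M(-1)^{1/p}`, while its exponential
  -- `1/t` is not integrable.
  have h1 := hK (logProfile 0 1) hi.locallyIntegrableOn
    (by rw [bmoNorm_logProfile hp 1 zero_lt_one]; simpa using hlt.le) 0 1 zero_lt_one le_rfl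
  rw [setLAverage_eq, Real.volume_Ioo] at h1
  simp only [sub_zero, ENNReal.ofReal_one, div_one] at h1
  refine not_intervalIntegrable_exp_logProfile_one ?_
  rw [intervalIntegrable_iff_integrableOn_Ioo_of_le zero_le_one]
  refine ⟨Real.continuous_exp.comp_aestronglyMeasurable hi.aestronglyMeasurable, ?_⟩
  rw [hasFiniteIntegral_iff_ofReal (Filter.Eventually.of_forall fun x => (Real.exp_pos _).le)]
  exact h1.trans_lt (ENNReal.mul_lt_top ENNReal.coe_lt_top ENNReal.ofReal_lt_top)

theorem johnNirenbergConst_eq (hp1 : 1 < p) (hp2 : p < 2) :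
    johnNirenbergConst p = ENNReal.ofReal (expMoment p (-1) ^ (1 / p)) := by
  apply le_antisymm
  · exact iSup₂_le fun ε hε => le_of_johnNirenbergHolds hp1.le hε
  · refine ENNReal.le_of_forall_nnreal_lt fun ε hε => ?_
    refine le_iSup₂_of_le ε (johnNirenbergHolds_of_lt hp1 hp2 ?_) le_rfl
    rw [← ENNReal.ofReal_coe_nnreal] at hε
    exact (ENNReal.ofReal_lt_ofReal_iff_of_nonneg ε.coe_nonneg).1 hε

end johnNirenberg

/-! ### Sharpness and conclusion -/

theorem exists_attaining {a b C α p : ℝ} (hab : a < b) (hα : α < 1)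
    (h : Real.exp (-α) = C * (1 - α)) (hp : 1 ≤ p) :
    ∃ φ : ℝ → ℝ, MemAInfty (fun t => Real.exp (φ t)) (Ioo a b) ∧
      aInftyChar (fun t => Real.exp (φ t)) (Ioo a b) = ENNReal.ofReal C ∧
      bmoNorm p φ (Ioo a b) =
        ENNReal.ofReal (expMoment p (-1) ^ (1 / p)) * ENNReal.ofReal |α| := by
  refine ⟨logProfile a α, memAInfty_logProfile hα hab, ?_, bmoNorm_logProfile hp α hab⟩
  rw [aInftyChar_logProfile hα hab, h, mul_div_cancel_right₀ _ (by linarith)]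

theorem mainTheorem5 (a b : ℝ) (hab : a < b) :
    -- the estimates, with `C` the exact characteristic of `e^φ`
    (∀ (φ : ℝ → ℝ) (C : ℝ), MemAInfty (fun t => Real.exp (φ t)) (Ioo a b) →
      aInftyChar (fun t => Real.exp (φ t)) (Ioo a b) = ENNReal.ofReal C →
        (ENNReal.ofReal (xiPlus C) ≤ bmoNorm 2 φ (Ioo a b) ∧
          bmoNorm 2 φ (Ioo a b) ≤ ENNReal.ofReal |xiMinus C|) ∧
        ENNReal.ofReal (kFun C) ≤ bmoNorm 1 φ (Ioo a b) ∧
        (∀ p : ℝ, 1 < p → p < 2 → Real.exp (p - 2) / (p - 1) ≤ C →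
          johnNirenbergConst p * ENNReal.ofReal (xiPlus C) ≤ bmoNorm p φ (Ioo a b))) ∧
    -- sharpness of the lower and of the upper bound for `p = 2`
    (∀ C : ℝ, 1 ≤ C →
      (∃ φ : ℝ → ℝ, MemAInfty (fun t => Real.exp (φ t)) (Ioo a b) ∧
        aInftyChar (fun t => Real.exp (φ t)) (Ioo a b) = ENNReal.ofReal C ∧
        bmoNorm 2 φ (Ioo a b) = ENNReal.ofReal (xiPlus C)) ∧
      (∃ φ : ℝ → ℝ, MemAInfty (fun t => Real.exp (φ t)) (Ioo a b) ∧
        aInftyChar (fun t => Real.exp (φ t)) (Ioo a b) = ENNReal.ofReal C ∧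
        bmoNorm 2 φ (Ioo a b) = ENNReal.ofReal |xiMinus C|)) ∧
    -- sharpness of the bound for `1 < p < 2`
    (∀ p C : ℝ, 1 < p → p < 2 → Real.exp (p - 2) / (p - 1) ≤ C →
      ∃ φ : ℝ → ℝ, MemAInfty (fun t => Real.exp (φ t)) (Ioo a b) ∧
        aInftyChar (fun t => Real.exp (φ t)) (Ioo a b) = ENNReal.ofReal C ∧
        bmoNorm p φ (Ioo a b) = johnNirenbergConst p * ENNReal.ofReal (xiPlus C)) := by
  -- The variance of `-log u` on `(0, 1)` is `1`, so no constant appears for `p = 2`.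
  have hM2 : ENNReal.ofReal (expMoment 2 (-1) ^ ((1 : ℝ) / 2)) = 1 := by
    rw [expMoment_two_neg_one, Real.one_rpow, ENNReal.ofReal_one]
  refine ⟨fun φ C _ hC => ?_, fun C hC => ⟨?_, ?_⟩, fun p C hp1 hp2 hC => ?_⟩
  · have H := exactChar_of_aInftyChar_eq hab hC
    refine ⟨⟨?_, H.bmoNorm_two_le hab⟩, H.kFun_le_bmoNorm hab, fun p hp1 hp2 hpC => ?_⟩
    -- For `C = 1` the normalization by `ξ⁺ = 0` is impossible, but the bound is trivial.
    · rcases (xiPlus_spec H.one_le).1.1.eq_or_lt with h0 | h0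
      · rw [← h0]; simp
      · simpa only [hM2, one_mul] using H.le_bmoNorm hab one_lt_two le_rfl h0 (by linarith)
    · have hξ := two_sub_le_xiPlus hp1 hp2.le H.one_le hpC
      rw [johnNirenbergConst_eq hp1 hp2]
      exact H.le_bmoNorm hab hp1 hp2.le (by linarith) hξ
  · have hξ := xiPlus_spec hC
    simpa only [hM2, one_mul, abs_of_nonneg hξ.1.1] using
      exists_attaining hab hξ.1.2 hξ.2 one_le_two
  · have hξ := xiMinus_spec hC
    simpa only [hM2, one_mul] using
      exists_attaining hab (hξ.1.trans_lt zero_lt_one) hξ.2 one_le_two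
  · have hC1 := (one_lt_threshold hp1 hp2).le.trans hC
    have hξ := xiPlus_spec hC1
    rw [johnNirenbergConst_eq hp1 hp2]
    simpa only [abs_of_nonneg hξ.1.1] using exists_attaining hab hξ.1.2 hξ.2 hp1.le
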